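/- **Universal embedding theorem.** *The theory $\mathbf{PR}$.* Objects are generated from $\mathbb 1,\mathbb N$ by $(A,B)\mapsto A\times B$. Map terms are generated by identities, composition, terminal maps $\Pi_A$, projections $\ell,r$, induced maps $(f,g)$, $0:\mathbb 1\to\mathbb N$, $s:\mathbb N\to\mathbb N$ and iteration $f:A\to A\ \mapsto\ f^{\S}:A\times\mathbb N\to A$. Derivable equality is the smallest congruence for composition and pairing which makes $\mathbf{PR}$ a category with terminal object $\mathbb 1$ and products $\times$ (with surjective pairing) and satisfies $f^\S(a,0)=a$, $f^\S(a,s\,n)=f(f^\S(a,n))$ and Freyd's uniqueness: $h(a,0)=f(a)$ and $h(a,s\,n)=g(h(a,n))$ imply $h=g^\S\circ(f\times\mathbb N)$. A *cartesian p.r. category* is a category with a terminal object, binary products, and an NNO with iteration and this uniqueness; a *cartesian p.r. functor* preserves all of this up to the canonical isomorphisms. A *predicate* is a map $\chi:A\to\mathbb N$ with $\mathrm{sign}\circ\chi=\chi$; $\doteq$, $\wedge$, $\Rightarrow$ are the usual p.r. terms. *The theory $\mathbf{PRa}$* has objects $\{A:\chi\}$, $\chi$ a predicate (term) on $A$; maps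 $\{A:\chi\}\to\{B:\varphi\}$ are the $\mathbf{PR}$-maps $f:A\to B$ with $\mathbf{PR}\vdash\chi(a)\Rightarrow\varphi(f(a))$, and $f=g$ if $\mathbf{PR}\vdash\chi(a)\Rightarrow f(a)\doteq g(a)$. $\mathbf{PR}$ embeds in it by $A\mapsto\{A:\mathrm{true}\}$. *The universal object.* Fix the Gödel numbering of expressions by Cantor pairing $J$ on $\mathbb N$ in which $\ulcorner\sigma_k\urcorner=1+J(0,k)$ for the symbols $\sigma_0=0,\ \sigma_1=s,\ \sigma_2=\bot$; $\ulcorner(v\circ u)\urcorner=1+J(1,J(v,u))$; and $\langle x;y\rangle=\ulcorner(x,y)\urcorner=1+J(2,J(x,y))$. Internal numerals are $\nu(0)=\ulcorner0\urcorner$, $\nu(s\,n)=\ulcorner(s\circ\nu(n))\urcorner$. $X\subset\mathbb N$ is the p.r. predicative set of internal numerals and nested pairs of them, $\bot\notin X$ is the code of the undefined value, and $X_\bot=X\cup\{\bot\}$. *The universe monoid $\mathbf{PRX}\subset\mathbf{PR}(\mathbb N,\mathbb N)$* is the smallest set of endomaps of $\mathbb N$ (with the equality of $\mathbf{PR}$)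 which contains $\mathring{\mathrm{id}}:x\mapsto x$ and $\mathring\Pi:x\mapsto\nu0$ $(x\in X)$, $\mathring0:\nu0\mapsto\nu0$, $\mathring s:\nu n\mapsto\nu(s\,n)$, $\mathring\ell:\langle x;y\rangle\mapsto x$, $\mathring r:\langle x;y\rangle\mapsto y$, and is closed under composition, $\langle f.g\rangle:x\mapsto\langle f x;g x\rangle$, $\langle f\dot\times g\rangle:\langle x;y\rangle\mapsto\langle fx;gy\rangle$ and $f^{\dot\S}:\langle x;\nu n\rangle\mapsto f^n(x)$, all of these with value $\bot$ where the given clause does not apply or a component is undefined. *The theory $\mathbf{PRXa}$* has as objects the predicative subobjects $\{X:\chi\}$ of $X$, $\chi$ a predicate (term) on $\mathbb N$; its maps are the $\mathbf{PRa}$-maps between these subsets of $\mathbb N$ which are given by elements of $\mathbf{PRX}$. The category $\mathbf{PRX}$ is the full subcategory on objects generated from $X$, $\nu\mathbb 1=\{\nu0\}$, $\nu\mathbb N=\{\nu n\}$ by $\langle A\dot\times B\rangle$. For each object $A$ of $\mathbf{PR}$ let $\nu_A:A\to X$ be the numeralisation ($\nu$ on components, pairs going to coded pairs), $\nu A$ its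 image in $\mathbf{PRX}$, and $\nu\{A:\chi\}=\{z\in \mathrm{im}\,\nu_A:\chi(\nu_A^{-1}z)\}$ in $\mathbf{PRXa}$. For $f:A\to B$ in $\mathbf{PR}$ let $\dot f=\nu_B\circ f\circ\nu_A^{-1}$ on $\mathrm{im}\,\nu_A$ and $\dot f=\bot$ elsewhere. **Theorem.** There are functors $\mathbf I_0:\mathbf{PR}\to\mathbf{PRX}$, $A\mapsto\nu A$, $f\mapsto\dot f$, and $\mathbf I:\mathbf{PRa}\to\mathbf{PRXa}$, $\{A:\chi\}\mapsto\nu\{A:\chi\}$, $f\mapsto\dot f$, such that: 1. $\mathbf{PRX}$ is a cartesian p.r. category, with structure given by $\mathring\Pi,\mathring\ell,\mathring r,\langle f.g\rangle,\mathring0,\mathring s,f^{\dot\S}$ on $\nu\mathbb 1,\nu\mathbb N,\langle A\dot\times B\rangle$. Every $\dot f$ lies in $\mathbf{PRX}$, and $\mathbf I_0$ is a faithful cartesian p.r. functor. In $\mathbf{PR}(\mathbb N,\mathbb N)$: $\dot f=\dot g$ iff $f=g$; $(g\circ f)^{\cdot}=\dot g\circ\dot f$, $(f,g)^\cdot=\langle\dot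 f.\dot g\rangle$, $(f\times g)^\cdot=\langle\dot f\dot\times\dot g\rangle$, $\dot 0=\mathring 0$, $\dot s=\mathring s$, and $\dot\Pi_A,\dot\ell,\dot r,(f^\S)^\cdot$ are $\mathring\Pi,\mathring\ell,\mathring r,(\dot f)^{\dot\S}$ composed with $(\mathrm{id})^\cdot$ of their domain. 2. $\mathbf{PRXa}$ inherits the structure of $\mathbf{PRa}$: it is cartesian p.r., with structure given by the same operations, and $\mathbf{PRX}\to\mathbf{PRXa}$ is a cartesian p.r. functor; $\nu\mathbb 2=\nu\{n\in\mathbb N:n\le1\}$ is a truth object, i.e. a sum of $\mathrm{false}=\nu0$ and $\mathrm{true}=\nu1$ over which products distribute; every object $\nu\{A:\chi\}$ has an equality predicate $e:\nu\{A:\chi\}\times\nu\{A:\chi\}\to\nu\mathbb 2$, with $e\circ(f,g)=\mathrm{true}$ iff $f=g$; for every object $P$ and every $\mathbf{PR}$-predicate $c$ on $\mathbb N$ there is a subobject of $P$ (included by $\mathring{\mathrm{id}}$) through which a map $f:Q\to P$ factors iff $Q(z)\Rightarrow c(f(z))$ is derivable; any two maps $f,g:P\to Q$ have an equaliser which is a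 predicative subobject of $P$ (included by $\mathring{\mathrm{id}}$). $\mathbf{PRa}$ and $\mathbf{PRXa}$ have all finite limits. 3. $\mathbf I$ extends $\mathbf I_0$ (up to the natural isomorphism given by $\mathring{\mathrm{id}}$), and it is a cartesian p.r. functor, preserves finite limits, is faithful and is injective on objects. 4. $\mathbf I$ is full, and it is an isomorphism of categories, in both directions by cartesian p.r. functors, from $\mathbf{PRa}$ onto its image $\mathbf I[\mathbf{PRa}]$, which is a cartesian p.r. category whose inclusion in $\mathbf{PRXa}$ is a cartesian p.r. functor. 5. Map equality is that of $\mathbf{PR}(\mathbb N,\mathbb N)$: elements $u,v\in\mathbf{PRX}$ which define maps $X\to Q$ in $\mathbf{PRXa}$ define the same map iff $u=v$ in $\mathbf{PR}$; and every map of $\mathbf{PRXa}$ whose domain is an object of $\mathbf{PRX}$ or some $\nu\{A:\chi\}$ is given by exactly one element of $\mathbf{PRX}$ with value $\bot$ outside the domain. 6. In $\mathbf{PRa}$ the numeralisations $\nu_A:\{A:\chi\}\cong\nu\{A:\chi\}$ are isomorphisms, natural with respect to $f$ and $\mathbf I f$; each object of $\mathbf{PRXa}$ is included by $\mathring{\mathrm{id}}$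 as a subobject of $X\subset X_\bot\subset\mathbb N$; and every element of $\mathbf{PRX}$ maps $X_\bot$ into $X_\bot$. -/

import Mathlib

open CategoryTheory CategoryTheory.Limits

/-- A cartesian p.r. structure on a category: a terminal object, binary products, and a natural
numbers object with iteration of endomaps and uniqueness of the initialised iterated. -/
structure CartesianPR (C : Type*) [Category C] where
  one : C
  bang : ∀ A : C, A ⟶ one
  bang_uniq : ∀ {A : C} (f : A ⟶ one), f = bang A
  prod : C → C → C
  fst : ∀ A B : C, prod A B ⟶ A
  snd : ∀ A B : C, prod A B ⟶ B
  lift : ∀ {D A B : C}, (D ⟶ A) → (D ⟶ B) → (D ⟶ prod A B)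
  lift_fst : ∀ {D A B : C} (f : D ⟶ A) (g : D ⟶ B), lift f g ≫ fst A B = f
  lift_snd : ∀ {D A B : C} (f : D ⟶ A) (g : D ⟶ B), lift f g ≫ snd A B = g
  lift_uniq : ∀ {D A B : C} (h : D ⟶ prod A B), lift (h ≫ fst A B) (h ≫ snd A B) = h
  nat : C
  zero : one ⟶ nat
  succ : nat ⟶ nat
  iter : ∀ {A : C}, (A ⟶ A) → (prod A nat ⟶ A)
  iter_zero : ∀ {A : C} (f : A ⟶ A), lift (𝟙 A) (bang A ≫ zero) ≫ iter f = 𝟙 A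
  iter_succ : ∀ {A : C} (f : A ⟶ A),
    lift (fst A nat) (snd A nat ≫ succ) ≫ iter f = iter f ≫ f
  iter_uniq : ∀ {A B : C} (f : A ⟶ B) (g : B ⟶ B) (h : prod A nat ⟶ B),
    lift (𝟙 A) (bang A ≫ zero) ≫ h = f →
    lift (fst A nat) (snd A nat ≫ succ) ≫ h = h ≫ g →
    h = lift (fst A nat ≫ f) (snd A nat) ≫ iter g

/-- A functor between cartesian p.r. categories is a cartesian p.r. functor if it preserves the
terminal object, binary products, the natural numbers object and iteration. -/
structure CartesianPR.IsPRFunctor {C D : Type*} [Category C] [Category D]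
    (S : CartesianPR C) (T : CartesianPR D) (F : C ⥤ D) : Prop where
  one : IsIso (T.bang (F.obj S.one))
  prod : ∀ A B : C, IsIso (T.lift (F.map (S.fst A B)) (F.map (S.snd A B)))
  nat : ∃ i : T.nat ≅ F.obj S.nat,
    T.bang (F.obj S.one) ≫ T.zero ≫ i.hom = F.map S.zero ∧
    T.succ ≫ i.hom = i.hom ≫ F.map S.succ ∧
    ∀ {A : C} (f : A ⟶ A),
      T.lift (F.map (S.fst A S.nat)) (F.map (S.snd A S.nat) ≫ i.inv) ≫ T.iter (F.map f) =
        F.map (S.iter f)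

/-- The objects of the theory of primitive recursion. -/
inductive PR : Type
  | one : PR
  | nat : PR
  | prod : PR → PR → PR

namespace PR

/-- The map terms of the theory of primitive recursion. -/
inductive Term : PR → PR → Type
  | ident (A : PR) : Term A A
  | comp {A B C : PR} (g : Term B C) (f : Term A B) : Term A C
  | bang (A : PR) : Term A one
  | fst (A B : PR) : Term (prod A B) A
  | snd (A B : PR) : Term (prod A B) B
  | pair {D A B : PR} (f : Term D A) (g : Term D B) : Term D (prod A B)
  | zero : Term one nat
  | succ : Term nat nat
  | iter {A : PR} (f : Term A A) : Term (prod A nat) A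

infixr:80 " ∘ₜ " => Term.comp

open Term

/-- Derivable equality of map terms in the theory of primitive recursion. -/
inductive Eqv : {A B : PR} → Term A B → Term A B → Prop
  | refl {A B : PR} (f : Term A B) : Eqv f f
  | symm {A B : PR} {f g : Term A B} : Eqv f g → Eqv g f
  | trans {A B : PR} {f g h : Term A B} : Eqv f g → Eqv g h → Eqv f h
  | comp_congr {A B C : PR} {g g' : Term B C} {f f' : Term A B} :
      Eqv g g' → Eqv f f' → Eqv (g ∘ₜ f) (g' ∘ₜ f')
  | assoc {A B C D : PR} (h : Term C D) (g : Term B C) (f : Term A B) :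
      Eqv (h ∘ₜ g ∘ₜ f) ((h ∘ₜ g) ∘ₜ f)
  | id_comp {A B : PR} (f : Term A B) : Eqv (ident B ∘ₜ f) f
  | comp_id {A B : PR} (f : Term A B) : Eqv (f ∘ₜ ident A) f
  | bang_uniq {A : PR} (f : Term A one) : Eqv f (bang A)
  | pair_congr {D A B : PR} {f f' : Term D A} {g g' : Term D B} :
      Eqv f f' → Eqv g g' → Eqv (pair f g) (pair f' g')
  | fst_pair {D A B : PR} (f : Term D A) (g : Term D B) : Eqv (fst A B ∘ₜ pair f g) f
  | snd_pair {D A B : PR} (f : Term D A) (g : Term D B) : Eqv (snd A B ∘ₜ pair f g) g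
  | surj_pair {D A B : PR} (h : Term D (prod A B)) :
      Eqv (pair (fst A B ∘ₜ h) (snd A B ∘ₜ h)) h
  | iter_zero {A : PR} (f : Term A A) : Eqv (iter f ∘ₜ pair (ident A) (zero ∘ₜ bang A)) (ident A)
  | iter_succ {A : PR} (f : Term A A) :
      Eqv (iter f ∘ₜ pair (fst A nat) (succ ∘ₜ snd A nat)) (f ∘ₜ iter f)
  | iter_uniq {A B : PR} (f : Term A B) (g : Term B B) (h : Term (prod A nat) B) :
      Eqv (h ∘ₜ pair (ident A) (zero ∘ₜ bang A)) f →
      Eqv (h ∘ₜ pair (fst A nat) (succ ∘ₜ snd A nat)) (g ∘ₜ h) →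
      Eqv h (iter g ∘ₜ pair (f ∘ₜ fst A nat) (snd A nat))

theorem Eqv.iter_congr {A : PR} {f g : Term A A} (h : Eqv f g) : Eqv (iter f) (iter g) := by
  refine (Eqv.iter_uniq (ident A) g (iter f) (Eqv.iter_zero f)
    ((Eqv.iter_succ f).trans (.comp_congr h (.refl _)))).trans ?_
  refine (Eqv.comp_congr (.refl _) ?_).trans (.comp_id _)
  refine (Eqv.pair_congr ?_ ?_).trans (.surj_pair (ident _))
  · exact (Eqv.id_comp _).trans (Eqv.comp_id _).symm
  · exact (Eqv.comp_id _).symm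

/-- Map terms up to derivable equality. -/
instance termSetoid (A B : PR) : Setoid (Term A B) := ⟨Eqv, .refl, .symm, .trans⟩

/-- The theory of primitive recursion as a category. -/
instance : Category PR where
  Hom A B := Quotient (termSetoid A B)
  id A := ⟦ident A⟧
  comp f g := Quotient.map₂ (fun f g => g ∘ₜ f) (fun _ _ h _ _ k => .comp_congr k h) f g
  id_comp := by rintro A B ⟨f⟩; exact Quotient.sound (.comp_id f)
  comp_id := by rintro A B ⟨f⟩; exact Quotient.sound (.id_comp f)
  assoc := by rintro A B C D ⟨f⟩ ⟨g⟩ ⟨h⟩; exact Quotient.sound (.assoc h g f)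

/-- The map of the theory denoted by a map term. -/
def cls {A B : PR} (f : Term A B) : A ⟶ B := Quotient.mk _ f

theorem mk_eq {A B : PR} {f g : Term A B} : cls f = cls g ↔ Eqv f g :=
  ⟨fun h => Quotient.exact h, fun h => Quotient.sound h⟩

theorem mk_surj {A B : PR} (f : A ⟶ B) : ∃ t : Term A B, cls t = f := Quotient.exists_rep f

theorem mk_comp {A B C : PR} (f : Term A B) (g : Term B C) : cls (g ∘ₜ f) = cls f ≫ cls g := rfl

theorem mk_id (A : PR) : cls (ident A) = 𝟙 A := rfl

/-- The cartesian p.r. structure of the theory of primitive recursion. -/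
def cartesianPR : CartesianPR PR where
  one := one
  bang A := cls (bang A)
  bang_uniq := by rintro A ⟨f⟩; exact Quotient.sound (.bang_uniq f)
  prod := prod
  fst A B := cls (fst A B)
  snd A B := cls (snd A B)
  lift f g := Quotient.map₂ pair (fun _ _ h _ _ k => .pair_congr h k) f g
  lift_fst := by rintro D A B ⟨f⟩ ⟨g⟩; exact Quotient.sound (.fst_pair f g)
  lift_snd := by rintro D A B ⟨f⟩ ⟨g⟩; exact Quotient.sound (.snd_pair f g)
  lift_uniq := by rintro D A B ⟨h⟩; exact Quotient.sound (.surj_pair h)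
  nat := nat
  zero := cls zero
  succ := cls succ
  iter f := Quotient.map iter (fun _ _ h => Eqv.iter_congr h) f
  iter_zero := by rintro A ⟨f⟩; exact Quotient.sound (.iter_zero f)
  iter_succ := by rintro A ⟨f⟩; exact Quotient.sound (.iter_succ f)
  iter_uniq := by
    rintro A B ⟨f⟩ ⟨g⟩ ⟨h⟩ h0 h1
    exact Quotient.sound (.iter_uniq f g h (Quotient.exact h0) (Quotient.exact h1))

end PR

namespace PR

open Term

/-! ### Primitive recursive arithmetic

Terms with a common domain `G` are written as functions of free variables ranging over `G`. -/

/-- The truth value `0` (false), and the number zero, on any domain. -/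
def zeroT (G : PR) : Term G nat := zero ∘ₜ bang G

/-- The truth value `1` (true) on any domain. -/
def trueT (G : PR) : Term G nat := succ ∘ₜ zeroT G

/-- The full scheme of primitive recursion:
`f (a, 0) = g a` and `f (a, s n) = h ((a, n), f (a, n))`. -/
def prec {A B : PR} (g : Term A B) (h : Term (prod (prod A nat) B) B) : Term (prod A nat) B :=
  snd (prod A nat) B ∘ₜ
    iter (pair (pair (fst A nat ∘ₜ fst _ _) (succ ∘ₜ snd A nat ∘ₜ fst _ _)) h) ∘ₜ
      pair (pair (pair (ident A) (zeroT A)) g ∘ₜ fst A nat) (snd A nat)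

/-- Definition by cases on a numerical argument: `f (a, 0) = g a`, `f (a, s n) = h (a, n)`. -/
def caseT {A B : PR} (g : Term A B) (h : Term (prod A nat) B) : Term (prod A nat) B :=
  prec g (h ∘ₜ fst _ _)

/-- `if c then u else v`. -/
def cond {G B : PR} (c : Term G nat) (u v : Term G B) : Term G B :=
  caseT v (u ∘ₜ fst G nat) ∘ₜ pair (ident G) c

/-- Logical negation: `0 ↦ 1`, `s n ↦ 0`. -/
def neg : Term nat nat := caseT (trueT nat) (zeroT _) ∘ₜ pair (ident nat) (ident nat)

/-- `0 ↦ 0`, `s n ↦ 1`. -/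
def sign : Term nat nat := neg ∘ₜ neg

/-- The predecessor. -/
def pred : Term nat nat := caseT (zeroT nat) (snd nat nat) ∘ₜ pair (ident nat) (ident nat)

/-- Addition. -/
def add {G : PR} (u v : Term G nat) : Term G nat := iter succ ∘ₜ pair u v

/-- Truncated subtraction. -/
def sub {G : PR} (u v : Term G nat) : Term G nat := iter pred ∘ₜ pair u v

/-- Multiplication: `a * 0 = 0`, `a * s n = a * n + a`. -/
def mul {G : PR} (u v : Term G nat) : Term G nat :=
  prec (zeroT nat) (add (snd _ _) (fst nat nat ∘ₜ fst _ _)) ∘ₜ pair u v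

/-- Logical conjunction. -/
def and {G : PR} (u v : Term G nat) : Term G nat := sign ∘ₜ mul u v

/-- The predicate `u ≤ v`. -/
def le {G : PR} (u v : Term G nat) : Term G nat := neg ∘ₜ sub u v

/-- Implication of predicates. -/
def imp {G : PR} (u v : Term G nat) : Term G nat := neg ∘ₜ and u (neg ∘ₜ v)

/-- Disjunction of predicates. -/
def or {G : PR} (u v : Term G nat) : Term G nat := neg ∘ₜ and (neg ∘ₜ u) (neg ∘ₜ v)

/-- Predicative equality `u ≐ v`, componentwise on products. -/
def eqT : {G : PR} → (B : PR) → Term G B → Term G B → Term G nat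
  | G, one, _, _ => trueT G
  | _, nat, u, v => and (le u v) (le v u)
  | _, prod A B, u, v =>
      and (eqT A (fst A B ∘ₜ u) (fst A B ∘ₜ v)) (eqT B (snd A B ∘ₜ u) (snd A B ∘ₜ v))

/-- A predicate is a map with truth values. -/
def IsPred {A : PR} (c : Term A nat) : Prop := Eqv (sign ∘ₜ c) c

/-- The implication from `c` to `d` is derivable. -/
def Implies {A : PR} (c d : Term A nat) : Prop := Eqv (imp c d) (trueT A)

end PR

namespace PR

open Term

/-! ### Derived laws, as equations between maps -/

def hpair {D A B : PR} (f : D ⟶ A) (g : D ⟶ B) : D ⟶ prod A B := cartesianPR.lift f g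
def hfst (A B : PR) : prod A B ⟶ A := cls (fst A B)
def hsnd (A B : PR) : prod A B ⟶ B := cls (snd A B)
def hiter {A : PR} (f : A ⟶ A) : prod A nat ⟶ A := cartesianPR.iter f
def hZ (G : PR) : G ⟶ nat := cls (zeroT G)
def hS : nat ⟶ nat := cls succ

@[simp] theorem hpair_fst {D A B : PR} (f : D ⟶ A) (g : D ⟶ B) : hpair f g ≫ hfst A B = f :=
  cartesianPR.lift_fst f g
@[simp] theorem hpair_snd {D A B : PR} (f : D ⟶ A) (g : D ⟶ B) : hpair f g ≫ hsnd A B = g :=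
  cartesianPR.lift_snd f g
@[simp] theorem hpair_fst' {D A B C : PR} (f : D ⟶ A) (g : D ⟶ B) (k : A ⟶ C) :
    hpair f g ≫ hfst A B ≫ k = f ≫ k := by rw [← Category.assoc, hpair_fst]
@[simp] theorem hpair_snd' {D A B C : PR} (f : D ⟶ A) (g : D ⟶ B) (k : B ⟶ C) :
    hpair f g ≫ hsnd A B ≫ k = g ≫ k := by rw [← Category.assoc, hpair_snd]

theorem hpair_ext {D A B : PR} {f g : D ⟶ prod A B} (h : f ≫ hfst A B = g ≫ hfst A B)
    (k : f ≫ hsnd A B = g ≫ hsnd A B) : f = g := by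
  rw [← cartesianPR.lift_uniq f, ← cartesianPR.lift_uniq g]
  exact congrArg₂ _ h k

@[simp] theorem comp_hpair {E D A B : PR} (e : E ⟶ D) (f : D ⟶ A) (g : D ⟶ B) :
    e ≫ hpair f g = hpair (e ≫ f) (e ≫ g) := by
  apply hpair_ext <;> simp

@[simp] theorem comp_hpair' {E D A B C : PR} (e : E ⟶ D) (f : D ⟶ A) (g : D ⟶ B)
    (k : prod A B ⟶ C) : e ≫ hpair f g ≫ k = hpair (e ≫ f) (e ≫ g) ≫ k := by
  rw [← Category.assoc, comp_hpair]

@[simp] theorem hpair_eta (A B : PR) : hpair (hfst A B) (hsnd A B) = 𝟙 _ := by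
  apply hpair_ext <;> simp

theorem one_uniq {A : PR} (f g : A ⟶ one) : f = g :=
  (cartesianPR.bang_uniq f).trans (cartesianPR.bang_uniq g).symm

@[simp] theorem comp_hZ {D G : PR} (f : D ⟶ G) : f ≫ hZ G = hZ D := by
  have : f ≫ cls (bang G) = cls (bang D) := one_uniq _ _
  change f ≫ cls (bang G) ≫ cls zero = cls (bang D) ≫ cls zero
  rw [← Category.assoc, this]

@[simp] theorem hiter_zero {A : PR} (f : A ⟶ A) : hpair (𝟙 A) (hZ A) ≫ hiter f = 𝟙 A :=
  cartesianPR.iter_zero f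
@[simp] theorem hiter_succ {A : PR} (f : A ⟶ A) :
    hpair (hfst A nat) (hsnd A nat ≫ hS) ≫ hiter f = hiter f ≫ f := cartesianPR.iter_succ f

/-- Uniqueness of the initialised iterated. -/
theorem freyd {A B : PR} {g : B ⟶ B} {h k : prod A nat ⟶ B}
    (h0 : hpair (𝟙 A) (hZ A) ≫ h = hpair (𝟙 A) (hZ A) ≫ k)
    (hs : hpair (hfst A nat) (hsnd A nat ≫ hS) ≫ h = h ≫ g)
    (ks : hpair (hfst A nat) (hsnd A nat ≫ hS) ≫ k = k ≫ g) : h = k :=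
  (cartesianPR.iter_uniq _ g h rfl hs).trans (cartesianPR.iter_uniq _ g k h0.symm ks).symm

@[simp] theorem iter_Z {G A : PR} (a : G ⟶ A) (f : A ⟶ A) : hpair a (hZ G) ≫ hiter f = a := by
  have : hpair a (hZ G) = a ≫ hpair (𝟙 A) (hZ A) := by simp
  rw [this, Category.assoc, hiter_zero, Category.comp_id]
@[simp] theorem iter_S {G A : PR} (a : G ⟶ A) (n : G ⟶ nat) (f : A ⟶ A) :
    hpair a (n ≫ hS) ≫ hiter f = hpair a n ≫ hiter f ≫ f := by
  have : hpair a (n ≫ hS) = hpair a n ≫ hpair (hfst A nat) (hsnd A nat ≫ hS) := by simp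
  rw [this, Category.assoc, hiter_succ]
@[simp] theorem iter_Z' {G A C : PR} (a : G ⟶ A) (f : A ⟶ A) (k : A ⟶ C) :
    hpair a (hZ G) ≫ hiter f ≫ k = a ≫ k := by
  rw [← Category.assoc, iter_Z]
@[simp] theorem iter_S' {G A C : PR} (a : G ⟶ A) (n : G ⟶ nat) (f : A ⟶ A) (k : A ⟶ C) :
    hpair a (n ≫ hS) ≫ hiter f ≫ k = hpair a n ≫ hiter f ≫ f ≫ k := by
  rw [← Category.assoc, iter_S]; simp

def hprec {A B : PR} (g : A ⟶ B) (h : prod (prod A nat) B ⟶ B) : prod A nat ⟶ B :=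
  (hpair (hfst A nat ≫ hpair (hpair (𝟙 A) (hZ A)) g) (hsnd A nat) ≫
    hiter (hpair (hpair (hfst _ _ ≫ hfst A nat) ((hfst _ _ ≫ hsnd A nat) ≫ hS)) h)) ≫
      hsnd (prod A nat) B

theorem hprec_aux {A B : PR} (g : A ⟶ B) (h : prod (prod A nat) B ⟶ B) :
    hpair (hfst A nat ≫ hpair (hpair (𝟙 A) (hZ A)) g) (hsnd A nat) ≫
    hiter (hpair (hpair (hfst _ _ ≫ hfst A nat) ((hfst _ _ ≫ hsnd A nat) ≫ hS)) h) ≫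
      hfst (prod A nat) B = 𝟙 _ := by
  refine freyd (g := hpair (hfst _ _) (hsnd _ _ ≫ hS)) ?_ ?_ ?_
  · simp [← Category.assoc]
  · simp
  · simp

@[simp] theorem prec_Z {G A B : PR} (a : G ⟶ A) (g : A ⟶ B) (h : prod (prod A nat) B ⟶ B) :
    hpair a (hZ G) ≫ hprec g h = a ≫ g := by
  simp [hprec]
@[simp] theorem prec_S {G A B : PR} (a : G ⟶ A) (n : G ⟶ nat) (g : A ⟶ B)
    (h : prod (prod A nat) B ⟶ B) :
    hpair a (n ≫ hS) ≫ hprec g h = hpair (hpair a n) (hpair a n ≫ hprec g h) ≫ h := by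
  have := congrArg (fun k => hpair a n ≫ k) (hprec_aux g h)
  simp at this
  have e : hpair (hpair a n) (hpair a n ≫ hprec g h) =
    hpair a n ≫ hpair (hfst A nat ≫ hpair (hpair (𝟙 A) (hZ A)) g) (hsnd A nat) ≫
    hiter (hpair (hpair (hfst _ _ ≫ hfst A nat) ((hfst _ _ ≫ hsnd A nat) ≫ hS)) h) := by
    apply hpair_ext
    · simpa using this.symm
    · simp [hprec]
  rw [e]
  simp [hprec]

/-- Uniqueness in the full scheme of primitive recursion. -/
theorem prec_uniq {A B : PR} (φ : prod (prod A nat) B ⟶ B) {h k : prod A nat ⟶ B}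
    (h0 : hpair (𝟙 A) (hZ A) ≫ h = hpair (𝟙 A) (hZ A) ≫ k)
    (hs : hpair (hfst A nat) (hsnd A nat ≫ hS) ≫ h = hpair (𝟙 _) h ≫ φ)
    (ks : hpair (hfst A nat) (hsnd A nat ≫ hS) ≫ k = hpair (𝟙 _) k ≫ φ) : h = k := by
  have : hpair (𝟙 _) h = hpair (𝟙 _) k := by
    refine freyd (g := hpair (hfst _ _ ≫ hpair (hfst _ _) (hsnd _ _ ≫ hS)) φ) ?_ ?_ ?_
    · simp [h0]
    · simp [hs]
    · simp [ks]
  simpa using congrArg (fun x => x ≫ hsnd _ _) this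

/-- Two maps which agree at zero and at successors are equal. -/
theorem cases_ext {A B : PR} {h k : prod A nat ⟶ B}
    (h0 : hpair (𝟙 A) (hZ A) ≫ h = hpair (𝟙 A) (hZ A) ≫ k)
    (hs : hpair (hfst A nat) (hsnd A nat ≫ hS) ≫ h =
      hpair (hfst A nat) (hsnd A nat ≫ hS) ≫ k) : h = k :=
  prec_uniq (hfst _ _ ≫ hpair (hfst A nat) (hsnd A nat ≫ hS) ≫ k) h0 (by simp [hs]) (by simp)

end PR

namespace PR

open Term

@[simp] theorem comp_hZ' {D G B : PR} (f : D ⟶ G) (k : nat ⟶ B) :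
    f ≫ hZ G ≫ k = hZ D ≫ k := by
  rw [← Category.assoc, comp_hZ]

def hcase {A B : PR} (g : A ⟶ B) (h : prod A nat ⟶ B) : prod A nat ⟶ B :=
  hprec g (hfst _ _ ≫ h)

@[simp] theorem case_Z {G A B : PR} (a : G ⟶ A) (g : A ⟶ B) (h : prod A nat ⟶ B) :
    hpair a (hZ G) ≫ hcase g h = a ≫ g := by simp [hcase]
@[simp] theorem case_S {G A B : PR} (a : G ⟶ A) (n : G ⟶ nat) (g : A ⟶ B)
    (h : prod A nat ⟶ B) : hpair a (n ≫ hS) ≫ hcase g h = hpair a n ≫ h := by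
  simp [hcase]

def hcond {G B : PR} (c : G ⟶ nat) (u v : G ⟶ B) : G ⟶ B :=
  hpair (𝟙 G) c ≫ hcase v (hfst G nat ≫ u)

@[simp] theorem cond_Z {G B : PR} (u v : G ⟶ B) : hcond (hZ G) u v = v := by simp [hcond]
@[simp] theorem cond_S {G B : PR} (c : G ⟶ nat) (u v : G ⟶ B) : hcond (c ≫ hS) u v = u := by
  simp [hcond]
@[simp] theorem comp_cond {D G B : PR} (d : D ⟶ G) (c : G ⟶ nat) (u v : G ⟶ B) :
    d ≫ hcond c u v = hcond (d ≫ c) (d ≫ u) (d ≫ v) := by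
  have key : hpair (hfst D nat ≫ d) (hsnd D nat) ≫ hcase v (hfst G nat ≫ u) =
      hcase (d ≫ v) (hfst D nat ≫ d ≫ u) := by
    apply cases_ext <;> simp
  simpa [hcond] using congrArg (fun k => hpair (𝟙 D) (d ≫ c) ≫ k) key
@[simp] theorem comp_cond' {D G B C : PR} (d : D ⟶ G) (c : G ⟶ nat) (u v : G ⟶ B)
    (k : B ⟶ C) :
    d ≫ hcond c u v ≫ k = hcond (d ≫ c) (d ≫ u) (d ≫ v) ≫ k := by
  rw [← Category.assoc, comp_cond]

/-- An equation with one free numerical variable may be checked by cases. -/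
theorem cases_on {G B : PR} (c : G ⟶ nat) (h k : prod G nat ⟶ B)
    (h0 : hpair (𝟙 G) (hZ G) ≫ h = hpair (𝟙 G) (hZ G) ≫ k)
    (hs : hpair (hfst G nat) (hsnd G nat ≫ hS) ≫ h =
      hpair (hfst G nat) (hsnd G nat ≫ hS) ≫ k) :
    hpair (𝟙 G) c ≫ h = hpair (𝟙 G) c ≫ k := by rw [cases_ext h0 hs]

theorem cond_comp {G B C : PR} (c : G ⟶ nat) (u v : G ⟶ B) (w : B ⟶ C) :
    hcond c u v ≫ w = hcond c (u ≫ w) (v ≫ w) := by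
  simpa using cases_on c (hcond (hsnd G nat) (hfst G nat ≫ u) (hfst G nat ≫ v) ≫ w)
    (hcond (hsnd G nat) (hfst G nat ≫ u ≫ w) (hfst G nat ≫ v ≫ w)) (by simp) (by simp)

def hneg : nat ⟶ nat := hpair (𝟙 nat) (𝟙 nat) ≫ hcase (hZ nat ≫ hS) (hZ _)
def hpred : nat ⟶ nat := hpair (𝟙 nat) (𝟙 nat) ≫ hcase (hZ nat) (hsnd nat nat)
def hsign : nat ⟶ nat := hneg ≫ hneg
def hadd {G : PR} (u v : G ⟶ nat) : G ⟶ nat := hpair u v ≫ hiter hS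
def hsub {G : PR} (u v : G ⟶ nat) : G ⟶ nat := hpair u v ≫ hiter hpred
def hmul {G : PR} (u v : G ⟶ nat) : G ⟶ nat :=
  hpair u v ≫ hprec (hZ nat) (hadd (hsnd _ _) (hfst _ _ ≫ hfst nat nat))
def hand {G : PR} (u v : G ⟶ nat) : G ⟶ nat := hmul u v ≫ hsign
def himp {G : PR} (u v : G ⟶ nat) : G ⟶ nat := hand u (v ≫ hneg) ≫ hneg

@[simp] theorem neg_Z (G : PR) : hZ G ≫ hneg = hZ G ≫ hS := by simp [hneg]
@[simp] theorem neg_S {G : PR} (u : G ⟶ nat) : u ≫ hS ≫ hneg = hZ G := by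
  simp [hneg]
@[simp] theorem neg_Z' (G : PR) {B : PR} (k : nat ⟶ B) :
    hZ G ≫ hneg ≫ k = hZ G ≫ hS ≫ k := by
  rw [← Category.assoc, neg_Z, Category.assoc]
@[simp] theorem neg_S' {G B : PR} (u : G ⟶ nat) (k : nat ⟶ B) :
    u ≫ hS ≫ hneg ≫ k = hZ G ≫ k := by
  rw [← neg_S u]; simp only [Category.assoc]
@[simp] theorem pred_Z (G : PR) : hZ G ≫ hpred = hZ G := by simp [hpred]
@[simp] theorem pred_S {G : PR} (u : G ⟶ nat) : u ≫ hS ≫ hpred = u := by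
  simp [hpred]
@[simp] theorem comp_add {D G : PR} (d : D ⟶ G) (u v : G ⟶ nat) :
    d ≫ hadd u v = hadd (d ≫ u) (d ≫ v) := by simp [hadd]
@[simp] theorem comp_sub {D G : PR} (d : D ⟶ G) (u v : G ⟶ nat) :
    d ≫ hsub u v = hsub (d ≫ u) (d ≫ v) := by simp [hsub]
@[simp] theorem comp_mul {D G : PR} (d : D ⟶ G) (u v : G ⟶ nat) :
    d ≫ hmul u v = hmul (d ≫ u) (d ≫ v) := by simp [hmul]
@[simp] theorem comp_add' {D G B : PR} (d : D ⟶ G) (u v : G ⟶ nat) (k : nat ⟶ B) :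
    d ≫ hadd u v ≫ k = hadd (d ≫ u) (d ≫ v) ≫ k := by
  rw [← Category.assoc, comp_add]
@[simp] theorem comp_sub' {D G B : PR} (d : D ⟶ G) (u v : G ⟶ nat) (k : nat ⟶ B) :
    d ≫ hsub u v ≫ k = hsub (d ≫ u) (d ≫ v) ≫ k := by
  rw [← Category.assoc, comp_sub]
@[simp] theorem comp_mul' {D G B : PR} (d : D ⟶ G) (u v : G ⟶ nat) (k : nat ⟶ B) :
    d ≫ hmul u v ≫ k = hmul (d ≫ u) (d ≫ v) ≫ k := by
  rw [← Category.assoc, comp_mul]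
@[simp] theorem comp_and {D G : PR} (d : D ⟶ G) (u v : G ⟶ nat) :
    d ≫ hand u v = hand (d ≫ u) (d ≫ v) := by
  simp only [hand, ← Category.assoc, comp_mul]
@[simp] theorem comp_and' {D G B : PR} (d : D ⟶ G) (u v : G ⟶ nat) (k : nat ⟶ B) :
    d ≫ hand u v ≫ k = hand (d ≫ u) (d ≫ v) ≫ k := by
  rw [← Category.assoc, comp_and]
@[simp] theorem add_Z {G : PR} (u : G ⟶ nat) : hadd u (hZ G) = u := by simp [hadd]
@[simp] theorem add_S {G : PR} (u v : G ⟶ nat) : hadd u (v ≫ hS) = hadd u v ≫ hS := by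
  simp [hadd]
@[simp] theorem sub_Z {G : PR} (u : G ⟶ nat) : hsub u (hZ G) = u := by simp [hsub]
@[simp] theorem sub_S {G : PR} (u v : G ⟶ nat) : hsub u (v ≫ hS) = hsub u v ≫ hpred := by
  simp [hsub]
@[simp] theorem mul_Z {G : PR} (u : G ⟶ nat) : hmul u (hZ G) = hZ G := by simp [hmul]
@[simp] theorem mul_S {G : PR} (u v : G ⟶ nat) : hmul u (v ≫ hS) = hadd (hmul u v) u := by
  simp [hmul]

theorem on_var {G B : PR} (c : G ⟶ nat) {h k : prod G nat ⟶ B} (e : h = k) :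
    hpair (𝟙 G) c ≫ h = hpair (𝟙 G) c ≫ k := by rw [e]

@[simp] theorem Z_add {G : PR} (u : G ⟶ nat) : hadd (hZ G) u = u := by
  have : hadd (hZ _) (hsnd G nat) = hsnd G nat := by
    apply freyd (g := hS) <;> simp
  simpa using on_var u this
@[simp] theorem S_add {G : PR} (u v : G ⟶ nat) : hadd (u ≫ hS) v = hadd u v ≫ hS := by
  have : hadd (hfst G nat ≫ u ≫ hS) (hsnd G nat) = hadd (hfst G nat ≫ u) (hsnd G nat) ≫ hS := by
    apply freyd (g := hS) <;> simp
  simpa using on_var v this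
@[simp] theorem S_add' {D G : PR} (d : G ⟶ D) (u : D ⟶ nat) (v : G ⟶ nat) :
    hadd (d ≫ u ≫ hS) v = hadd (d ≫ u) v ≫ hS := by rw [← Category.assoc, S_add]
@[simp] theorem add_S' {D G : PR} (d : G ⟶ D) (u : G ⟶ nat) (v : D ⟶ nat) :
    hadd u (d ≫ v ≫ hS) = hadd u (d ≫ v) ≫ hS := by rw [← Category.assoc, add_S]
@[simp] theorem sub_S' {D G : PR} (d : G ⟶ D) (u : G ⟶ nat) (v : D ⟶ nat) :
    hsub u (d ≫ v ≫ hS) = hsub u (d ≫ v) ≫ hpred := by rw [← Category.assoc, sub_S]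
@[simp] theorem Z_sub {G : PR} (u : G ⟶ nat) : hsub (hZ G) u = hZ G := by
  have : hsub (hZ _) (hsnd G nat) = hZ _ := by
    apply freyd (g := hpred) <;> simp
  simpa using on_var u this
@[simp] theorem S_sub {G : PR} (u v : G ⟶ nat) : hsub (u ≫ hS) v ≫ hpred = hsub u v := by
  have : hsub (hfst G nat ≫ u ≫ hS) (hsnd G nat) ≫ hpred =
      hsub (hfst G nat ≫ u) (hsnd G nat) := by
    apply freyd (g := hpred) <;> simp
  simpa using on_var v this
@[simp] theorem S_sub' {D G : PR} (d : G ⟶ D) (u : D ⟶ nat) (v : G ⟶ nat) :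
    hsub (d ≫ u ≫ hS) v ≫ hpred = hsub (d ≫ u) v := by rw [← Category.assoc, S_sub]
@[simp] theorem sub_self {G : PR} (u : G ⟶ nat) : hsub u u = hZ G := by
  have : hsub (hsnd G nat) (hsnd G nat) = hZ _ := by
    apply freyd (g := 𝟙 _) <;> simp
  simpa using on_var u this
@[simp] theorem Z_mul {G : PR} (u : G ⟶ nat) : hmul (hZ G) u = hZ G := by
  have : hmul (hZ _) (hsnd G nat) = hZ _ := by
    apply freyd (g := 𝟙 _) <;> simp
  simpa using on_var u this

@[simp] theorem Z_and {G : PR} (u : G ⟶ nat) : hand (hZ G) u = hZ G := by simp [hand, hsign]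
@[simp] theorem and_Z {G : PR} (u : G ⟶ nat) : hand u (hZ G) = hZ G := by simp [hand, hsign]
@[simp] theorem S_and_S {G : PR} (u v : G ⟶ nat) : hand (u ≫ hS) (v ≫ hS) = hZ G ≫ hS := by
  simp [hand, hsign]
end PR

namespace PR

/-! Commutativity of the maximum, `u + (v ∸ u) = v + (u ∸ v)`. -/

theorem sign_S {G : PR} (u : G ⟶ nat) : u ≫ hS ≫ hsign = hZ G ≫ hS := by simp [hsign]
theorem sign_Z (G : PR) : hZ G ≫ hsign = hZ G := by simp [hsign]
attribute [simp] sign_S sign_Z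

theorem max_aux₁ {G : PR} (c n : G ⟶ nat) :
    hadd (hadd c (n ≫ hsign)) (n ≫ hpred) = hadd c n := by
  have : hadd (hadd (hfst G nat ≫ c) (hsnd G nat ≫ hsign)) (hsnd G nat ≫ hpred) =
      hadd (hfst G nat ≫ c) (hsnd G nat) := by apply cases_ext <;> simp
  simpa using on_var n this

theorem max_aux₂ {G : PR} (c m n : G ⟶ nat) :
    hadd (hadd c (hadd m n ≫ hsign)) (hadd (m ≫ hpred) (hsub (n ≫ hpred) (m ≫ hpred))) =
      hadd c (hadd m (hsub n m)) := by
  have aux (H : PR) (c k n : H ⟶ nat) :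
      hadd c (hadd k (hsub (n ≫ hpred) k)) ≫ hS = hadd c (hadd k (hsub n (k ≫ hS)) ≫ hS) := by
    have : hadd (hfst H nat ≫ c) (hadd (hfst H nat ≫ k) (hsub (hsnd H nat ≫ hpred)
          (hfst H nat ≫ k))) ≫ hS =
        hadd (hfst H nat ≫ c) (hadd (hfst H nat ≫ k)
          (hsub (hsnd H nat) (hfst H nat ≫ k ≫ hS)) ≫ hS) := by
      apply cases_ext <;> simp
    simpa using on_var n this
  have : hadd (hadd (hfst G nat ≫ c) (hadd (hsnd G nat) (hfst G nat ≫ n) ≫ hsign))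
        (hadd (hsnd G nat ≫ hpred) (hsub (hfst G nat ≫ n ≫ hpred) (hsnd G nat ≫ hpred))) =
      hadd (hfst G nat ≫ c) (hadd (hsnd G nat) (hsub (hfst G nat ≫ n) (hsnd G nat))) := by
    apply cases_ext
    · simpa using max_aux₁ c n
    · simpa using aux _ (hfst G nat ≫ c) (hsnd G nat) (hfst G nat ≫ n)
  simpa using on_var m this

theorem max_aux₃ {G : PR} (c m n : G ⟶ nat) :
    hadd (hadd c (hadd m n ≫ hsign)) (hadd (n ≫ hpred) (hsub (m ≫ hpred) (n ≫ hpred))) =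
      hadd c (hadd n (hsub m n)) := by
  have e : hadd m n ≫ hsign = hadd n m ≫ hsign := by
    have : hadd (hfst G nat ≫ m) (hsnd G nat) ≫ hsign =
        hadd (hsnd G nat) (hfst G nat ≫ m) ≫ hsign := by apply cases_ext <;> simp
    simpa using on_var n this
  rw [e, max_aux₂]

def maxStep : prod (prod nat nat) nat ⟶ prod (prod nat nat) nat :=
  hpair (hpair (hfst _ _ ≫ hfst _ _ ≫ hpred) (hfst _ _ ≫ hsnd _ _ ≫ hpred))
    (hadd (hsnd _ _) (hadd (hfst _ _ ≫ hfst _ _) (hfst _ _ ≫ hsnd _ _) ≫ hsign))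

theorem maxStep_inv {F : prod (prod nat nat) nat ⟶ nat} (hF : maxStep ≫ F = F) :
    hiter maxStep ≫ F = hfst _ _ ≫ F := by
  apply freyd (g := 𝟙 _) <;> simp [hF]

theorem maxStep_fst : hiter maxStep ≫ hfst _ _ ≫ hfst _ _ =
    hsub (hfst _ nat ≫ hfst _ _ ≫ hfst _ _) (hsnd _ _) := by
  apply freyd (g := hpred) <;> simp [maxStep]

theorem maxStep_snd : hiter maxStep ≫ hfst _ _ ≫ hsnd _ _ =
    hsub (hfst _ nat ≫ hfst _ _ ≫ hsnd _ _) (hsnd _ _) := by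
  apply freyd (g := hpred) <;> simp [maxStep]

theorem max_comm {G : PR} (m n : G ⟶ nat) :
    hadd m (hsub n m) = hadd n (hsub m n) := by
  have h1 := maxStep_inv (F := hadd (hsnd _ _) (hadd (hfst _ _ ≫ hfst _ _)
    (hsub (hfst _ _ ≫ hsnd _ _) (hfst _ _ ≫ hfst _ _)))) (by
      simpa [maxStep] using max_aux₂ (hsnd (prod nat nat) nat) (hfst _ _ ≫ hfst _ _)
        (hfst _ _ ≫ hsnd _ _))
  have h2 := maxStep_inv (F := hadd (hsnd _ _) (hadd (hfst _ _ ≫ hsnd _ _)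
    (hsub (hfst _ _ ≫ hfst _ _) (hfst _ _ ≫ hsnd _ _)))) (by
      simpa [maxStep] using max_aux₃ (hsnd (prod nat nat) nat) (hfst _ _ ≫ hfst _ _)
        (hfst _ _ ≫ hsnd _ _))
  have e := fun F : prod (prod nat nat) nat ⟶ nat => fun h : hiter maxStep ≫ F = hfst _ _ ≫ F =>
    congrArg (fun k => hpair (hpair (hpair m n) (hZ G)) m ≫ k) h
  have e1 := e _ h1
  have e2 := e _ h2
  have f1 := congrArg (fun k => hpair (hpair (hpair m n) (hZ G)) m ≫ k) maxStep_fst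
  simp at e1 e2 f1
  simp [f1] at e1 e2
  rw [← e1, ← e2]

end PR

namespace PR

open Term

/-! Implication and predicative equality -/

def HImpl {G : PR} (a b : G ⟶ nat) : Prop := himp a b = hZ G ≫ hS

theorem eq_Z_of_neg {G : PR} {a : G ⟶ nat} (h : a ≫ hneg = hZ G ≫ hS) : a = hZ G := by
  have : hcond (hsnd G nat ≫ hneg) (hZ _) (hsnd G nat) = hsnd G nat := by
    apply cases_ext <;> simp
  have := on_var a this
  simp [h] at this
  exact this.symm

theorem neg_neg_cond {G : PR} (a : G ⟶ nat) : hcond (a ≫ hneg ≫ hneg) a (hZ G) = a := by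
  have : hcond (hsnd G nat ≫ hneg ≫ hneg) (hsnd G nat) (hZ _) = hsnd G nat := by
    apply cases_ext <;> simp
  simpa using on_var a this

@[simp] theorem S_and {G : PR} (a b : G ⟶ nat) : hand (a ≫ hS) b = b ≫ hneg ≫ hneg := by
  have : hand (hfst G nat ≫ a ≫ hS) (hsnd G nat) = hsnd G nat ≫ hneg ≫ hneg := by
    apply cases_ext
    · simp
    · simpa using S_and_S (hfst G nat ≫ a) (hsnd G nat)
  simpa using on_var b this

@[simp] theorem S_and' {D G : PR} (d : G ⟶ D) (a : D ⟶ nat) (b : G ⟶ nat) :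
    hand (d ≫ a ≫ hS) b = b ≫ hneg ≫ hneg := by rw [← Category.assoc, S_and]

@[simp] theorem neg_neg_neg {G : PR} (a : G ⟶ nat) : a ≫ hneg ≫ hneg ≫ hneg = a ≫ hneg := by
  have : hsnd G nat ≫ hneg ≫ hneg ≫ hneg = hsnd G nat ≫ hneg := by
    apply cases_ext <;> simp
  simpa using on_var a this

theorem and_neg {G : PR} (a b : G ⟶ nat) : hand a (b ≫ hneg) = hcond a (b ≫ hneg) (hZ G) := by
  have : hand (hsnd G nat) (hfst G nat ≫ b ≫ hneg) =
      hcond (hsnd G nat) (hfst G nat ≫ b ≫ hneg) (hZ _) := by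
    apply cases_ext <;> simp
  simpa using on_var a this

theorem HImp_iff {G : PR} (a b : G ⟶ nat) : HImpl a b ↔ hcond a (b ≫ hneg) (hZ G) = hZ G := by
  rw [← and_neg]
  exact ⟨fun h => eq_Z_of_neg h, fun h => by simp [HImpl, himp, h]⟩

theorem HImpl.trans {G : PR} {a b c : G ⟶ nat} (h : HImpl a b) (k : HImpl b c) : HImpl a c := by
  rw [HImp_iff] at *
  have e₁ : hcond (hsnd G nat ≫ hneg) (hfst G nat ≫ c ≫ hneg)
      (hcond (hsnd G nat) (hfst G nat ≫ c ≫ hneg) (hZ _)) = hfst G nat ≫ c ≫ hneg := by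
    apply cases_ext <;> simp
  have e₂ := on_var b e₁
  have e₃ : hcond (hcond (hsnd G nat) (hfst G nat ≫ b ≫ hneg) (hZ _)) (hfst G nat ≫ c ≫ hneg)
      (hcond (hsnd G nat) (hfst G nat ≫ hcond b (c ≫ hneg) (hZ G)) (hZ _)) =
      hcond (hsnd G nat) (hfst G nat ≫ c ≫ hneg) (hZ _) := by
    simp at e₂
    apply cases_ext
    · simp
    · simpa using congrArg (fun k => hfst G nat ≫ k) e₂
  have e₄ := on_var a e₃
  simp [h, k] at e₄
  rw [← e₄]
  have e₅ : hcond (hsnd G nat) (hZ _) (hZ _) = hZ _ := by apply cases_ext <;> simp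
  simpa using on_var a e₅

@[simp] theorem comp_imp {D G : PR} (d : D ⟶ G) (a b : G ⟶ nat) :
    d ≫ himp a b = himp (d ≫ a) (d ≫ b) := by simp [himp]

theorem HImpl.subst {D G : PR} (d : D ⟶ G) {a b : G ⟶ nat} (h : HImpl a b) :
    HImpl (d ≫ a) (d ≫ b) := by
  have := congrArg (fun k => d ≫ k) h
  simpa [HImpl] using this

theorem HImpl.true {G : PR} (a : G ⟶ nat) : HImpl a (hZ G ≫ hS) := by simp [HImpl, himp]

theorem HImpl.refl {G : PR} (a : G ⟶ nat) : HImpl a a := by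
  have : hand (hsnd G nat) (hsnd G nat ≫ hneg) = hZ _ := by apply cases_ext <;> simp
  have := on_var a this
  simp at this
  simp [HImpl, himp, this]

theorem HImpl.and_left {G : PR} (a b : G ⟶ nat) : HImpl (hand a b) a := by
  have : himp (hand (hsnd G nat) (hfst G nat ≫ b)) (hsnd G nat) = hZ _ ≫ hS := by
    apply cases_ext <;> simp [himp]
  have := on_var a this
  simp at this
  exact this

theorem HImpl.and_right {G : PR} (a b : G ⟶ nat) : HImpl (hand a b) b := by
  have : himp (hand (hfst G nat ≫ a) (hsnd G nat)) (hsnd G nat) = hZ _ ≫ hS := by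
    apply cases_ext <;> simp [himp]
  have := on_var b this
  simp at this
  exact this

theorem HImpl.and {G : PR} {a b c : G ⟶ nat} (h : HImpl a b) (k : HImpl a c) :
    HImpl a (hand b c) := by
  rw [HImp_iff] at *
  have e₁ : hcond (hsnd G nat ≫ hneg) (hZ _ ≫ hS) (hfst G nat ≫ c ≫ hneg) =
      hand (hsnd G nat) (hfst G nat ≫ c) ≫ hneg := by
    apply cases_ext <;> simp
  have e₂ := on_var b e₁
  have e₃ : hcond (hcond (hsnd G nat) (hfst G nat ≫ b ≫ hneg) (hZ _)) (hZ _ ≫ hS)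
      (hcond (hsnd G nat) (hfst G nat ≫ c ≫ hneg) (hZ _)) =
      hcond (hsnd G nat) (hfst G nat ≫ hand b c ≫ hneg) (hZ _) := by
    simp at e₂
    apply cases_ext
    · simp
    · simpa using congrArg (fun k => hfst G nat ≫ k) e₂
  have e₄ := on_var a e₃
  simp [h, k] at e₄
  exact e₄.symm

def heqT : {G : PR} → (B : PR) → (G ⟶ B) → (G ⟶ B) → (G ⟶ nat)
  | G, one, _, _ => hZ G ≫ hS
  | _, nat, u, v => hand (hsub u v ≫ hneg) (hsub v u ≫ hneg)
  | _, prod A B, u, v =>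
      hand (heqT A (u ≫ hfst A B) (v ≫ hfst A B)) (heqT B (u ≫ hsnd A B) (v ≫ hsnd A B))

@[simp] theorem comp_heqT {D G : PR} (d : D ⟶ G) (B : PR) (u v : G ⟶ B) :
    d ≫ heqT B u v = heqT B (d ≫ u) (d ≫ v) := by
  induction B with
  | one => simp [heqT]
  | nat => simp [heqT]
  | prod A B hA hB => simp [heqT, hA, hB]

theorem heqT_self {G : PR} (B : PR) (u : G ⟶ B) : heqT B u u = hZ G ≫ hS := by
  induction B with
  | one => simp [heqT]
  | nat => simp [heqT]
  | prod A B hA hB => simp [heqT, hA, hB]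

/-- Replacing a subterm under a condition. -/
theorem cond_subst {G A B : PR} (χ : G ⟶ nat) (u c : G ⟶ A) (k : prod G A ⟶ B) (w : G ⟶ B) :
    hcond χ (hpair (𝟙 G) (hcond χ u c) ≫ k) w = hcond χ (hpair (𝟙 G) u ≫ k) w := by
  have : hcond (hsnd G nat) (hpair (hfst G nat) (hcond (hsnd G nat) (hfst G nat ≫ u)
        (hfst G nat ≫ c)) ≫ k) (hfst G nat ≫ w) =
      hcond (hsnd G nat) (hpair (hfst G nat) (hfst G nat ≫ u) ≫ k) (hfst G nat ≫ w) := by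
    apply cases_ext <;> simp
  simpa using on_var χ this

theorem cond_eq_change {G B : PR} {χ : G ⟶ nat} {u v c : G ⟶ B}
    (h : hcond χ u c = hcond χ v c) (d : G ⟶ B) : hcond χ u d = hcond χ v d := by
  have e := fun u => cond_subst χ u c (hsnd G B) d
  simp at e
  rw [← e u, ← e v, h]

/-- Equality definability: predicative equality under a condition is map equality under that
condition. -/
theorem HImp_heqT_iff {G : PR} (B : PR) (χ : G ⟶ nat) (u v c : G ⟶ B) :
    HImpl χ (heqT B u v) ↔ hcond χ u c = hcond χ v c := by
  constructor
  · intro h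
    induction B with
    | one => exact one_uniq _ _
    | nat =>
      apply cond_eq_change (c := hZ G)
      have key (p : G ⟶ nat) (hp : HImpl χ (p ≫ hneg)) : hcond χ p (hZ G) = hZ G := by
        rw [HImp_iff] at hp
        have := cond_subst χ (p ≫ hneg ≫ hneg) (hZ G)
          (hcond (hsnd G nat) (hfst G nat ≫ p) (hZ _)) (hZ G)
        simp [neg_neg_cond] at this hp
        rw [← this, hp]
        have e₅ : hcond (hsnd G nat) (hZ _) (hZ _) = hZ _ := by apply cases_ext <;> simp
        simpa using on_var χ e₅
      have dist (u v : G ⟶ nat) : hsub (hcond χ u (hZ G)) (hcond χ v (hZ G)) =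
          hcond χ (hsub u v) (hZ G) := by
        have : hsub (hcond (hsnd G nat) (hfst G nat ≫ u) (hZ _))
            (hcond (hsnd G nat) (hfst G nat ≫ v) (hZ _)) =
            hcond (hsnd G nat) (hfst G nat ≫ hsub u v) (hZ _) := by
          apply cases_ext <;> simp
        simpa using on_var χ this
      have h1 := (dist u v).trans (key _ (h.trans (HImpl.and_left _ _)))
      have h2 := (dist v u).trans (key _ (h.trans (HImpl.and_right _ _)))
      have := max_comm (hcond χ u (hZ G)) (hcond χ v (hZ G))
      simpa [h1, h2] using this
    | prod A B hA hB =>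
      apply hpair_ext
      · rw [cond_comp, cond_comp]; exact hA _ _ _ (h.trans (HImpl.and_left _ _))
      · rw [cond_comp, cond_comp]; exact hB _ _ _ (h.trans (HImpl.and_right _ _))
  · intro h
    rw [HImp_iff]
    have e₁ := cond_subst χ u c (heqT B (hsnd G B) (hfst G B ≫ v) ≫ hneg) (hZ G)
    have e₂ := cond_subst χ v c (heqT B (hfst G B ≫ hcond χ v c) (hsnd G B) ≫ hneg) (hZ G)
    rw [← Category.assoc, ← Category.assoc] at e₁ e₂
    simp at e₁ e₂
    rw [← e₁, h, ← e₂, heqT_self]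
    have e₅ : hcond (hsnd G nat) (hZ _) (hZ _) = hZ _ := by apply cases_ext <;> simp
    simpa using on_var χ e₅

theorem HImp_heqT_self {G : PR} (B : PR) (χ : G ⟶ nat) (u : G ⟶ B) : HImpl χ (heqT B u u) :=
  (HImp_heqT_iff B χ u u u).2 rfl

theorem HImp_heqT_comp {G A B : PR} {χ : G ⟶ nat} {u v : G ⟶ A} (h : HImpl χ (heqT A u v))
    (g : A ⟶ B) : HImpl χ (heqT B (u ≫ g) (v ≫ g)) := by
  rw [HImp_heqT_iff A χ u v u] at h
  rw [HImp_heqT_iff B χ _ _ (u ≫ g), ← cond_comp, h, cond_comp]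

theorem HImpl_cond_self {A : PR} (a b : A ⟶ nat) (w : A ⟶ A) :
    HImpl (hand a b) (heqT A (hcond a (𝟙 A) w) (𝟙 A)) := by
  refine HImpl.trans (HImpl.and_left a b) ?_
  rw [HImp_heqT_iff _ _ _ _ w]
  simpa using cond_subst a (𝟙 A) w (hsnd _ _) w

theorem HImpl_of_heqT {A : PR} {a : A ⟶ nat} {u : A ⟶ A} (e : HImpl a (heqT A u (𝟙 A))) :
    HImpl a (u ≫ a) := by
  have h := (HImp_heqT_iff _ _ _ _ (hZ A)).1 (HImp_heqT_comp e (a ≫ hneg))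
  rw [Category.id_comp, (HImp_iff _ _).1 (HImpl.refl _), ← Category.assoc] at h
  exact (HImp_iff _ _).2 h

theorem mk_eqT {G : PR} (B : PR) (u v : Term G B) :
    cls (eqT B u v) = heqT B (cls u) (cls v) := by
  induction B with
  | one => rfl
  | nat => rfl
  | prod A B hA hB =>
    change hand (cls (eqT A _ _)) (cls (eqT B _ _)) = _
    rw [hA, hB]; rfl

theorem Implies_iff {A : PR} (c d : Term A nat) : Implies c d ↔ HImpl (cls c) (cls d) :=
  mk_eq.symm

theorem mk_cond {G B : PR} (c : Term G nat) (u v : Term G B) :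
    cls (cond c u v) = hcond (cls c) (cls u) (cls v) := rfl
theorem mk_and {G : PR} (u v : Term G nat) : cls (and u v) = hand (cls u) (cls v) := rfl

end PR

open PR in
/-- An object `{A : χ}` of the theory of primitive recursion with predicate abstraction. -/
@[ext]
structure PRa : Type where
  carrier : PR
  pred : Term carrier PR.nat
  isPred : IsPred pred

namespace PRa

open PR Term

/-- The `PR`-maps `f : A → B` which are `PRa`-maps `{A : χ} → {B : φ}`: the implication
`χ a ⟹ φ (f a)` is derivable. -/
def RawHom (P Q : PRa) : Type :=
  {f : Term P.carrier Q.carrier // Implies P.pred (Q.pred ∘ₜ f)}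

/-- Two `PRa`-maps `f, g : {A : χ} → {B : φ}` are equal if `χ a ⟹ f a ≐ g a` is derivable. -/
instance rawSetoid (P Q : PRa) : Setoid (RawHom P Q) where
  r f g := Implies P.pred (eqT Q.carrier f.1 g.1)
  iseqv := by
    have key (f g : RawHom P Q) : Implies P.pred (eqT Q.carrier f.1 g.1) ↔
        ∀ c, hcond (cls P.pred) (cls f.1) c = hcond (cls P.pred) (cls g.1) c := by
      rw [Implies_iff, mk_eqT]
      exact ⟨fun h c => (HImp_heqT_iff _ _ _ _ c).1 h,
        fun h => (HImp_heqT_iff _ _ _ _ (cls f.1)).2 (h _)⟩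
    refine ⟨fun f => (key f f).2 fun _ => rfl, fun {f g} h => ?_, fun {f g k} h h' => ?_⟩
    · exact (key _ _).2 fun c => ((key _ _).1 h c).symm
    · exact (key _ _).2 fun c => ((key _ _).1 h c).trans ((key _ _).1 h' c)

/-- The theory of primitive recursion with predicate abstraction as a category. -/
instance : Category PRa where
  Hom P Q := Quotient (rawSetoid P Q)
  id P := Quotient.mk _ ⟨ident P.carrier, by
    rw [Implies_iff, mk_comp, mk_id, Category.id_comp]; exact HImpl.refl _⟩
  comp {P Q R} f g := Quotient.map₂
    (fun (f : RawHom P Q) (g : RawHom Q R) => (⟨g.1 ∘ₜ f.1, by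
      have hf : HImpl (cls P.pred) (cls f.1 ≫ cls Q.pred) := (Implies_iff _ _).1 f.2
      have hg : HImpl (cls Q.pred) (cls g.1 ≫ cls R.pred) := (Implies_iff _ _).1 g.2
      have hg := hg.subst (cls f.1)
      rw [Implies_iff]
      have h := hf.trans hg
      rw [← Category.assoc] at h
      exact h⟩ : RawHom P R))
    (fun f f' h g g' k => by
      have h := (Implies_iff _ _).1 h
      have k := ((Implies_iff _ _).1 k).subst (cls f'.1)
      have hf' : HImpl (cls P.pred) (cls f'.1 ≫ cls Q.pred) := (Implies_iff _ _).1 f'.2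
      rw [mk_eqT] at h k
      rw [comp_heqT] at k
      refine (Implies_iff _ _).2 ?_
      rw [mk_eqT]
      have h₁ := (HImp_heqT_iff _ _ _ _ (cls f.1 ≫ cls g.1)).1 (HImp_heqT_comp h (cls g.1))
      have h₂ := (HImp_heqT_iff _ _ _ _ (cls f.1 ≫ cls g.1)).1 (hf'.trans k)
      exact (HImp_heqT_iff _ _ _ _ (cls f.1 ≫ cls g.1)).2 (h₁.trans h₂)) f g
  id_comp := by
    rintro P Q ⟨f⟩
    refine Quotient.sound ((Implies_iff _ _).2 ?_)
    rw [mk_eqT]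
    change HImpl _ (heqT _ (𝟙 _ ≫ cls f.1) (cls f.1))
    rw [Category.id_comp]; exact HImp_heqT_self _ _ _
  comp_id := by
    rintro P Q ⟨f⟩
    refine Quotient.sound ((Implies_iff _ _).2 ?_)
    rw [mk_eqT]
    change HImpl _ (heqT _ (cls f.1 ≫ 𝟙 _) (cls f.1))
    rw [Category.comp_id]; exact HImp_heqT_self _ _ _
  assoc := by
    rintro P Q R S ⟨f⟩ ⟨g⟩ ⟨h⟩
    refine Quotient.sound ((Implies_iff _ _).2 ?_)
    rw [mk_eqT]
    change HImpl _ (heqT _ ((cls f.1 ≫ cls g.1) ≫ cls h.1) (cls f.1 ≫ cls g.1 ≫ cls h.1))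
    rw [Category.assoc]; exact HImp_heqT_self _ _ _

/-- The `PRa`-map `h` is given by the `PR`-map term `f`. -/
def Rep {P Q : PRa} (f : Term P.carrier Q.carrier) (h : P ⟶ Q) : Prop :=
  ∃ hf : Implies P.pred (Q.pred ∘ₜ f), (Quotient.mk _ ⟨f, hf⟩ : P ⟶ Q) = h

theorem Rep.comp {P Q R : PRa} {f : Term P.carrier Q.carrier} {g : Term Q.carrier R.carrier}
    {h : P ⟶ Q} {k : Q ⟶ R} (hf : Rep f h) (hg : Rep g k) : Rep (g ∘ₜ f) (h ≫ k) := by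
  obtain ⟨_, rfl⟩ := hf
  obtain ⟨_, rfl⟩ := hg
  exact ⟨_, rfl⟩

end PRa

namespace PR

open Term

theorem isPred_and {A : PR} (u v : Term A nat) : IsPred (and u v) := by
  refine mk_eq.1 ?_
  change (hmul (cls u) (cls v) ≫ hneg ≫ hneg) ≫ hneg ≫ hneg = hmul (cls u) (cls v) ≫ hneg ≫ hneg
  simp

theorem _root_.PRa.rep_cond_id {A : PR} (c d : Term A nat) (w : Term A A) :
    PRa.Rep (P := ⟨A, and c d, isPred_and c d⟩) (Q := ⟨A, and c d, isPred_and c d⟩)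
      (cond c (ident A) w) (𝟙 _) := by
  have e : HImpl (hand (cls c) (cls d)) (heqT A (hcond (cls c) (𝟙 A) (cls w)) (𝟙 A)) :=
    HImpl_cond_self _ _ _
  refine ⟨(Implies_iff _ _).2 (HImpl_of_heqT e), Quotient.sound ((Implies_iff _ _).2 ?_)⟩
  rw [mk_eqT]
  exact e

theorem isPred_true (A : PR) : IsPred (trueT A) := by
  refine mk_eq.1 ?_
  change (hZ A ≫ hS) ≫ hneg ≫ hneg = hZ A ≫ hS
  simp

/-- The embedding of the fundamental theory, `A ↦ {A : true}`. -/
def toPRa : PR ⥤ PRa where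
  obj A := ⟨A, trueT A, isPred_true A⟩
  map {A B} f := Quotient.map (sa := termSetoid A B)
    (fun f => (⟨f, by
      rw [Implies_iff]
      change HImpl _ (cls f ≫ hZ B ≫ hS)
      rw [comp_hZ']; exact HImpl.true _⟩ : PRa.RawHom ⟨A, trueT A, isPred_true A⟩ ⟨B, trueT B, isPred_true B⟩))
    (fun f g h => by
      refine (Implies_iff _ _).2 ?_
      rw [mk_eqT, mk_eq.2 h]; exact HImp_heqT_self _ _ _) f
  map_id _ := rfl
  map_comp := by rintro A B C ⟨f⟩ ⟨g⟩; rfl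

/-! ### Coding -/

/-- The number `n`, on any domain. -/
def num (G : PR) : ℕ → Term G nat
  | 0 => zeroT G
  | n + 1 => succ ∘ₜ num G n

/-- The sum `1 + ⋯ + n`. -/
def tri : Term nat nat :=
  prec (zeroT one) (add (snd _ _) (succ ∘ₜ snd one nat ∘ₜ fst _ _)) ∘ₜ pair (bang nat) (ident nat)

/-- Cantor's pairing of numbers. -/
def cpair {G : PR} (u v : Term G nat) : Term G nat := add (tri ∘ₜ add u v) v

/-- Cantor's count `nat → nat × nat`, inverse to the pairing: it walks along the antidiagonals,
`(0, y) ↦ (y + 1, 0)` and `(x + 1, y) ↦ (x, y + 1)`. -/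
def count : Term nat (prod nat nat) :=
  iter (cond (fst nat nat) (pair (pred ∘ₜ fst nat nat) (succ ∘ₜ snd nat nat))
    (pair (succ ∘ₜ snd nat nat) (zeroT _))) ∘ₜ pair (pair (zeroT _) (zeroT _)) (ident nat)

/-- Goedel number of an expression of kind `t` with constituent `a`.  The kinds are: `0` symbols,
`1` compositions `(v ∘ u)`, `2` pairs `(x , y)`; all other kinds are left for other expressions. -/
def code {G : PR} (t : ℕ) (a : Term G nat) : Term G nat := succ ∘ₜ cpair (num G t) a

/-- Goedel number of the symbol `0`. -/
def codeZero (G : PR) : Term G nat := code 0 (num G 0)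
/-- Goedel number of the symbol `s`. -/
def codeSucc (G : PR) : Term G nat := code 0 (num G 1)
/-- Goedel number of the symbol `⊥`, the undefined value. -/
def bott (G : PR) : Term G nat := code 0 (num G 2)
/-- Goedel number of the composition `(v ∘ u)`. -/
def codeComp {G : PR} (v u : Term G nat) : Term G nat := code 1 (cpair v u)
/-- Goedel number of the pair `(x , y)`. -/
def codePair {G : PR} (x y : Term G nat) : Term G nat := code 2 (cpair x y)

/-- First constituent of the expression with Goedel number `z`. -/
def arg1 {G : PR} (z : Term G nat) : Term G nat :=
  fst nat nat ∘ₜ count ∘ₜ snd nat nat ∘ₜ count ∘ₜ pred ∘ₜ z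
/-- Second constituent of the expression with Goedel number `z`. -/
def arg2 {G : PR} (z : Term G nat) : Term G nat :=
  snd nat nat ∘ₜ count ∘ₜ snd nat nat ∘ₜ count ∘ₜ pred ∘ₜ z

/-- `z` is the Goedel number of a pair. -/
def isPair {G : PR} (z : Term G nat) : Term G nat := eqT nat z (codePair (arg1 z) (arg2 z))

/-- Course-of-values recursion: `cov h` is `n ↦ h (n, t)` where `t` lists the values below `n`. -/
def cov (h : Term (prod nat nat) nat) : Term nat nat :=
  fst nat nat ∘ₜ count ∘ₜ prec (zeroT one)
    (cpair (h ∘ₜ pair (snd one nat ∘ₜ fst _ _) (snd _ _)) (snd _ _)) ∘ₜ pair (bang nat) succ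

/-- The value at `k < n` in the list `t` of the values below `n`. -/
def look {G : PR} (k n t : Term G nat) : Term G nat :=
  fst nat nat ∘ₜ count ∘ₜ iter (snd nat nat ∘ₜ count) ∘ₜ pair t (sub n (succ ∘ₜ k))

/-- Internal numerals: `nu 0` is the code of `0`, `nu (n + 1)` is the code of `(s ∘ nu n)`. -/
def nu : Term nat nat :=
  iter (codeComp (codeSucc nat) (ident nat)) ∘ₜ pair (codeZero nat) (ident nat)

/-- The number with a given internal numeral (and some number if there is none). -/
def nuInv : Term nat nat :=
  cov (cond (eqT nat (fst nat nat) (codeComp (codeSucc _) (arg2 (fst nat nat))))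
    (succ ∘ₜ look (arg2 (fst nat nat)) (fst nat nat) (snd nat nat)) (zeroT _))

/-- The image predicate of the internal numerals. -/
def isNum {G : PR} (z : Term G nat) : Term G nat := eqT nat (nu ∘ₜ nuInv ∘ₜ z) z

/-- The predicate of the universal object `X` of internal numerals and nested pairs of internal
numerals. -/
def inX : Term nat nat :=
  cov (or (isNum (fst nat nat)) (and (isPair (fst nat nat))
    (and (look (arg1 (fst nat nat)) (fst nat nat) (snd nat nat))
      (look (arg2 (fst nat nat)) (fst nat nat) (snd nat nat)))))

/-- The predicate of `X ∪ {⊥}`. -/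
def inXbot : Term nat nat := or inX (eqT nat (ident nat) (bott nat))

/-! ### The universe monoid -/

/-- `z` belongs to `X` and is a pair. -/
def isXPair : Term nat nat := and inX (isPair (ident nat))

/-- Identity of `X`. -/
def xId : Term nat nat := cond inX (ident nat) (bott nat)
/-- `nu 0 ↦ nu 0`. -/
def xZero : Term nat nat :=
  cond (eqT nat (ident nat) (nu ∘ₜ zeroT nat)) (nu ∘ₜ zeroT nat) (bott nat)
/-- `nu n ↦ nu (s n)`. -/
def xSucc : Term nat nat := cond (isNum (ident nat)) (nu ∘ₜ succ ∘ₜ nuInv) (bott nat)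
/-- `x ↦ nu 0` on `X`. -/
def xBang : Term nat nat := cond inX (nu ∘ₜ zeroT nat) (bott nat)
/-- `(x , y) ↦ x` on pairs in `X`. -/
def xFst : Term nat nat := cond isXPair (arg1 (ident nat)) (bott nat)
/-- `(x , y) ↦ y` on pairs in `X`. -/
def xSnd : Term nat nat := cond isXPair (arg2 (ident nat)) (bott nat)
/-- `x ↦ (f x , g x)` on those `x` in `X` for which both values are defined. -/
def xPair (f g : Term nat nat) : Term nat nat :=
  cond (and inX (and (inX ∘ₜ f) (inX ∘ₜ g))) (codePair f g) (bott nat)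
/-- `(x , y) ↦ (f x , g y)` on those pairs in `X` for which both values are defined. -/
def xProd (f g : Term nat nat) : Term nat nat :=
  cond (and isXPair (and (inX ∘ₜ f ∘ₜ arg1 (ident nat)) (inX ∘ₜ g ∘ₜ arg2 (ident nat))))
    (codePair (f ∘ₜ arg1 (ident nat)) (g ∘ₜ arg2 (ident nat))) (bott nat)
/-- `(x , nu n) ↦ f^n x` on the pairs in `X` whose second component is an internal numeral. -/
def xIter (f : Term nat nat) : Term nat nat :=
  cond (and isXPair (isNum (arg2 (ident nat))))
    (iter f ∘ₜ pair (arg1 (ident nat)) (nuInv ∘ₜ arg2 (ident nat))) (bott nat)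

/-- The universe monoid, a set of endomaps of `nat` in the theory of primitive recursion. Equality
of its elements is the one of that theory. -/
inductive IsPRX : Term nat nat → Prop
  | id : IsPRX xId
  | zero : IsPRX xZero
  | succ : IsPRX xSucc
  | bang : IsPRX xBang
  | fst : IsPRX xFst
  | snd : IsPRX xSnd
  | comp {f g : Term nat nat} : IsPRX f → IsPRX g → IsPRX (g ∘ₜ f)
  | pair {f g : Term nat nat} : IsPRX f → IsPRX g → IsPRX (xPair f g)
  | prod {f g : Term nat nat} : IsPRX f → IsPRX g → IsPRX (xProd f g)
  | iter {f : Term nat nat} : IsPRX f → IsPRX (xIter f)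
  | of_eqv {f g : Term nat nat} : Eqv f g → IsPRX f → IsPRX g

/-- The numeralisation `A → X` of the object `A`. -/
def nuMap : (A : PR) → Term A nat
  | one => nu ∘ₜ zero
  | nat => nu
  | prod A B => codePair (nuMap A ∘ₜ fst A B) (nuMap B ∘ₜ snd A B)

/-- The inverse of the numeralisation, on its image. -/
def nuMapInv : (A : PR) → Term nat A
  | one => bang nat
  | nat => nuInv
  | prod A B => pair (nuMapInv A ∘ₜ arg1 (ident nat)) (nuMapInv B ∘ₜ arg2 (ident nat))

/-- The image predicate of the numeralisation of `A`. -/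
def imPred (A : PR) : Term nat nat := eqT nat (nuMap A ∘ₜ nuMapInv A) (ident nat)

/-- The numeral twin of `f : A → B`: the map `nuMap B ∘ f ∘ (nuMap A)⁻¹` on the image of `nuMap A`,
and undefined (with value `⊥`) elsewhere. -/
def twin {A B : PR} (f : Term A B) : Term nat nat :=
  cond (imPred A) (nuMap B ∘ₜ f ∘ₜ nuMapInv A) (bott nat)

end PR

open PR in
/-- An object of the universe theory with predicate abstraction: a predicative subobject
`{X : χ}` of the universal object `X`. -/
@[ext]
structure PRXa : Type where
  pred : Term PR.nat PR.nat
  isPred : IsPred pred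

namespace PRXa

open PR Term

/-- The predicative subset of `nat` underlying an object. -/
def toObj (P : PRXa) : PRa := ⟨PR.nat, and inX P.pred, isPred_and _ _⟩

theorem rep_xId (P : PRXa) : PRa.Rep (P := P.toObj) (Q := P.toObj) xId (𝟙 P.toObj) :=
  PRa.rep_cond_id inX P.pred (bott PR.nat)

/-- Maps of the universe theory with predicate abstraction: the maps between predicative subobjects
given by an element of the universe monoid. -/
@[ext]
structure Hom (P Q : PRXa) : Type where
  map : P.toObj ⟶ Q.toObj
  isPRX : ∃ u, IsPRX u ∧ PRa.Rep (P := P.toObj) (Q := Q.toObj) u map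

instance : Category PRXa where
  Hom := Hom
  id P := ⟨𝟙 _, xId, .id, rep_xId P⟩
  comp f g := ⟨f.map ≫ g.map, by
    obtain ⟨u, hu, hu'⟩ := f.isPRX
    obtain ⟨v, hv, hv'⟩ := g.isPRX
    exact ⟨v ∘ₜ u, .comp hu hv, hu'.comp hv'⟩⟩
  id_comp f := Hom.ext (Category.id_comp f.map)
  comp_id f := Hom.ext (Category.comp_id f.map)
  assoc f g h := Hom.ext (Category.assoc f.map g.map h.map)

/-- The underlying functor `PRXa ⥤ PRa`. -/
def forget : PRXa ⥤ PRa where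
  obj P := P.toObj
  map f := f.map

/-- The map `h` is given by the endomap term `u` of `nat`. -/
def Rep {P Q : PRXa} (u : Term PR.nat PR.nat) (h : P ⟶ Q) : Prop :=
  PRa.Rep (P := P.toObj) (Q := Q.toObj) u h.map

end PRXa

/-- The objects of the universe theory `PRX` before predicate abstraction: the universal object,
and nested products formed from it, a terminal object and a natural numbers object. -/
inductive PRX : Type
  | univ : PRX
  | one : PRX
  | nat : PRX
  | prod : PRX → PRX → PRX

namespace PRX

open PR Term

/-- The predicate on `X` of an object: `X`, `{nu 0}`, the internal numerals, and sets of pairs. -/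
def pred : PRX → Term PR.nat PR.nat
  | univ => trueT PR.nat
  | one => eqT PR.nat (ident PR.nat) (nu ∘ₜ zeroT PR.nat)
  | nat => isNum (ident PR.nat)
  | prod S T => PR.and (isPair (ident PR.nat))
      (PR.and (S.pred ∘ₜ arg1 (ident PR.nat)) (T.pred ∘ₜ arg2 (ident PR.nat)))

theorem isPred : ∀ S : PRX, IsPred S.pred
  | univ => isPred_true _
  | one => isPred_and _ _
  | nat => isPred_and _ _
  | prod _ _ => isPred_and _ _

/-- Objects of `PRX` as objects of `PRXa`. -/
def toPRXa (S : PRX) : PRXa := ⟨S.pred, S.isPred⟩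

instance : Category PRX := inferInstanceAs (Category (InducedCategory PRXa toPRXa))

/-- The inclusion of `PRX` in `PRXa`. -/
def incl : PRX ⥤ PRXa := inducedFunctor toPRXa

/-- The object of internal numerals and pairs corresponding to an object of `PR`. -/
def ofPR : PR → PRX
  | .one => one
  | .nat => nat
  | .prod A B => prod (ofPR A) (ofPR B)

end PRX

namespace PRXa

open PR Term

/-- The object `nu {A : χ}`: the image of `{A : χ}` under the numeralisation of `A`. -/
def ofPRa (P : PRa) : PRXa :=
  ⟨PR.and (imPred P.carrier) (P.pred ∘ₜ nuMapInv P.carrier), isPred_and _ _⟩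

/-- The cartesian p.r. structure `S`, regarded within `PRXa` by means of `F`, is given by the
constants and operations of the universe monoid. -/
structure IsStandard {C : Type*} [Category C] (S : CartesianPR C) (F : C ⥤ PRXa) : Prop where
  bang : ∀ A : C, Rep xBang (F.map (S.bang A))
  fst : ∀ A B : C, Rep xFst (F.map (S.fst A B))
  snd : ∀ A B : C, Rep xSnd (F.map (S.snd A B))
  lift : ∀ {D A B : C} (f : D ⟶ A) (g : D ⟶ B) (u v : Term PR.nat PR.nat),
    Rep u (F.map f) → Rep v (F.map g) → Rep (xPair u v) (F.map (S.lift f g))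
  zero : Rep xZero (F.map S.zero)
  succ : Rep xSucc (F.map S.succ)
  iter : ∀ {A : C} (f : A ⟶ A) (u : Term PR.nat PR.nat),
    Rep u (F.map f) → Rep (xIter u) (F.map (S.iter f))

end PRXa

open PR PR.Term in
/-- The truth object `{n ∈ nat : n ≤ 1}`. -/
def PRa.two : PRa :=
  ⟨PR.nat, le (ident PR.nat) (trueT PR.nat), by
    refine mk_eq.1 ?_
    change (hsub (𝟙 PR.nat) (hZ PR.nat ≫ hS) ≫ hneg) ≫ hneg ≫ hneg =
      hsub (𝟙 PR.nat) (hZ PR.nat ≫ hS) ≫ hneg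
    simp only [Category.assoc, neg_neg_neg]⟩

/-- `Ω` is a truth object: the sum of `ff` and `tt`, with products distributing over this sum
(definition of maps by case distinction). -/
def CartesianPR.IsTruthObject {C : Type*} [Category C] (S : CartesianPR C) {Ω : C}
    (ff tt : S.one ⟶ Ω) : Prop :=
  ∀ {A B : C} (f g : A ⟶ B), ∃! h : S.prod A Ω ⟶ B,
    S.lift (𝟙 A) (S.bang A ≫ tt) ≫ h = f ∧ S.lift (𝟙 A) (S.bang A ≫ ff) ≫ h = g

/-- `e` is the equality predicate of `P`, with truth value `tt`. -/
def CartesianPR.IsEqualityPred {C : Type*} [Category C] (S : CartesianPR C) {Ω : C}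
    (tt : S.one ⟶ Ω) {P : C} (e : S.prod P P ⟶ Ω) : Prop :=
  ∀ {Q : C} (f g : Q ⟶ P), S.lift f g ≫ e = S.bang Q ≫ tt ↔ f = g

/-- The image of a functor on objects; if the functor is full, the full subcategory on these objects
is the image of the functor. -/
def imageProp {C D : Type*} [Category C] [Category D] (F : C ⥤ D) : ObjectProperty D :=
  fun Y => ∃ X, F.obj X = Y

/-- A functor, with codomain restricted to its image. -/
def toImage {C D : Type*} [Category C] [Category D] (F : C ⥤ D) :
    C ⥤ (imageProp F).FullSubcategory :=
  (imageProp F).lift F fun X => ⟨X, rfl⟩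

namespace PR

open Term

/-! ### Two-valued models of the theory of primitive recursion

A prime filter of predicates on an object `G` turns the maps with domain `G` into a two-valued model
of the theory; equality of maps is equality in all models. -/

/-! Derivability in `PR` is treated semantically. Maps `G ⟶ nat` are read as truth values, nonzero
meaning true, and ordered by derivable implication. A prime filter of them makes the maps with
domain `G` into a two-valued model: the elements of `A` are maps `G ⟶ A` modulo "the equality
predicate lies in the filter", and terms act by composition. Primeness makes every number of a model
zero or a successor. If `u` and `v` are not derivably equal, Zorn's lemma extends the negation of
their equality predicate to a maximal filter on their domain, and the identity, as generic element,
separates them. Thus `eqv_iff_ev` and `implies_iff_ev` replace derivations by computations with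
elements. Freyd's uniqueness becomes induction inside a model for predicates definable with
parameters (`induct`). It yields enough arithmetic to show that `count` inverts Cantor's pairing and
that codes exceed their constituents. Hence the course-of-values recursions behind `nuInv` and `inX`
satisfy their intended equations, and numerals, pairs and `⊥` are told apart. A numeral twin is
determined by its values on the image of the numeralisation and by `⊥` elsewhere (`twin_eqv`), so
the laws of twins are pointwise checks. Twins belong to the universe monoid because the restriction
of the identity to each image does (`isPRX_twin_ident`); for numerals the successor is iterated on
`ν0`. Maps of `PRa` and of `PRXa` are equal iff representing terms agree on members in all models.
This gives the cartesian p.r. structures, the equalisers and the preservation statements. The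
embedding is faithful since numeralisation is injective, and full since a map `k` between images
comes from `ν⁻¹ ∘ k ∘ ν`, a map of `PR`. Its inverse on the image is strict, and the structure of
the image is transported along it. Elements of the universe monoid are `⊥` outside `X`
(`ev_eq_bot`), so map equality on `X` is equality in `PR`. For the other domains concerned,
uniqueness of the element comes with existence by precomposing with a restriction of the identity
that lies in the monoid. -/

theorem and_one {G : PR} (a : G ⟶ nat) : hand a (hZ G ≫ hS) = a ≫ hneg ≫ hneg := by
  have : hand (hsnd G nat) (hZ _ ≫ hS) = hsnd G nat ≫ hneg ≫ hneg := by
    apply cases_ext <;> simp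
  simpa using on_var a this

/-- Cases on `a` settle it. This form of currying turns the inconsistency of `a` with `b` into a
derivation of the negation of `b` from `a`, as needed for maximal filters and for completeness. -/
theorem himp_neg {G : PR} (a b : G ⟶ nat) : himp a (b ≫ hneg) = himp (hand a b) (hZ G) := by
  have : himp (hsnd G nat) (hfst G nat ≫ b ≫ hneg) =
      himp (hand (hsnd G nat) (hfst G nat ≫ b)) (hZ _) := by
    apply cases_ext <;> simp [himp, and_one]
  simpa using on_var a this

theorem HImpl_neg_neg {G : PR} (a : G ⟶ nat) : HImpl (a ≫ hneg ≫ hneg) a := by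
  have : himp (hsnd G nat ≫ hneg ≫ hneg) (hsnd G nat) = hZ _ ≫ hS := by
    apply cases_ext <;> simp [himp]
  simpa [HImpl] using on_var a this

theorem HImpl_heqT_Z {G : PR} (a : G ⟶ nat) : HImpl (a ≫ hneg) (heqT nat a (hZ G)) := by
  have : himp (hsnd G nat ≫ hneg) (heqT nat (hsnd G nat) (hZ _)) = hZ _ ≫ hS := by
    apply cases_ext <;> simp [himp, heqT]
  simpa [HImpl] using on_var a this

/-- Together with `HImpl_heqT_Z` this is the alternative "zero or successor" in the form of
derivable implications; a prime filter then decides which one applies. -/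
theorem HImpl_heqT_pred {G : PR} (a : G ⟶ nat) : HImpl a (heqT nat a (a ≫ hpred ≫ hS)) := by
  have : himp (hsnd G nat) (heqT nat (hsnd G nat) (hsnd G nat ≫ hpred ≫ hS)) = hZ _ ≫ hS := by
    apply cases_ext
    · simp [himp, heqT]
    · have : hsnd G nat ≫ hS ≫ hpred ≫ hS = hsnd G nat ≫ hS := by
        rw [← Category.assoc, ← Category.assoc, Category.assoc (hsnd G nat), pred_S]
      rw [comp_imp, comp_heqT, hpair_snd, hpair_snd', Category.assoc, this, heqT_self]
      simp [himp]
  simpa [HImpl] using on_var a this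

theorem HImpl_absurd {G : PR} (a : G ⟶ nat) : HImpl (hand a (a ≫ hneg)) (hZ G) := by
  have : himp (hand (hsnd G nat) (hsnd G nat ≫ hneg)) (hZ _) = hZ _ ≫ hS := by
    apply cases_ext <;> simp [himp]
  simpa [HImpl] using on_var a this

theorem HImpl_heqT_Z_absurd {G : PR} (a : G ⟶ nat) :
    HImpl (hand a (heqT nat a (hZ G))) (hZ G) := by
  have : himp (hand (hsnd G nat) (heqT nat (hsnd G nat) (hZ _))) (hZ _) = hZ _ ≫ hS := by
    apply cases_ext <;> simp [himp, heqT]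
  simpa [HImpl] using on_var a this

theorem HImpl_heqT_symm {G B : PR} (u v : G ⟶ B) : HImpl (heqT B u v) (heqT B v u) :=
  (HImp_heqT_iff _ _ _ _ u).2 ((HImp_heqT_iff _ _ _ _ u).1 (HImpl.refl _)).symm

theorem HImpl_heqT_trans {G B : PR} (u v w : G ⟶ B) :
    HImpl (hand (heqT B u v) (heqT B v w)) (heqT B u w) :=
  (HImp_heqT_iff _ _ _ _ u).2 (((HImp_heqT_iff _ _ _ _ u).1 (HImpl.and_left _ _)).trans
    ((HImp_heqT_iff _ _ _ _ u).1 (HImpl.and_right _ _)))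

/-- A proper filter of predicates on `G`. -/
structure IsFilt {G : PR} (F : Set (G ⟶ nat)) : Prop where
  one_mem : hZ G ≫ hS ∈ F
  and_mem : ∀ {a b}, a ∈ F → b ∈ F → hand a b ∈ F
  up : ∀ {a b}, a ∈ F → HImpl a b → b ∈ F
  zero_notMem : hZ G ∉ F

/-- Zorn's lemma above the principal filter of `p`, which is proper because `p` does not imply
false. The union of a chain of proper filters is proper, as falsity would already lie in one of
them. -/
theorem IsFilt.exists_maximal {G : PR} {p : G ⟶ nat} (hp : ¬ HImpl p (hZ G)) :
    ∃ F : Set (G ⟶ nat), IsFilt F ∧ p ∈ F ∧ ∀ F', IsFilt F' → F ⊆ F' → F' = F := by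
  have h0 : IsFilt {d | HImpl p d} :=
    ⟨HImpl.true _, fun h k => HImpl.and h k, fun h k => HImpl.trans h k, hp⟩
  obtain ⟨F, hF, hm⟩ := zorn_subset_nonempty {F : Set (G ⟶ nat) | IsFilt F} (by
    intro c hc hch ⟨F₀, hF₀⟩
    refine ⟨⋃₀ c, ⟨⟨F₀, hF₀, (hc hF₀).one_mem⟩, ?_, ?_, ?_⟩, fun s hs => Set.subset_sUnion_of_mem hs⟩
    · rintro a b ⟨s, hs, ha⟩ ⟨t, ht, hb⟩
      rcases hch.total hs ht with h | h
      · exact ⟨t, ht, (hc ht).and_mem (h ha) hb⟩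
      · exact ⟨s, hs, (hc hs).and_mem ha (h hb)⟩
    · rintro a b ⟨s, hs, ha⟩ h
      exact ⟨s, hs, (hc hs).up ha h⟩
    · rintro ⟨s, hs, ha⟩
      exact (hc hs).zero_notMem ha) _ h0
  exact ⟨F, hm.1, hF (HImpl.refl p), fun F' hF' h => (hm.2 hF' h).antisymm h⟩

/-- Maximal filters are prime: the filter generated by `F` and `a` is improper, and then some `f ∈
F` implies the negation of `a`, or it is proper and hence equals `F`. -/
theorem IsFilt.mem_or_neg_mem {G : PR} {F : Set (G ⟶ nat)} (hF : IsFilt F)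
    (hm : ∀ F', IsFilt F' → F ⊆ F' → F' = F) (a : G ⟶ nat) : a ∈ F ∨ a ≫ hneg ∈ F := by
  by_contra h
  rw [not_or] at h
  have : IsFilt {d | ∃ f ∈ F, HImpl (hand f a) d} := by
    refine ⟨⟨_, hF.one_mem, HImpl.true _⟩, ?_, ?_, ?_⟩
    · rintro b c ⟨f, hf, h⟩ ⟨g, hg, k⟩
      have h1 := (HImpl.and_left (hand f g) a).trans (HImpl.and_left _ _)
      have h2 := (HImpl.and_left (hand f g) a).trans (HImpl.and_right _ _)
      exact ⟨_, hF.and_mem hf hg, HImpl.and ((h1.and (HImpl.and_right _ _)).trans h)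
        ((h2.and (HImpl.and_right _ _)).trans k)⟩
    · rintro b c ⟨f, hf, h⟩ k
      exact ⟨f, hf, h.trans k⟩
    · rintro ⟨f, hf, k⟩
      refine h.2 (hF.up hf ?_)
      rw [HImpl, himp_neg]
      exact k
  refine h.1 ?_
  rw [← hm _ this fun f hf => ⟨f, hf, HImpl.and_left _ _⟩]
  exact ⟨_, hF.one_mem, HImpl.and_right _ _⟩

/-- A two-valued model of the theory of primitive recursion. -/
structure Model where
  G : PR
  F : Set (G ⟶ nat)
  isFilt : IsFilt F
  prime : ∀ a, a ∈ F ∨ a ≫ hneg ∈ F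

namespace Model

/-- Equality of maps on the prime filter. -/
def eqv (M : Model) (A : PR) : Setoid (M.G ⟶ A) where
  r u v := heqT A u v ∈ M.F
  iseqv := by
    refine ⟨fun u => ?_, fun h => M.isFilt.up h (HImpl_heqT_symm _ _), fun h k =>
      M.isFilt.up (M.isFilt.and_mem h k) (HImpl_heqT_trans _ _ _)⟩
    rw [heqT_self]; exact M.isFilt.one_mem

/-- The elements of an object in a model. -/
def El (M : Model) (A : PR) : Type := Quotient (M.eqv A)

variable {M : Model} {A B C D : PR}

/-- The element given by a map. -/
def elt (x : M.G ⟶ A) : El M A := Quotient.mk (M.eqv A) x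

theorem elt_eq_elt {x y : M.G ⟶ A} : elt x = elt y ↔ heqT A x y ∈ M.F := Quotient.eq (r := M.eqv A)

theorem exists_elt (a : El M A) : ∃ x, elt x = a := Quotient.exists_rep a

/-- The value of a map term. -/
def ev (t : Term A B) (a : El M A) : El M B :=
  Quotient.map (sa := M.eqv A) (sb := M.eqv B) (fun x => x ≫ cls t)
    (fun _ _ h => M.isFilt.up h (HImp_heqT_comp (HImpl.refl _) _)) a

theorem ev_elt (t : Term A B) (x : M.G ⟶ A) : ev t (elt x) = elt (x ≫ cls t) := rfl

theorem ev_congr {s t : Term A B} (h : Eqv s t) (a : El M A) : ev s a = ev t a := by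
  obtain ⟨x, rfl⟩ := exists_elt a
  rw [ev_elt, ev_elt, PR.mk_eq.2 h]

@[simp] theorem ev_ident (a : El M A) : ev (ident A) a = a := by
  obtain ⟨x, rfl⟩ := exists_elt a
  rw [ev_elt, mk_id, Category.comp_id]

@[simp] theorem ev_comp (g : Term B C) (f : Term A B) (a : El M A) :
    ev (g ∘ₜ f) a = ev g (ev f a) := by
  obtain ⟨x, rfl⟩ := exists_elt a
  rw [ev_elt, ev_elt, ev_elt, mk_comp, Category.assoc]

/-- The pair of two elements. -/
def mkp (a : El M A) (b : El M B) : El M (prod A B) :=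
  Quotient.map₂ (sa := M.eqv A) (sb := M.eqv B) (sc := M.eqv (prod A B)) (fun x y => hpair x y)
    (fun x x' h y y' k => by
      change heqT _ _ _ ∈ _
      simpa [heqT] using M.isFilt.and_mem h k) a b

theorem mkp_elt (x : M.G ⟶ A) (y : M.G ⟶ B) : mkp (elt x) (elt y) = elt (hpair x y) := rfl

@[simp] theorem ev_pair (f : Term D A) (g : Term D B) (a : El M D) :
    ev (pair f g) a = mkp (ev f a) (ev g a) := by
  obtain ⟨x, rfl⟩ := exists_elt a
  rw [ev_elt, ev_elt, ev_elt, mkp_elt]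
  exact congrArg elt (comp_hpair x (cls f) (cls g))

@[simp] theorem ev_fst_mkp (a : El M A) (b : El M B) : ev (fst A B) (mkp a b) = a := by
  obtain ⟨x, rfl⟩ := exists_elt a
  obtain ⟨y, rfl⟩ := exists_elt b
  exact congrArg elt (hpair_fst x y)

@[simp] theorem ev_snd_mkp (a : El M A) (b : El M B) : ev (snd A B) (mkp a b) = b := by
  obtain ⟨x, rfl⟩ := exists_elt a
  obtain ⟨y, rfl⟩ := exists_elt b
  exact congrArg elt (hpair_snd x y)

@[simp] theorem mkp_eta (z : El M (prod A B)) : mkp (ev (fst A B) z) (ev (snd A B) z) = z := by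
  rw [← ev_pair]
  exact (ev_congr ((Eqv.pair_congr (.symm (.comp_id _)) (.symm (.comp_id _))).trans
    (.surj_pair (ident _))) z).trans (ev_ident z)

theorem exists_mkp (z : El M (prod A B)) : ∃ a b, z = mkp a b := ⟨_, _, (mkp_eta z).symm⟩

@[simp] theorem mkp_inj {a a' : El M A} {b b' : El M B} :
    mkp a b = mkp a' b' ↔ a = a' ∧ b = b' := by
  refine ⟨fun h => ⟨?_, ?_⟩, by rintro ⟨rfl, rfl⟩; rfl⟩
  · simpa using congrArg (ev (fst A B)) h
  · simpa using congrArg (ev (snd A B)) h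

instance : Unique (El M one) where
  default := elt (cls (bang M.G))
  uniq a := by
    obtain ⟨x, rfl⟩ := exists_elt a
    exact congrArg elt (one_uniq _ _)

instance : Zero (El M nat) := ⟨elt (hZ M.G)⟩

/-- The successor. -/
def S (n : El M nat) : El M nat := ev succ n

instance : One (El M nat) := ⟨S 0⟩

theorem one_def : (1 : El M nat) = S 0 := rfl

@[simp] theorem ev_succ (n : El M nat) : ev succ n = S n := rfl

@[simp] theorem ev_zero (a : El M one) : ev zero a = 0 := by
  obtain ⟨x, rfl⟩ := exists_elt a
  have : x = cls (bang M.G) := one_uniq _ _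
  rw [this]; rfl

/-- Membership in the filter is truth. By primeness a value outside the filter has its negation
inside, and the negation implies being equal to zero. -/
theorem elt_eq_zero {x : M.G ⟶ nat} : elt x = 0 ↔ x ∉ M.F := by
  refine Iff.trans elt_eq_elt ⟨fun h k => ?_, fun h => ?_⟩
  · exact M.isFilt.zero_notMem (M.isFilt.up (M.isFilt.and_mem k h) (HImpl_heqT_Z_absurd x))
  · exact M.isFilt.up ((M.prime x).resolve_left h) (HImpl_heqT_Z x)

theorem elt_ne_zero {x : M.G ⟶ nat} : elt x ≠ 0 ↔ x ∈ M.F := by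
  rw [Ne, elt_eq_zero, not_not]

@[simp] theorem S_ne_zero (n : El M nat) : S n ≠ 0 := by
  obtain ⟨x, rfl⟩ := exists_elt n
  refine elt_ne_zero.2 (M.isFilt.up M.isFilt.one_mem ?_)
  change HImpl _ (x ≫ hS)
  simp [HImpl, himp]

@[simp] theorem zero_ne_S (n : El M nat) : 0 ≠ S n := (S_ne_zero n).symm

instance : NeZero (1 : El M nat) := ⟨S_ne_zero 0⟩

/-- The predecessor is the witness. Models may contain nonstandard numbers, yet this alternative
still allows case distinction on them. -/
theorem zero_or_S (n : El M nat) : n = 0 ∨ ∃ m, n = S m := by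
  obtain ⟨x, rfl⟩ := exists_elt n
  refine or_iff_not_imp_left.2 fun h => ⟨elt (x ≫ hpred), ?_⟩
  exact elt_eq_elt.2 (M.isFilt.up (elt_ne_zero.1 h) (by
    change HImpl x (heqT nat x ((x ≫ hpred) ≫ hS))
    rw [Category.assoc]; exact HImpl_heqT_pred x))

@[simp] theorem ev_zeroT (a : El M A) : ev (zeroT A) a = 0 := by simp [zeroT]
@[simp] theorem ev_trueT (a : El M A) : ev (trueT A) a = 1 := by simp [trueT, one_def]

@[simp] theorem ev_iter_zero (f : Term A A) (a : El M A) : ev (iter f) (mkp a 0) = a := by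
  simpa using ev_congr (Eqv.iter_zero f) a

@[simp] theorem ev_iter_S (f : Term A A) (a : El M A) (n : El M nat) :
    ev (iter f) (mkp a (S n)) = ev f (ev (iter f) (mkp a n)) := by
  simpa using ev_congr (Eqv.iter_succ f) (mkp a n)

theorem ev_eq_of_cls {s t : Term A B} (h : cls s = cls t) (a : El M A) : ev s a = ev t a :=
  ev_congr (PR.mk_eq.1 h) a

@[simp] theorem ev_prec_zero (g : Term A B) (h : Term (prod (prod A nat) B) B) (a : El M A) :
    ev (prec g h) (mkp a 0) = ev g a := by
  have : cls (prec g h ∘ₜ pair (ident A) (zeroT A)) = cls g :=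
    (prec_Z (𝟙 A) (cls g) (cls h)).trans (Category.id_comp _)
  simpa using ev_eq_of_cls this a

@[simp] theorem ev_prec_S (g : Term A B) (h : Term (prod (prod A nat) B) B) (a : El M A)
    (n : El M nat) :
    ev (prec g h) (mkp a (S n)) = ev h (mkp (mkp a n) (ev (prec g h) (mkp a n))) := by
  have : cls (prec g h ∘ₜ pair (fst A nat) (succ ∘ₜ snd A nat)) =
      cls (h ∘ₜ pair (ident _) (prec g h)) :=
    (prec_S (hfst A nat) (hsnd A nat) (cls g) (cls h)).trans (by
      rw [hpair_eta, Category.id_comp]; rfl)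
  simpa using ev_eq_of_cls this (mkp a n)

@[simp] theorem ev_caseT_zero (g : Term A B) (h : Term (prod A nat) B) (a : El M A) :
    ev (caseT g h) (mkp a 0) = ev g a := by simp [caseT]
@[simp] theorem ev_caseT_S (g : Term A B) (h : Term (prod A nat) B) (a : El M A) (n : El M nat) :
    ev (caseT g h) (mkp a (S n)) = ev h (mkp a n) := by simp [caseT]

open Classical in
@[simp] theorem ev_cond (c : Term A nat) (u v : Term A B) (a : El M A) :
    ev (cond c u v) a = if ev c a ≠ 0 then ev u a else ev v a := by
  rcases zero_or_S (ev c a) with h | ⟨m, h⟩ <;> simp [cond, h]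

@[simp] theorem ev_neg_ne_zero (n : El M nat) : ev neg n ≠ 0 ↔ n = 0 := by
  rcases zero_or_S n with rfl | ⟨m, rfl⟩ <;> simp [neg]

@[simp] theorem ev_neg_eq_zero (n : El M nat) : ev neg n = 0 ↔ n ≠ 0 := by
  rw [← not_iff_not, not_not]; exact ev_neg_ne_zero n

open Classical in
theorem ev_neg (n : El M nat) : ev neg n = if n = 0 then 1 else 0 := by
  rcases zero_or_S n with rfl | ⟨m, rfl⟩ <;> simp [neg]

open Classical in
@[simp] theorem ev_sign (n : El M nat) : ev sign n = if n = 0 then 0 else 1 := by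
  rcases zero_or_S n with rfl | ⟨m, rfl⟩ <;> simp [sign, ev_neg]

@[simp] theorem ev_pred_zero : ev pred (0 : El M nat) = 0 := by simp [pred]
@[simp] theorem ev_pred_S (n : El M nat) : ev pred (S n) = n := by simp [pred]

theorem S_injective : Function.Injective (S : El M nat → El M nat) :=
  Function.LeftInverse.injective ev_pred_S

@[simp] theorem S_inj {m n : El M nat} : S m = S n ↔ m = n := S_injective.eq_iff

theorem ev_and_ne_zero (u v : Term A nat) (a : El M A) :
    ev (and u v) a ≠ 0 ↔ ev u a ≠ 0 ∧ ev v a ≠ 0 := by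
  obtain ⟨x, rfl⟩ := exists_elt a
  rw [ev_elt, ev_elt, ev_elt, elt_ne_zero, elt_ne_zero, elt_ne_zero, mk_and, comp_and]
  exact ⟨fun h => ⟨M.isFilt.up h (HImpl.and_left _ _), M.isFilt.up h (HImpl.and_right _ _)⟩,
    fun h => M.isFilt.and_mem h.1 h.2⟩

theorem ev_isPred {c : Term A nat} (hc : IsPred c) (a : El M A) : ev c a = 0 ∨ ev c a = 1 := by
  have := ev_congr hc a
  rw [ev_comp, ev_sign] at this
  rw [← this]
  split <;> simp

theorem ev_or_ne_zero (u v : Term A nat) (a : El M A) :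
    ev (or u v) a ≠ 0 ↔ ev u a ≠ 0 ∨ ev v a ≠ 0 := by
  rw [or, ev_comp, ev_neg_ne_zero, ← not_iff_not, ← Ne, ev_and_ne_zero]
  simp

theorem ev_imp_ne_zero (u v : Term A nat) (a : El M A) :
    ev (imp u v) a ≠ 0 ↔ (ev u a ≠ 0 → ev v a ≠ 0) := by
  rw [imp, ev_comp, ev_neg_ne_zero, ← not_iff_not, ← Ne, ev_and_ne_zero]
  simp

/-- Elements were identified by means of `heqT`, so internal predicative equality is actual equality
of elements. -/
theorem ev_eqT_ne_zero (u v : Term A B) (a : El M A) :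
    ev (eqT B u v) a ≠ 0 ↔ ev u a = ev v a := by
  obtain ⟨x, rfl⟩ := exists_elt a
  rw [ev_elt, ev_elt, ev_elt, elt_ne_zero, elt_eq_elt, mk_eqT, comp_heqT]

@[simp] theorem ev_and_eq_zero (u v : Term A nat) (a : El M A) :
    ev (and u v) a = 0 ↔ ¬ (ev u a ≠ 0 ∧ ev v a ≠ 0) := by
  rw [← ev_and_ne_zero, Ne, not_not]
@[simp] theorem ev_or_eq_zero (u v : Term A nat) (a : El M A) :
    ev (or u v) a = 0 ↔ ¬ (ev u a ≠ 0 ∨ ev v a ≠ 0) := by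
  rw [← ev_or_ne_zero, Ne, not_not]
@[simp] theorem ev_eqT_eq_zero (u v : Term A B) (a : El M A) :
    ev (eqT B u v) a = 0 ↔ ¬ (ev u a = ev v a) := by
  rw [← ev_eqT_ne_zero, Ne, not_not]

end Model

open Model

/-- Equality of map terms is equality in all models. -/
theorem eqv_of_ev {A B : PR} {u v : Term A B} (h : ∀ (M : Model) (a : El M A), ev u a = ev v a) :
    Eqv u v := by
  by_contra hne
  -- Otherwise the doubly negated equality predicate would be true, hence the equality predicate
  -- itself, and equality definability would give `Eqv u v`.
  have : ¬ HImpl (heqT B (cls u) (cls v) ≫ hneg) (hZ A) := by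
    intro k
    apply hne
    have k1 : HImpl (hZ A ≫ hS) (heqT B (cls u) (cls v) ≫ hneg ≫ hneg) := by
      rw [← Category.assoc, HImpl, himp_neg]
      simpa [himp, HImpl] using k
    have := (HImp_heqT_iff B _ _ _ (cls u)).1 (k1.trans (HImpl_neg_neg _))
    simp only [cond_S] at this
    exact PR.mk_eq.1 this
  obtain ⟨F, hF, hp, hm⟩ := IsFilt.exists_maximal this
  -- The model is built over the domain `A`, so that the identity of `A` serves as generic element.
  let M : Model := ⟨A, F, hF, hF.mem_or_neg_mem hm⟩
  have := h M (elt (𝟙 A))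
  rw [ev_elt, ev_elt, Category.id_comp, Category.id_comp, elt_eq_elt] at this
  exact hF.zero_notMem (hF.up (hF.and_mem this hp) (HImpl_absurd _))

theorem eqv_iff_ev {A B : PR} {u v : Term A B} :
    Eqv u v ↔ ∀ (M : Model) (a : El M A), ev u a = ev v a :=
  ⟨fun h _ a => ev_congr h a, eqv_of_ev⟩

/-- The term `imp c d` is two-valued, so its being equal to true amounts to its being nonzero. -/
theorem implies_iff_ev {A : PR} {c d : Term A nat} :
    Implies c d ↔ ∀ (M : Model) (a : El M A), ev c a ≠ 0 → ev d a ≠ 0 := by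
  rw [Implies, eqv_iff_ev]
  refine forall₂_congr fun M a => ?_
  rw [← ev_imp_ne_zero, ev_trueT]
  refine ⟨fun h => by rw [h]; exact one_ne_zero, fun h => ?_⟩
  have : IsPred (imp c d) := eqv_of_ev fun M a => by
    rw [imp, ev_comp, ev_sign, ev_comp, ev_neg]
    split <;> simp_all
  exact (ev_isPred this a).resolve_left h

/-! ### Induction inside a model -/

namespace Model

variable {M : Model} {A B C D : PR}

/-- The maps `sign ∘ₜ e` and true solve the same primitive recursion, with step `x ↦ x ∨ e (a, s
n)`, so uniqueness identifies them. The hypotheses range over all models because they have to yield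
derivable equations; `induct` removes this restriction. -/
theorem ev_ne_zero_of_step (e : Term (prod A nat) nat)
    (h0 : ∀ (M : Model) (a : El M A), ev e (mkp a 0) ≠ 0)
    (hs : ∀ (M : Model) (a : El M A) (n : El M nat), ev e (mkp a n) ≠ 0 → ev e (mkp a (S n)) ≠ 0)
    (a : El M A) (n : El M nat) : ev e (mkp a n) ≠ 0 := by
  have key : cls (sign ∘ₜ e) = cls (trueT (prod A nat)) := by
    refine prec_uniq (cls (or (snd _ _)
      (e ∘ₜ pair (fst A nat) (succ ∘ₜ snd A nat) ∘ₜ fst _ _))) ?_ ?_ ?_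
    · refine (PR.mk_eq (f := (sign ∘ₜ e) ∘ₜ pair (ident A) (zeroT A))
        (g := trueT _ ∘ₜ pair (ident A) (zeroT A)) |>.2 (eqv_of_ev fun M a => ?_))
      simp [h0]
    · refine (PR.mk_eq (f := (sign ∘ₜ e) ∘ₜ pair (fst A nat) (succ ∘ₜ snd A nat))
        (g := or (snd _ _) (e ∘ₜ pair (fst A nat) (succ ∘ₜ snd A nat) ∘ₜ fst _ _) ∘ₜ
          pair (ident _) (sign ∘ₜ e)) |>.2 (eqv_of_ev fun M z => ?_))
      obtain ⟨a, n, rfl⟩ := exists_mkp z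
      have := hs M a n
      by_cases h : ev e (mkp a n) = 0 <;> by_cases k : ev e (mkp a (S n)) = 0 <;>
        simp_all [or, ev_neg]
    · refine (PR.mk_eq (f := trueT _ ∘ₜ pair (fst A nat) (succ ∘ₜ snd A nat))
        (g := or (snd _ _) (e ∘ₜ pair (fst A nat) (succ ∘ₜ snd A nat) ∘ₜ fst _ _) ∘ₜ
          pair (ident _) (trueT _)) |>.2 (eqv_of_ev fun M z => ?_))
      simp [or, ev_neg]
  have := ev_eq_of_cls key (mkp a n)
  simp at this
  exact this

/-- Functions on the numbers of a model which are definable with parameters. -/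
def DF (f : El M nat → El M B) : Prop :=
  ∃ (A : PR) (a : El M A) (t : Term (prod A nat) B), ∀ n, f n = ev t (mkp a n)

theorem DF.const (b : El M B) : DF fun _ => b := ⟨B, b, fst _ _, by simp⟩
theorem DF.id : DF fun n : El M nat => n := ⟨one, default, snd _ _, by simp⟩
theorem DF.map {f : El M nat → El M B} (hf : DF f) (k : Term B C) : DF fun n => ev k (f n) := by
  obtain ⟨A, a, t, h⟩ := hf
  exact ⟨A, a, k ∘ₜ t, by simp [h]⟩
theorem DF.succ {f : El M nat → El M nat} (hf : DF f) : DF fun n => S (f n) := hf.map Term.succ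
theorem DF.pair {f : El M nat → El M B} {g : El M nat → El M C} (hf : DF f) (hg : DF g) :
    DF fun n => mkp (f n) (g n) := by
  obtain ⟨A, a, t, h⟩ := hf
  obtain ⟨A', a', t', h'⟩ := hg
  exact ⟨_, mkp a a', Term.pair (t ∘ₜ Term.pair (fst _ _ ∘ₜ fst _ _) (snd _ _))
    (t' ∘ₜ Term.pair (snd _ _ ∘ₜ fst _ _) (snd _ _)), by simp [h, h']⟩

/-- Predicates on the numbers of a model which are definable with parameters. -/
def DP (p : El M nat → Prop) : Prop := ∃ f : El M nat → El M nat, DF f ∧ ∀ n, p n ↔ f n ≠ 0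

theorem DF.ne_zero {f : El M nat → El M nat} (hf : DF f) : DP fun n => f n ≠ 0 :=
  ⟨f, hf, fun _ => Iff.rfl⟩
theorem DF.eq {f g : El M nat → El M B} (hf : DF f) (hg : DF g) : DP fun n => f n = g n :=
  ⟨_, (hf.pair hg).map (eqT B (fst _ _) (snd _ _)), fun n => by rw [ev_eqT_ne_zero]; simp⟩
theorem DP.not {p : El M nat → Prop} (hp : DP p) : DP fun n => ¬ p n := by
  obtain ⟨f, hf, h⟩ := hp
  exact ⟨_, hf.map neg, fun n => by simp [h]⟩
theorem DP.imp {p q : El M nat → Prop} (hp : DP p) (hq : DP q) : DP fun n => p n → q n := by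
  obtain ⟨f, hf, h⟩ := hp
  obtain ⟨g, hg, k⟩ := hq
  exact ⟨_, (hf.pair hg).map (PR.imp (fst _ _) (snd _ _)), fun n => by
    rw [ev_imp_ne_zero]; simp [h, k]⟩
theorem DP.disj {p q : El M nat → Prop} (hp : DP p) (hq : DP q) : DP fun n => p n ∨ q n := by
  simpa only [or_iff_not_imp_left] using hp.not.imp hq

/-- Induction on definable predicates. -/
theorem induct {p : El M nat → Prop} (hp : DP p) (h0 : p 0) (hs : ∀ n, p n → p (S n)) :
    ∀ n, p n := by
  obtain ⟨f, ⟨A, a, e, hf⟩, h⟩ := hp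
  intro n
  -- The counter `k` starts at zero, advances while `e` holds at its current value and then stays
  -- put. Its recursion equations hold in all models, whereas `hs` is known only in `M`.
  obtain ⟨k, k0, ks⟩ : ∃ k : Term (prod A nat) nat,
      (∀ (M : Model) (a : El M A), ev k (mkp a 0) = 0) ∧
      ∀ (M : Model) (a : El M A) (n : El M nat),
        (ev e (mkp a (ev k (mkp a n))) ≠ 0 ∧ ev k (mkp a (S n)) = S (ev k (mkp a n))) ∨
        (ev e (mkp a (ev k (mkp a n))) = 0 ∧ ev k (mkp a (S n)) = ev k (mkp a n)) := by
    refine ⟨prec (zeroT A) (cond (e ∘ₜ pair (fst _ _ ∘ₜ fst _ _) (snd _ _)) (succ ∘ₜ snd _ _)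
      (snd _ _)), by simp, fun M a n => ?_⟩
    rw [ev_prec_S]
    generalize ev (prec _ _) (mkp a n) = x
    by_cases hx : ev e (mkp a x) = 0 <;> simp [hx]
  -- Either the counter has never stopped, or it rests at a failure of `e`.
  have k1 := ev_ne_zero_of_step (M := M)
    (or (eqT nat k (snd _ _)) (neg ∘ₜ e ∘ₜ pair (fst _ _) k)) (by simp [k0])
    (fun M a n => by
      simp only [ev_or_ne_zero, ev_eqT_ne_zero, ev_comp, ev_neg_ne_zero, ev_pair, ev_fst_mkp,
        ev_snd_mkp]
      rcases ks M a n with ⟨h1, h2⟩ | ⟨h1, h2⟩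
      · simp [h1, h2]; tauto
      · simp [h1, h2]) a n
  -- The predecessor of a positive count is a value at which `e` holds.
  have k2 := ev_ne_zero_of_step (M := M)
    (or (neg ∘ₜ k) (e ∘ₜ pair (fst _ _) (pred ∘ₜ k))) (by simp [k0])
    (fun M a n => by
      simp only [ev_or_ne_zero, ev_comp, ev_neg_ne_zero, ev_pair, ev_fst_mkp]
      rcases ks M a n with ⟨h1, h2⟩ | ⟨h1, h2⟩
      · simp [h1, h2]
      · simp [h2]) a n
  simp only [ev_or_ne_zero, ev_eqT_ne_zero, ev_comp, ev_neg_ne_zero, ev_pair, ev_fst_mkp,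
        ev_snd_mkp] at k1 k2
  -- The only use of `hs`: `p` holds at the predecessor of a positive count, hence at the count.
  -- This excludes that the counter rests at a failure, so it has reached `n`.
  have key : p (ev k (mkp a n)) := by
    rcases zero_or_S (ev k (mkp a n)) with h1 | ⟨m, h1⟩
    · rwa [h1]
    · rw [h1] at k2 ⊢
      refine hs _ ((h _).2 ?_)
      simpa [hf] using k2
  rcases k1 with h1 | h1
  · rwa [h1] at key
  · rw [h, hf] at key
    exact absurd h1 key

end Model

end PR

namespace PR

open Term

namespace Model

variable {M : Model} {A B C D : PR}

/-! ### Arithmetic in a model -/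

@[simp] theorem ev_bang (a : El M A) : ev (bang A) a = default := Unique.eq_default _

instance : Add (El M nat) := ⟨fun x y => ev (iter succ) (mkp x y)⟩
instance : Sub (El M nat) := ⟨fun x y => ev (iter pred) (mkp x y)⟩

@[simp] theorem ev_add (u v : Term A nat) (a : El M A) : ev (add u v) a = ev u a + ev v a := by
  simp [add]; rfl
@[simp] theorem ev_sub (u v : Term A nat) (a : El M A) : ev (sub u v) a = ev u a - ev v a := by
  simp [sub]; rfl

theorem DF.add {f g : El M nat → El M nat} (hf : DF f) (hg : DF g) : DF fun n => f n + g n :=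
  (hf.pair hg).map (iter Term.succ)
theorem DF.sub {f g : El M nat → El M nat} (hf : DF f) (hg : DF g) : DF fun n => f n - g n :=
  (hf.pair hg).map (iter pred)

@[simp] theorem add_Z (x : El M nat) : x + 0 = x := ev_iter_zero _ _
@[simp] theorem add_S (x y : El M nat) : x + S y = S (x + y) := ev_iter_S _ _ _
@[simp] theorem sub_Z (x : El M nat) : x - 0 = x := ev_iter_zero _ _
@[simp] theorem sub_S (x y : El M nat) : x - S y = ev pred (x - y) := ev_iter_S _ _ _

@[simp] theorem Z_add (x : El M nat) : 0 + x = x :=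
  induct (((DF.const 0).add .id).eq .id) (by simp) (by simp) x
@[simp] theorem S_add (x y : El M nat) : S x + y = S (x + y) :=
  induct (((DF.const (S x)).add .id).eq ((DF.const x).add .id).succ) (by simp) (by simp) y
theorem add_comm' (x y : El M nat) : x + y = y + x :=
  induct (((DF.const x).add .id).eq (DF.id.add (.const x))) (by simp) (by simp) y
theorem add_assoc' (x y z : El M nat) : x + y + z = x + (y + z) :=
  induct (((DF.const (x + y)).add .id).eq ((DF.const x).add ((DF.const y).add .id)))
    (by simp) (by simp) z

instance : AddCommMonoid (El M nat) where
  add_assoc := add_assoc'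
  zero_add := Z_add
  add_zero := add_Z
  add_comm := add_comm'
  nsmul := nsmulRec

@[simp] theorem S_sub_S (x y : El M nat) : S x - S y = x - y :=
  induct (((DF.const (S x)).sub DF.id.succ).eq ((DF.const x).sub .id)) (by simp)
    (fun n h => by rw [sub_S, h, ← sub_S]) y
@[simp] theorem add_sub_self (x y : El M nat) : x + y - x = y :=
  induct ((((DF.id).add (.const y)).sub .id).eq (.const y)) (by simp)
    (fun n h => by rw [S_add, S_sub_S, h]) x

/-- The strict order of the numbers of a model. -/
def Lt (k n : El M nat) : Prop := ∃ d, n = S (k + d)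

/-! ### Cantor's pairing -/

/-- Cantor's pairing. -/
def J (x y : El M nat) : El M nat := ev tri (x + y) + y

@[simp] theorem ev_tri_zero : ev tri (0 : El M nat) = 0 := by simp [tri]
@[simp] theorem ev_tri_S (n : El M nat) : ev tri (S n) = S (ev tri n + n) := by simp [tri]

@[simp] theorem ev_cpair (u v : Term A nat) (a : El M A) :
    ev (cpair u v) a = J (ev u a) (ev v a) := by simp [cpair, J]

@[simp] theorem ev_count_zero : ev count (0 : El M nat) = mkp 0 0 := by simp [count]
theorem ev_count_S_zero {n y : El M nat} (h : ev count n = mkp 0 y) :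
    ev count (S n) = mkp (S y) 0 := by
  simp only [count, ev_comp, ev_pair, ev_ident, ev_zeroT, ev_iter_S] at h ⊢
  rw [h]; simp
theorem ev_count_S_S {n x y : El M nat} (h : ev count n = mkp (S x) y) :
    ev count (S n) = mkp x (S y) := by
  simp only [count, ev_comp, ev_pair, ev_ident, ev_zeroT, ev_iter_S] at h ⊢
  rw [h]; simp

/-- Each step along an antidiagonal moves a unit from the first coordinate to the second. The
premise `s - y + y = s` expresses `y ≤ s` by an equation, which keeps the implication definable and
thus open to `induct`. -/
theorem ev_count_add {s : El M nat} (hs : ev count (ev tri s) = mkp s 0) (y : El M nat) :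
    s - y + y = s → ev count (ev tri s + y) = mkp (s - y) y := by
  refine induct (DP.imp ((((DF.const s).sub .id).add .id).eq (.const s))
    ((((DF.const _).add .id).map count).eq (((DF.const s).sub .id).pair .id))) ?_ ?_ y
  · simpa using hs
  · intro y ih h
    -- If the first coordinate were already exhausted, the premise for `S y` would give `s = S y`,
    -- and then `s - y` would be one.
    rcases zero_or_S (s - y) with h0 | ⟨m, hm⟩
    · have hs' : s = S y := by simpa [h0] using h.symm
      have h1 := add_sub_self y 1
      rw [one_def, add_S, add_Z, ← hs', h0] at h1
      exact absurd h1 (by simp)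
    · rw [sub_S, hm] at h ⊢
      rw [hm] at ih
      simp only [ev_pred_S, add_S] at h ⊢
      exact ev_count_S_S (ih (by simpa using h))

/-- Induction over the antidiagonals: `s` steps lead from `(s, 0)` to `(0, s)`, and one more opens
the next antidiagonal. -/
theorem ev_count_tri (s : El M nat) : ev count (ev tri s) = mkp s 0 := by
  refine induct (((DF.id.map tri).map count).eq (DF.id.pair (.const 0))) (by simp)
    (fun s hs => ?_) s
  have h : s - s = 0 := by simpa using add_sub_self s 0
  have := ev_count_add hs s (by rw [h, Z_add])
  rw [h] at this
  rw [ev_tri_S]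
  exact ev_count_S_zero this

@[simp] theorem ev_count_J (x y : El M nat) : ev count (J x y) = mkp x y := by
  have h : x + y - y = x := by rw [add_comm, add_sub_self]
  have := ev_count_add (ev_count_tri (x + y)) y (by rw [h])
  rwa [h] at this

@[simp] theorem J_inj {x y x' y' : El M nat} : J x y = J x' y' ↔ x = x' ∧ y = y' := by
  refine ⟨fun h => ?_, by rintro ⟨rfl, rfl⟩; rfl⟩
  simpa using congrArg (ev count) h

theorem Lt_S_J_right (x y : El M nat) : Lt y (S (J x y)) := ⟨ev tri (x + y), by rw [J, add_comm]⟩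

/-- The point is that triangular numbers satisfy `n ≤ tri n`. Strictness comes from the successor
that every code carries. -/
theorem Lt_S_J_left (x y : El M nat) : Lt x (S (J x y)) := by
  obtain ⟨d, hd⟩ : ∃ d, ev tri (x + y) = x + y + d := by
    rcases zero_or_S (x + y) with h | ⟨n, h⟩
    · exact ⟨0, by simp [h]⟩
    · exact ⟨ev tri n, by rw [h, ev_tri_S, S_add, add_comm]⟩
  exact ⟨y + d + y, by rw [J, hd]; simp only [add_assoc]⟩

/-! ### Course-of-values recursion -/

/-- The equations of `iter` peel off the outermost application, while the entries of a list are
removed from the inside; this lemma mediates. -/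
theorem ev_iter_comm (f : Term A A) (a : El M A) (n : El M nat) :
    ev (iter f) (mkp (ev f a) n) = ev f (ev (iter f) (mkp a n)) :=
  induct ((((DF.const _).pair .id).map _).eq ((((DF.const a).pair .id).map (iter f)).map f))
    (by simp) (fun n h => by simp [h]) n

/-- The list of the values below a given number. -/
def covList (h : Term (prod nat nat) nat) : Term nat nat :=
  prec (zeroT one) (cpair (h ∘ₜ pair (snd one nat ∘ₜ fst _ _) (snd _ _)) (snd _ _)) ∘ₜ
    pair (bang nat) (ident nat)

theorem ev_covList_S (h : Term (prod nat nat) nat) (n : El M nat) :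
    ev (covList h) (S n) = J (ev h (mkp n (ev (covList h) n))) (ev (covList h) n) := by
  simp [covList]

theorem ev_cov (h : Term (prod nat nat) nat) (n : El M nat) :
    ev (cov h) n = ev h (mkp n (ev (covList h) n)) := by
  have : ev (cov h) n = ev (fst nat nat) (ev count (ev (covList h) (S n))) := by
    simp [cov, covList]
  rw [this, ev_covList_S, ev_count_J, ev_fst_mkp]

/-- Write `n = S (k + d)`. Removing `n - S k = d` heads from the list of values below `n` leaves the
list of values below `S k`, and the head of that list is the value at `k`. -/
theorem ev_look (h : Term (prod nat nat) nat) (k n t : Term A nat) (a : El M A)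
    (hk : Lt (ev k a) (ev n a)) (ht : ev t a = ev (covList h) (ev n a)) :
    ev (look k n t) a = ev (cov h) (ev k a) := by
  obtain ⟨d, hd⟩ := hk
  have key : ∀ k d : El M nat, ev (iter (snd nat nat ∘ₜ count))
      (mkp (ev (covList h) (S k + d)) d) = ev (covList h) (S k) := by
    intro k
    refine induct (((((DF.const (S k)).add .id).map _).pair .id).map _ |>.eq (.const _))
      (by simp) fun d hd => ?_
    rw [ev_iter_S, ← ev_iter_comm, add_S, ev_covList_S]
    simpa using hd
  have := key (ev k a) d
  simp only [look, ev_comp, ev_pair, ev_sub, ev_succ, ht, hd]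
  rw [← S_add, add_sub_self, key, ev_covList_S, ev_count_J, ev_fst_mkp, ev_cov]

/-! ### Codes -/

/-- The standard numbers of a model. -/
def nm : ℕ → El M nat
  | 0 => 0
  | n + 1 => S (nm n)

@[simp] theorem ev_num (n : ℕ) (a : El M A) : ev (num A n) a = nm n := by
  induction n with
  | zero => simp [num, nm]
  | succ n ih => simp [num, nm, ih]

@[simp] theorem nm_inj {m n : ℕ} : (nm m : El M nat) = nm n ↔ m = n := by
  refine ⟨fun h => ?_, by rintro rfl; rfl⟩
  induction m generalizing n with
  | zero => cases n <;> simp [nm] at h ⊢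
  | succ m ih =>
    cases n with
    | zero => simp [nm] at h
    | succ n => rw [ih (S_inj.1 h)]

@[simp] theorem ev_code (t : ℕ) (u : Term A nat) (a : El M A) :
    ev (code t u) a = S (J (nm t) (ev u a)) := by simp [code]

@[simp] theorem ev_codeZero (a : El M A) : ev (codeZero A) a = S (J (nm 0) (nm 0)) := by
  simp [codeZero]
@[simp] theorem ev_codeSucc (a : El M A) : ev (codeSucc A) a = S (J (nm 0) (nm 1)) := by
  simp [codeSucc]
@[simp] theorem ev_codeComp (u v : Term A nat) (a : El M A) :
    ev (codeComp u v) a = S (J (nm 1) (J (ev u a) (ev v a))) := by simp [codeComp]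

/-- The undefined value. -/
def bot : El M nat := S (J (nm 0) (nm 2))

@[simp] theorem ev_bott (a : El M A) : ev (bott A) a = bot := by simp [bott, bot]

/-- The code of a pair. -/
def cpd (x y : El M nat) : El M nat := S (J (nm 2) (J x y))

@[simp] theorem ev_codePair (u v : Term A nat) (a : El M A) :
    ev (codePair u v) a = cpd (ev u a) (ev v a) := by simp [codePair, cpd]

@[simp] theorem cpd_inj {x y x' y' : El M nat} : cpd x y = cpd x' y' ↔ x = x' ∧ y = y' := by
  simp [cpd]

@[simp] theorem ev_arg1_cpd (u : Term A nat) (a : El M A) {x y : El M nat}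
    (h : ev u a = cpd x y) : ev (arg1 u) a = x := by simp [arg1, h, cpd]
@[simp] theorem ev_arg2_cpd (u : Term A nat) (a : El M A) {x y : El M nat}
    (h : ev u a = cpd x y) : ev (arg2 u) a = y := by simp [arg2, h, cpd]

theorem ev_isPair_ne_zero (u : Term A nat) (a : El M A) :
    ev (isPair u) a ≠ 0 ↔ ∃ x y, ev u a = cpd x y := by
  rw [isPair, ev_eqT_ne_zero, ev_codePair]
  refine ⟨fun h => ⟨_, _, h⟩, ?_⟩
  rintro ⟨x, y, h⟩
  rw [ev_arg1_cpd u a h, ev_arg2_cpd u a h, h]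

/-- Since `look` is correct only below the current argument, this descent to components is what
makes the recursion defining `inX` work. -/
theorem Lt_cpd_left (x y : El M nat) : Lt x (cpd x y) := by
  obtain ⟨d, hd⟩ := Lt_S_J_left x y
  obtain ⟨e, he⟩ := Lt_S_J_right (nm 2) (J x y)
  have : J x y = x + d := by simpa using hd
  exact ⟨d + e, by rw [cpd, he, this, add_assoc]⟩
theorem Lt_cpd_right (x y : El M nat) : Lt y (cpd x y) := by
  obtain ⟨d, hd⟩ := Lt_S_J_right x y
  obtain ⟨e, he⟩ := Lt_S_J_right (nm 2) (J x y)
  have : J x y = y + d := by simpa using hd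
  exact ⟨d + e, by rw [cpd, he, this, add_assoc]⟩

/-! ### Internal numerals -/

/-- Internal numerals. -/
def nuE (n : El M nat) : El M nat := ev nu n

/-- The code of the composition of the successor with an expression. -/
def sc (x : El M nat) : El M nat := S (J (nm 1) (J (S (J (nm 0) (nm 1))) x))

@[simp] theorem ev_nu (n : El M nat) : ev nu n = nuE n := rfl

theorem nuE_zero : (nuE 0 : El M nat) = S (J (nm 0) (nm 0)) := by
  simp [nuE, nu]
theorem nuE_S (n : El M nat) : nuE (S n) = sc (nuE n) := by
  simp [nuE, nu, sc]

theorem Lt_sc (x : El M nat) : Lt x (sc x) := by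
  obtain ⟨d, hd⟩ := Lt_S_J_right (S (J (nm 0) (nm 1))) x
  obtain ⟨e, he⟩ := Lt_S_J_right (nm 1) (J (S (J (nm 0) (nm 1))) x)
  have : J (S (J (nm 0) (nm 1))) x = x + d := by simpa using hd
  exact ⟨d + e, by rw [sc, he, this, add_assoc]⟩

theorem ev_arg2_sc (u : Term A nat) (a : El M A) {x : El M nat} (h : ev u a = sc x) :
    ev (arg2 u) a = x := by simp [arg2, h, sc]

/-- The test rebuilds a code from the second constituent and so succeeds on `sc x`; as `x` is below
`sc x`, the lookup returns the value at `x`. -/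
theorem nuInv_sc (x : El M nat) : ev nuInv (sc x) = S (ev nuInv x) := by
  rw [nuInv, ev_cov, ev_cond, if_pos]
  · rw [ev_comp, ev_succ, ev_look _ _ _ _ _ _ (by rw [ev_snd_mkp, ev_fst_mkp]),
      ev_arg2_sc (x := x) _ _ (by simp)]
    rw [ev_arg2_sc (x := x) _ _ (by simp)]
    simpa using Lt_sc x
  · rw [ev_eqT_ne_zero, ev_codeComp, ev_codeSucc, ev_arg2_sc (x := x) _ _ (by simp)]
    simp [sc]

/-- The default value zero of the recursion is also the correct one at the code of the symbol `0`,
which starts the induction in `nuInv_nuE`. -/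
theorem nuInv_of_ne_sc {z : El M nat} (h : ∀ x, z ≠ sc x) : ev nuInv z = 0 := by
  rw [nuInv, ev_cov, ev_cond, if_neg]
  · simp
  · rw [ev_eqT_ne_zero]
    simpa [sc] using h _

@[simp] theorem nuInv_nuE (n : El M nat) : ev nuInv (nuE n) = n := by
  refine induct (((DF.id.map nu).map nuInv).eq .id) (nuInv_of_ne_sc fun x => ?_)
    (fun n h => ?_) n
  · rw [ev_nu, nuE_zero]; simp [sc]
  · rw [ev_nu, nuE_S, nuInv_sc]; exact congrArg S h

theorem nuE_injective : Function.Injective (nuE : El M nat → El M nat) :=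
  Function.LeftInverse.injective nuInv_nuE
@[simp] theorem nuE_inj {m n : El M nat} : nuE m = nuE n ↔ m = n := nuE_injective.eq_iff

/-- Decoding followed by encoding fixes exactly the numerals, so the arbitrary values of `nuInv`
elsewhere do no harm. -/
theorem ev_isNum_ne_zero (u : Term A nat) (a : El M A) :
    ev (isNum u) a ≠ 0 ↔ ∃ n, ev u a = nuE n := by
  rw [isNum, ev_eqT_ne_zero, ev_comp, ev_comp, ev_nu]
  refine ⟨fun h => ⟨_, h.symm⟩, ?_⟩
  rintro ⟨n, h⟩
  rw [h, nuInv_nuE]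

@[simp] theorem nuE_ne_cpd (n x y : El M nat) : nuE n ≠ cpd x y := by
  rcases zero_or_S n with rfl | ⟨n, rfl⟩
  · simp [nuE_zero, cpd]
  · simp [nuE_S, cpd, sc]
@[simp] theorem cpd_ne_nuE (n x y : El M nat) : cpd x y ≠ nuE n := (nuE_ne_cpd n x y).symm
@[simp] theorem bot_ne_nuE (n : El M nat) : bot ≠ nuE n := by
  rcases zero_or_S n with rfl | ⟨n, rfl⟩
  · simp [nuE_zero, bot]
  · simp [nuE_S, bot, sc]
@[simp] theorem nuE_ne_bot (n : El M nat) : nuE n ≠ bot := (bot_ne_nuE n).symm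
@[simp] theorem bot_ne_cpd (x y : El M nat) : bot ≠ cpd x y := by simp [bot, cpd]
@[simp] theorem cpd_ne_bot (x y : El M nat) : cpd x y ≠ bot := (bot_ne_cpd x y).symm

/-! ### The universal object -/

/-- Membership in the universal object. -/
def X (z : El M nat) : Prop := ev inX z ≠ 0

theorem ev_inX_ne_zero (z : El M nat) : ev inX z ≠ 0 ↔ X z := Iff.rfl

@[simp] theorem X_nuE (n : El M nat) : X (nuE n) := by
  rw [X, inX, ev_cov, ev_or_ne_zero, ev_isNum_ne_zero]
  exact .inl ⟨n, by simp⟩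

@[simp] theorem X_cpd (x y : El M nat) : X (cpd x y) ↔ X x ∧ X y := by
  rw [X, inX, ev_cov, ev_or_ne_zero, ev_isNum_ne_zero, ev_and_ne_zero, ev_and_ne_zero,
    ev_isPair_ne_zero, ev_look _ (arg1 _) _ _ _ ?_ (by rw [ev_snd_mkp, ev_fst_mkp]),
    ev_look _ (arg2 _) _ _ _ ?_ (by rw [ev_snd_mkp, ev_fst_mkp]),
    ev_arg1_cpd (x := x) (y := y) _ _ (by simp), ev_arg2_cpd (x := x) (y := y) _ _ (by simp),
    ev_fst_mkp]
  · simp [X, inX]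
  · rw [ev_arg2_cpd (x := x) (y := y) _ _ (by simp), ev_fst_mkp]; exact Lt_cpd_right x y
  · rw [ev_arg1_cpd (x := x) (y := y) _ _ (by simp), ev_fst_mkp]; exact Lt_cpd_left x y

theorem X.cases {z : El M nat} (h : X z) : (∃ n, z = nuE n) ∨ ∃ x y, z = cpd x y ∧ X x ∧ X y := by
  have h' := h
  rw [X, inX, ev_cov, ev_or_ne_zero, ev_isNum_ne_zero, ev_and_ne_zero, ev_isPair_ne_zero,
    ev_fst_mkp] at h'
  rcases h' with h' | ⟨⟨x, y, rfl⟩, -⟩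
  · exact .inl h'
  · exact .inr ⟨x, y, rfl, (X_cpd x y).1 h⟩

@[simp] theorem not_X_bot : ¬ X (bot : El M nat) := by
  intro h
  rcases h.cases with ⟨n, h⟩ | ⟨x, y, h, -⟩
  · exact bot_ne_nuE n h
  · exact bot_ne_cpd x y h

theorem ev_inXbot_ne_zero (z : El M nat) : ev inXbot z ≠ 0 ↔ X z ∨ z = bot := by
  rw [inXbot, ev_or_ne_zero, ev_eqT_ne_zero, ev_ident, ev_bott]; rfl

theorem ev_isXPair_ne_zero (z : El M nat) :
    ev isXPair z ≠ 0 ↔ ∃ x y, z = cpd x y ∧ X x ∧ X y := by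
  rw [isXPair, ev_and_ne_zero, ev_isPair_ne_zero, ev_ident]
  constructor
  · rintro ⟨h, x, y, rfl⟩
    exact ⟨x, y, rfl, (X_cpd x y).1 h⟩
  · rintro ⟨x, y, rfl, h⟩
    exact ⟨(X_cpd x y).2 h, x, y, rfl⟩

end Model

end PR

namespace PR

open Term

namespace Model

variable {M : Model} {A B C D : PR}

/-! ### The operations of the universe monoid -/

theorem ev_cond_of_iff {c : Term A nat} {a : El M A} {p : Prop} [Decidable p] (h : ev c a ≠ 0 ↔ p)
    (u v : Term A B) : ev (cond c u v) a = if p then ev u a else ev v a := by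
  by_cases hp : p
  · rw [ev_cond, if_pos (h.2 hp), if_pos hp]
  · rw [ev_cond, if_neg fun k => hp (h.1 k), if_neg hp]

open Classical in
theorem ev_xId (z : El M nat) : ev xId z = if X z then z else bot := by
  rw [xId, ev_cond_of_iff (ev_inX_ne_zero z), ev_ident, ev_bott]
open Classical in
theorem ev_xBang (z : El M nat) : ev xBang z = if X z then nuE 0 else bot := by
  rw [xBang, ev_cond_of_iff (ev_inX_ne_zero z)]; simp
open Classical in
theorem ev_xZero (z : El M nat) : ev xZero z = if z = nuE 0 then nuE 0 else bot := by
  rw [xZero, ev_cond_of_iff (ev_eqT_ne_zero _ _ z)]; simp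
open Classical in
theorem ev_xPair (f g : Term nat nat) (z : El M nat) : ev (xPair f g) z =
    if X z ∧ X (ev f z) ∧ X (ev g z) then cpd (ev f z) (ev g z) else bot := by
  have : ev (and inX (and (inX ∘ₜ f) (inX ∘ₜ g))) z ≠ 0 ↔ X z ∧ X (ev f z) ∧ X (ev g z) := by
    rw [ev_and_ne_zero, ev_and_ne_zero, ev_comp, ev_comp]; rfl
  rw [xPair, ev_cond_of_iff this, ev_codePair, ev_bott]

theorem ev_xId_of {z : El M nat} (h : X z) : ev xId z = z := by rw [ev_xId, if_pos h]
theorem ev_xBang_of {z : El M nat} (h : X z) : ev xBang z = nuE 0 := by rw [ev_xBang, if_pos h]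
@[simp] theorem ev_xZero_nuE : ev xZero (nuE 0 : El M nat) = nuE 0 := by rw [ev_xZero, if_pos rfl]
theorem ev_xPair_of {f g : Term nat nat} {z : El M nat} (h : X z) (hf : X (ev f z))
    (hg : X (ev g z)) : ev (xPair f g) z = cpd (ev f z) (ev g z) := by
  rw [ev_xPair, if_pos ⟨h, hf, hg⟩]

@[simp] theorem ev_xSucc_nuE (n : El M nat) : ev xSucc (nuE n) = nuE (S n) := by
  rw [xSucc, ev_cond, if_pos ((ev_isNum_ne_zero _ _).2 ⟨n, by simp⟩)]; simp
theorem ev_xSucc_of_ne {z : El M nat} (h : ∀ n, z ≠ nuE n) : ev xSucc z = bot := by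
  rw [xSucc, ev_cond, if_neg (by rw [ev_isNum_ne_zero]; simpa using h), ev_bott]

theorem ev_xFst_cpd {x y : El M nat} (hx : X x) (hy : X y) : ev xFst (cpd x y) = x := by
  rw [xFst, ev_cond, if_pos ((ev_isXPair_ne_zero _).2 ⟨x, y, rfl, hx, hy⟩),
    ev_arg1_cpd _ _ (ev_ident _)]
theorem ev_xSnd_cpd {x y : El M nat} (hx : X x) (hy : X y) : ev xSnd (cpd x y) = y := by
  rw [xSnd, ev_cond, if_pos ((ev_isXPair_ne_zero _).2 ⟨x, y, rfl, hx, hy⟩),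
    ev_arg2_cpd _ _ (ev_ident _)]
theorem ev_xFst_of_ne {z : El M nat} (h : ¬ ∃ x y, z = cpd x y ∧ X x ∧ X y) :
    ev xFst z = bot := by
  rw [xFst, ev_cond, if_neg (by rwa [ev_isXPair_ne_zero]), ev_bott]
theorem ev_xSnd_of_ne {z : El M nat} (h : ¬ ∃ x y, z = cpd x y ∧ X x ∧ X y) :
    ev xSnd z = bot := by
  rw [xSnd, ev_cond, if_neg (by rwa [ev_isXPair_ne_zero]), ev_bott]

open Classical in
theorem ev_xProd_cpd (f g : Term nat nat) (x y : El M nat) : ev (xProd f g) (cpd x y) =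
    if X x ∧ X y ∧ X (ev f x) ∧ X (ev g y) then cpd (ev f x) (ev g y) else bot := by
  have : ev (and isXPair (and (inX ∘ₜ f ∘ₜ arg1 (ident nat)) (inX ∘ₜ g ∘ₜ arg2 (ident nat))))
      (cpd x y) ≠ 0 ↔ X x ∧ X y ∧ X (ev f x) ∧ X (ev g y) := by
    rw [ev_and_ne_zero, ev_isXPair_ne_zero, ev_and_ne_zero, ev_comp, ev_comp,
      ev_comp, ev_comp, ev_arg1_cpd _ _ (ev_ident _), ev_arg2_cpd _ _ (ev_ident _), ← and_assoc (a := X x)]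
    refine and_congr ⟨?_, fun h => ⟨x, y, rfl, h⟩⟩ Iff.rfl
    rintro ⟨x', y', h, h'⟩
    obtain ⟨rfl, rfl⟩ := cpd_inj.1 h
    exact h'
  rw [xProd, ev_cond_of_iff this, ev_codePair, ev_comp, ev_comp, ev_arg1_cpd _ _ (ev_ident _),
    ev_arg2_cpd _ _ (ev_ident _), ev_bott]
theorem ev_xProd_of_ne {f g : Term nat nat} {z : El M nat} (h : ∀ x y, z ≠ cpd x y) :
    ev (xProd f g) z = bot := by
  rw [xProd, ev_cond, if_neg, ev_bott]
  rw [ev_and_ne_zero, ev_isXPair_ne_zero]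
  rintro ⟨⟨x, y, h', -⟩, -⟩
  exact h x y h'

/-- The exponent may be any number of the model, standard or not; statements about its values are
therefore proved by `induct`. -/
theorem ev_xIter_cpd (f : Term nat nat) {x : El M nat} (hx : X x) (n : El M nat) :
    ev (xIter f) (cpd x (nuE n)) = ev (iter f) (mkp x n) := by
  rw [xIter, ev_cond, if_pos, ev_comp, ev_pair, ev_comp, ev_arg1_cpd _ _ (ev_ident _),
    ev_arg2_cpd _ _ (ev_ident _), nuInv_nuE]
  rw [ev_and_ne_zero, ev_isXPair_ne_zero, ev_isNum_ne_zero, ev_arg2_cpd _ _ (ev_ident _)]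
  exact ⟨⟨x, _, rfl, hx, X_nuE n⟩, n, rfl⟩
theorem ev_xIter_of_ne {f : Term nat nat} {z : El M nat}
    (h : ¬ ∃ x n, z = cpd x (nuE n) ∧ X x) : ev (xIter f) z = bot := by
  rw [xIter, ev_cond, if_neg, ev_bott]
  rw [ev_and_ne_zero, ev_isXPair_ne_zero, ev_isNum_ne_zero]
  rintro ⟨⟨x, y, rfl, hx, hy⟩, n, hn⟩
  rw [ev_arg2_cpd _ _ (ev_ident _)] at hn
  exact h ⟨x, n, by rw [hn], hx⟩

/-- Elements of the universe monoid are undefined outside `X`. -/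
theorem ev_eq_bot {u : Term nat nat} (hu : IsPRX u) :
    ∀ {M : Model} {z : El M nat}, ¬ X z → ev u z = bot := by
  induction hu with
  | id => intro M z h; rw [ev_xId, if_neg h]
  | zero => intro M z h; rw [ev_xZero, if_neg]; rintro rfl; exact h (X_nuE 0)
  | succ => intro M z h; exact ev_xSucc_of_ne (by rintro n rfl; exact h (X_nuE n))
  | bang => intro M z h; rw [ev_xBang, if_neg h]
  | fst =>
    intro M z h; exact ev_xFst_of_ne (by rintro ⟨x, y, rfl, h'⟩; exact h ((X_cpd x y).2 h'))
  | snd =>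
    intro M z h; exact ev_xSnd_of_ne (by rintro ⟨x, y, rfl, h'⟩; exact h ((X_cpd x y).2 h'))
  -- The inner value is already `⊥`, which itself lies outside `X`, so the hypothesis on the outer
  -- element applies to it.
  | comp _ _ hf hg => intro M z h; rw [ev_comp, hf h, hg not_X_bot]
  | pair _ _ _ _ => intro M z h; rw [ev_xPair, if_neg (fun k => h k.1)]
  | prod _ _ _ _ =>
    intro M z h
    by_cases hz : ∃ x y, z = cpd x y
    · obtain ⟨x, y, rfl⟩ := hz
      rw [ev_xProd_cpd, if_neg]
      exact fun k => h ((X_cpd x y).2 ⟨k.1, k.2.1⟩)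
    · exact ev_xProd_of_ne fun x y e => hz ⟨x, y, e⟩
  | iter _ _ =>
    intro M z h
    refine ev_xIter_of_ne ?_
    rintro ⟨x, n, rfl, hx⟩
    exact h ((X_cpd _ _).2 ⟨hx, X_nuE n⟩)
  | of_eqv e _ hf => intro M z h; rw [← ev_congr e, hf h]

theorem DF.X {f : El M nat → El M nat} (hf : DF f) : DP fun n => X (f n) := (hf.map inX).ne_zero

/-- Elements of the universe monoid take values in `X ∪ {⊥}`. -/
theorem X_or_eq_bot {u : Term nat nat} (hu : IsPRX u) :
    ∀ {M : Model} (z : El M nat), X (ev u z) ∨ ev u z = bot := by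
  induction hu with
  | id => intro M z; rw [ev_xId]; split <;> simp [*]
  | zero => intro M z; rw [ev_xZero]; split <;> simp
  | succ =>
    intro M z
    by_cases hz : ∃ n, z = nuE n
    · obtain ⟨n, rfl⟩ := hz; simp
    · exact .inr (ev_xSucc_of_ne fun n e => hz ⟨n, e⟩)
  | bang => intro M z; rw [ev_xBang]; split <;> simp
  | fst =>
    intro M z
    by_cases hz : ∃ x y, z = cpd x y ∧ X x ∧ X y
    · obtain ⟨x, y, rfl, hx, hy⟩ := hz; rw [ev_xFst_cpd hx hy]; exact .inl hx
    · exact .inr (ev_xFst_of_ne hz)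
  | snd =>
    intro M z
    by_cases hz : ∃ x y, z = cpd x y ∧ X x ∧ X y
    · obtain ⟨x, y, rfl, hx, hy⟩ := hz; rw [ev_xSnd_cpd hx hy]; exact .inl hy
    · exact .inr (ev_xSnd_of_ne hz)
  | comp _ _ _ hg => intro M z; rw [ev_comp]; exact hg _
  | pair _ _ _ _ => intro M z; rw [ev_xPair]; split <;> simp_all
  | prod _ _ _ _ =>
    intro M z
    by_cases hz : ∃ x y, z = cpd x y
    · obtain ⟨x, y, rfl⟩ := hz
      rw [ev_xProd_cpd]; split <;> simp_all
    · exact .inr (ev_xProd_of_ne fun x y e => hz ⟨x, y, e⟩)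
  | @iter f _ hf =>
    intro M z
    by_cases hz : ∃ x n, z = cpd x (nuE n) ∧ X x
    · obtain ⟨x, n, rfl, hx⟩ := hz
      rw [ev_xIter_cpd f hx]
      have hd : DF fun n => ev (Term.iter f) (mkp x n) := ((DF.const x).pair .id).map _
      -- The zeroth iterate is `x ∈ X`; every later one is a value of `f`, so the step needs no
      -- induction hypothesis.
      exact induct (hd.X.disj (hd.eq (.const bot))) (by simpa using .inl hx)
        (fun n _ => by rw [ev_iter_S]; exact hf _) n
    · exact .inr (ev_xIter_of_ne hz)
  | of_eqv e _ hf => intro M z; rw [← ev_congr e]; exact hf z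

/-! ### Numeralisation -/

@[simp] theorem ev_nuMap_nat (n : El M nat) : ev (nuMap nat) n = nuE n := rfl
@[simp] theorem ev_nuMap_one (a : El M one) : ev (nuMap one) a = nuE 0 := by simp [nuMap]
@[simp] theorem ev_nuMap_mkp (a : El M A) (b : El M B) :
    ev (nuMap (prod A B)) (mkp a b) = cpd (ev (nuMap A) a) (ev (nuMap B) b) := by simp [nuMap]

@[simp] theorem nuMapInv_nuMap (a : El M A) : ev (nuMapInv A) (ev (nuMap A) a) = a := by
  induction A with
  | one => exact Subsingleton.elim _ _
  | nat => exact nuInv_nuE a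
  | prod A B hA hB =>
    obtain ⟨a, b, rfl⟩ := exists_mkp a
    rw [ev_nuMap_mkp, nuMapInv, ev_pair, ev_comp, ev_comp, ev_arg1_cpd _ _ (ev_ident _),
      ev_arg2_cpd _ _ (ev_ident _), hA, hB]

theorem nuMap_injective : Function.Injective (ev (M := M) (nuMap A)) :=
  Function.LeftInverse.injective nuMapInv_nuMap
@[simp] theorem nuMap_inj {a b : El M A} : ev (nuMap A) a = ev (nuMap A) b ↔ a = b :=
  nuMap_injective.eq_iff

@[simp] theorem X_nuMap (a : El M A) : X (ev (nuMap A) a) := by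
  induction A with
  | one => simp
  | nat => simp
  | prod A B hA hB =>
    obtain ⟨a, b, rfl⟩ := exists_mkp a
    simp [hA, hB]

theorem ev_imPred_ne_zero (z : El M nat) : ev (imPred A) z ≠ 0 ↔ ∃ a, z = ev (nuMap A) a := by
  rw [imPred, ev_eqT_ne_zero, ev_comp, ev_ident]
  refine ⟨fun h => ⟨_, h.symm⟩, ?_⟩
  rintro ⟨a, rfl⟩
  rw [nuMapInv_nuMap]

@[simp] theorem ev_twin_nuMap (f : Term A B) (a : El M A) :
    ev (twin f) (ev (nuMap A) a) = ev (nuMap B) (ev f a) := by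
  rw [twin, ev_cond, if_pos ((ev_imPred_ne_zero _).2 ⟨a, rfl⟩)]; simp
theorem ev_twin_of_ne {f : Term A B} {z : El M nat} (h : ¬ ∃ a, z = ev (nuMap A) a) :
    ev (twin f) z = bot := by
  rw [twin, ev_cond, if_neg (by rwa [ev_imPred_ne_zero]), ev_bott]

@[simp] theorem ev_twin_bot (f : Term A B) : ev (twin f) (bot : El M nat) = bot :=
  ev_twin_of_ne (by rintro ⟨a, h⟩; exact not_X_bot (h ▸ X_nuMap a))

/-- Numeralised values lie in `X` while `⊥` does not, so domains of definition can be read off from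
membership in `X`. -/
theorem X_ev_twin {f : Term A B} {z : El M nat} :
    X (ev (twin f) z) ↔ ∃ a, z = ev (nuMap A) a := by
  constructor
  · intro h
    by_contra hz
    rw [ev_twin_of_ne hz] at h
    exact not_X_bot h
  · rintro ⟨a, rfl⟩
    simp

end Model

open Model

/-! ### The laws of numeral twins -/

/-- The two hypotheses prescribe the value at every number of every model, so completeness applies.
Each law of twins below reduces to these two evaluations. -/
theorem twin_eqv {A : PR} {B : PR} {f : Term A B} {u : Term nat nat}
    (h : ∀ (M : Model) (a : El M A), ev u (ev (nuMap A) a) = ev (nuMap B) (ev f a))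
    (h' : ∀ (M : Model) (z : El M nat), (¬ ∃ a, z = ev (nuMap A) a) → ev u z = bot) :
    Eqv (twin f) u := by
  refine eqv_of_ev fun M z => ?_
  by_cases hz : ∃ a, z = ev (nuMap A) a
  · obtain ⟨a, rfl⟩ := hz
    rw [ev_twin_nuMap, h]
  · rw [ev_twin_of_ne hz, h' M z hz]

theorem twin_eqv_iff {A B : PR} (f g : Term A B) : Eqv (twin f) (twin g) ↔ Eqv f g := by
  simp only [eqv_iff_ev]
  refine forall_congr' fun M => ⟨fun h a => ?_, fun h z => ?_⟩
  · simpa using h (ev (nuMap A) a)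
  · by_cases hz : ∃ a, z = ev (nuMap A) a
    · obtain ⟨a, rfl⟩ := hz
      rw [ev_twin_nuMap, ev_twin_nuMap, h]
    · rw [ev_twin_of_ne hz, ev_twin_of_ne hz]

theorem twin_comp {A B C : PR} (f : Term A B) (g : Term B C) :
    Eqv (twin (g ∘ₜ f)) (twin g ∘ₜ twin f) :=
  twin_eqv (by simp) fun M z hz => by rw [ev_comp, ev_twin_of_ne hz, ev_twin_bot]

theorem twin_bang (A : PR) : Eqv (twin (bang A)) (xBang ∘ₜ twin (ident A)) :=
  twin_eqv (fun M a => by simp [ev_xBang_of])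
    fun M z hz => by rw [ev_comp, ev_twin_of_ne hz, ev_eq_bot .bang not_X_bot]

theorem twin_fst (A B : PR) : Eqv (twin (fst A B)) (xFst ∘ₜ twin (ident (prod A B))) :=
  twin_eqv (fun M z => by
      rw [ev_comp, ev_twin_nuMap]
      obtain ⟨a, b, rfl⟩ := exists_mkp z
      simp [ev_xFst_cpd])
    fun M z hz => by rw [ev_comp, ev_twin_of_ne hz, ev_eq_bot .fst not_X_bot]

theorem twin_snd (A B : PR) : Eqv (twin (snd A B)) (xSnd ∘ₜ twin (ident (prod A B))) :=
  twin_eqv (fun M z => by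
      rw [ev_comp, ev_twin_nuMap]
      obtain ⟨a, b, rfl⟩ := exists_mkp z
      simp [ev_xSnd_cpd])
    fun M z hz => by rw [ev_comp, ev_twin_of_ne hz, ev_eq_bot .snd not_X_bot]

/-- No restriction to the domain is needed, in contrast to the projections: pairing is undefined as
soon as a component is, and twins are undefined off the image. -/
theorem twin_pair {D A B : PR} (f : Term D A) (g : Term D B) :
    Eqv (twin (pair f g)) (xPair (twin f) (twin g)) :=
  twin_eqv (fun M a => by rw [ev_xPair_of] <;> simp)
    fun M z hz => by rw [ev_xPair, if_neg]; rw [X_ev_twin]; exact fun h => hz h.2.1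

theorem twin_prod {A A' B B' : PR} (f : Term A A') (g : Term B B') :
    Eqv (twin (pair (f ∘ₜ fst A B) (g ∘ₜ snd A B))) (xProd (twin f) (twin g)) := by
  refine twin_eqv (fun M z => ?_) fun M z hz => ?_
  · obtain ⟨a, b, rfl⟩ := exists_mkp z
    rw [ev_nuMap_mkp, ev_xProd_cpd, if_pos] <;> simp
  · by_cases h : ∃ x y, z = cpd x y
    · obtain ⟨x, y, rfl⟩ := h
      rw [ev_xProd_cpd, if_neg]
      rw [X_ev_twin, X_ev_twin]
      rintro ⟨-, -, ⟨a, rfl⟩, b, rfl⟩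
      exact hz ⟨mkp a b, by simp⟩
    · exact ev_xProd_of_ne fun x y e => h ⟨x, y, e⟩

theorem twin_zero : Eqv (twin zero) xZero :=
  twin_eqv (fun M a => by simp) fun M z hz => by
    rw [ev_xZero, if_neg]; exact fun h => hz ⟨default, by simpa using h⟩

theorem twin_succ : Eqv (twin succ) xSucc :=
  twin_eqv (fun M a => by simp) fun M z hz => ev_xSucc_of_ne fun n h => hz ⟨n, h⟩

/-- The restricting factor is needed since `xIter` returns any `x ∈ X` at `⟨x; ν0⟩`, whether or not
`x` comes from `A`. On the image, the iterates agree by induction on their number. -/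
theorem twin_iter {A : PR} (f : Term A A) :
    Eqv (twin (iter f)) (xIter (twin f) ∘ₜ twin (ident (prod A nat))) := by
  refine twin_eqv (fun M z => ?_) fun M z hz => by
    rw [ev_comp, ev_twin_of_ne hz, ev_xIter_of_ne]
    rintro ⟨x, n, h, -⟩; exact bot_ne_cpd _ _ h
  obtain ⟨a, n, rfl⟩ := exists_mkp z
  rw [ev_comp, ev_twin_nuMap, ev_ident, ev_nuMap_mkp, ev_nuMap_nat, ev_xIter_cpd _ (by simp)]
  exact induct ((((DF.const _).pair .id).map _).eq ((((DF.const a).pair .id).map (iter f)).map _))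
    (by simp) (fun n h => by simp [h]) n

/-- The universe monoid can recognise the image of each numeralisation. For numerals, `x ↦ ⟨ν0; x⟩`
followed by iteration of the successor returns `x` when `x` is a numeral and is undefined otherwise.
For products the componentwise map works, being undefined when a component is. -/
theorem isPRX_twin_ident (A : PR) : IsPRX (twin (ident A)) := by
  induction A with
  | one =>
    refine .of_eqv (.symm (twin_eqv (u := xZero) (fun M a => by simp) fun M z hz => ?_)) .zero
    rw [ev_xZero, if_neg]; exact fun h => hz ⟨default, by simpa using h⟩
  | nat =>
    refine .of_eqv (.symm (twin_eqv (u := xIter xSucc ∘ₜ xPair (xZero ∘ₜ xBang) xId)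
      (fun M n => ?_) fun M z hz => ?_)) ((IsPRX.pair (.comp .bang .zero) .id).comp (.iter .succ))
    · rw [ev_comp, ev_nuMap_nat, ev_xPair_of (by simp) (by simp [ev_xBang_of])
        (by simp [ev_xId_of]), ev_comp, ev_xBang_of (by simp), ev_xZero_nuE, ev_xId_of (by simp),
        ev_xIter_cpd _ (by simp), ev_ident, ev_nuMap_nat]
      exact induct ((((DF.const _).pair .id).map (iter xSucc)).eq (DF.id.map nu))
        (by simp) (fun n h => by rw [ev_iter_S, h]; simp) n
    · rw [ev_comp, ev_xIter_of_ne]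
      rintro ⟨x, n, h, -⟩
      rw [ev_xPair] at h
      split at h
      · rename_i hX
        rw [ev_xId_of hX.1] at h
        exact hz ⟨n, (cpd_inj.1 h).2⟩
      · exact bot_ne_cpd _ _ h
  | prod A B hA hB =>
    refine .of_eqv (.symm (twin_eqv (u := xProd (twin (ident A)) (twin (ident B)))
      (fun M z => ?_) fun M z hz => ?_)) (hA.prod hB)
    · rw [ev_congr (twin_prod (ident A) (ident B)).symm, ev_twin_nuMap]
      obtain ⟨a, b, rfl⟩ := exists_mkp z
      simp
    · rw [ev_congr (twin_prod (ident A) (ident B)).symm, ev_twin_of_ne hz]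

/-- Structural induction on the term: the laws of twins express each twin by monoid operations and
restrictions of the identity. -/
theorem isPRX_twin {A B : PR} (f : Term A B) : IsPRX (twin f) := by
  induction f with
  | ident A => exact isPRX_twin_ident A
  | comp g f hg hf => exact .of_eqv (twin_comp f g).symm (hf.comp hg)
  | bang A => exact .of_eqv (twin_bang A).symm ((isPRX_twin_ident A).comp .bang)
  | fst A B => exact .of_eqv (twin_fst A B).symm ((isPRX_twin_ident _).comp .fst)
  | snd A B => exact .of_eqv (twin_snd A B).symm ((isPRX_twin_ident _).comp .snd)
  | pair f g hf hg => exact .of_eqv (twin_pair f g).symm (hf.pair hg)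
  | zero => exact .of_eqv twin_zero.symm .zero
  | succ => exact .of_eqv twin_succ.symm .succ
  | iter f hf => exact .of_eqv (twin_iter f).symm ((isPRX_twin_ident _).comp hf.iter)

/-- An element of the universe monoid which is the identity on `c` and undefined elsewhere. -/
structure IsRestriction (t c : Term nat nat) : Prop where
  isPRX : IsPRX t
  ev_of : ∀ {M : Model} {z : El M nat}, X z → ev c z ≠ 0 → ev t z = z
  ev_of_not : ∀ {M : Model} {z : El M nat}, ¬ (X z ∧ ev c z ≠ 0) → ev t z = bot

/-- Truth is turned into definedness: the negation of `c` is zero where `c` holds, and `xZero` is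
defined only at `ν0`. Pairing the identity with this partial test and projecting back leaves the
identity where the test succeeds. -/
theorem exists_isRestriction_image {A : PR} (c : Term A nat) :
    ∃ t, IsRestriction t (and (imPred A) (c ∘ₜ nuMapInv A)) := by
  let t : Term nat nat := xFst ∘ₜ xPair xId (xZero ∘ₜ twin (neg ∘ₜ c))
  have key {M : Model} (z : El M nat) : (∃ a, z = ev (nuMap A) a ∧ ev c a ≠ 0) →
      ev (xZero ∘ₜ twin (neg ∘ₜ c)) z = nuE 0 := by
    rintro ⟨a, rfl, ha⟩
    rw [ev_comp, ev_twin_nuMap, ev_comp, (ev_neg_eq_zero _).2 ha]; simp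
  have key' {M : Model} (z : El M nat) : (¬ ∃ a, z = ev (nuMap A) a ∧ ev c a ≠ 0) →
      ev (xZero ∘ₜ twin (neg ∘ₜ c)) z = bot := by
    intro h
    by_cases hz : ∃ a, z = ev (nuMap A) a
    · obtain ⟨a, rfl⟩ := hz
      rw [ev_comp, ev_twin_nuMap, ev_comp, ev_xZero, if_neg]
      intro k
      exact h ⟨a, rfl, (ev_neg_eq_zero _).1 (nuE_inj.1 k)⟩
    · rw [ev_comp, ev_twin_of_ne hz, ev_eq_bot .zero not_X_bot]
  have hc {M : Model} (z : El M nat) : ev (and (imPred A) (c ∘ₜ nuMapInv A)) z ≠ 0 ↔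
      ∃ a, z = ev (nuMap A) a ∧ ev c a ≠ 0 := by
    rw [ev_and_ne_zero, ev_imPred_ne_zero, ev_comp]
    constructor
    · rintro ⟨⟨a, rfl⟩, h⟩
      exact ⟨a, rfl, by simpa using h⟩
    · rintro ⟨a, rfl, h⟩
      exact ⟨⟨a, rfl⟩, by simpa using h⟩
  refine ⟨t, (IsPRX.pair .id ((isPRX_twin _).comp .zero)).comp .fst, fun h k => ?_, fun h => ?_⟩
  · rw [hc] at k
    have e := key _ k
    rw [ev_comp, ev_xPair_of h (by rwa [ev_xId_of h]) (by rw [e]; simp), e, ev_xId_of h,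
      ev_xFst_cpd h (by simp)]
  · rw [hc] at h
    rw [ev_comp, ev_xPair, if_neg, ev_eq_bot .fst not_X_bot]
    rintro ⟨h1, -, h2⟩
    rw [key' _ fun k => h ⟨h1, k⟩] at h2
    exact not_X_bot h2

end PR

/-! ### Restrictions of the identity to the objects of `PRX` -/

namespace PRX

open PR PR.Model Term

theorem ev_pred_one {M : Model} (z : El M PR.nat) : ev (pred one) z ≠ 0 ↔ z = nuE 0 := by
  rw [pred, ev_eqT_ne_zero]; simp

theorem ev_pred_nat {M : Model} (z : El M PR.nat) : ev (pred nat) z ≠ 0 ↔ ∃ n, z = nuE n := by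
  rw [pred, ev_isNum_ne_zero]; simp

end PRX

namespace PR

open Term Model

/-- The predicate on `X` of pairs with given predicates on the components. -/
def pairPred (c d : Term nat nat) : Term nat nat :=
  and (isPair (ident nat)) (and (c ∘ₜ arg1 (ident nat)) (d ∘ₜ arg2 (ident nat)))

theorem ev_pairPred_cpd {M : Model} (c d : Term nat nat) (x y : El M nat) :
    ev (pairPred c d) (cpd x y) ≠ 0 ↔ ev c x ≠ 0 ∧ ev d y ≠ 0 := by
  rw [pairPred, ev_and_ne_zero, ev_and_ne_zero, ev_isPair_ne_zero, ev_comp, ev_comp,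
    ev_arg1_cpd _ _ (ev_ident _), ev_arg2_cpd _ _ (ev_ident _)]
  simp

theorem ev_pairPred_ne_zero {M : Model} (c d : Term nat nat) (z : El M nat) :
    ev (pairPred c d) z ≠ 0 ↔ ∃ x y, z = cpd x y ∧ ev c x ≠ 0 ∧ ev d y ≠ 0 := by
  constructor
  · intro h
    have h' := h
    rw [pairPred, ev_and_ne_zero, ev_isPair_ne_zero] at h'
    obtain ⟨⟨x, y, hz⟩, -⟩ := h'
    rw [ev_ident] at hz
    subst hz
    exact ⟨x, y, rfl, (ev_pairPred_cpd c d x y).1 h⟩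
  · rintro ⟨x, y, rfl, h⟩
    exact (ev_pairPred_cpd c d x y).2 h

end PR

namespace PRX

open PR PR.Model Term

/-- The generators `xId` and `xZero` and the twin of the identity of `nat` serve the basic objects.
For products, `xProd` of two restrictions is defined only where both are. -/
theorem exists_isRestriction (P : PRX) : ∃ t, IsRestriction t P.pred := by
  induction P with
  | univ =>
    refine ⟨xId, .id, fun h _ => ev_xId_of h, fun {M z} h => ev_eq_bot .id fun k => h ⟨k, ?_⟩⟩
    rw [pred, ev_trueT]; exact one_ne_zero
  | one =>
    refine ⟨xZero, .zero, fun _ h => ?_, fun {M z} h => ?_⟩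
    · rw [ev_pred_one] at h
      rw [h, ev_xZero_nuE]
    · rw [ev_xZero, if_neg]
      rintro rfl
      exact h ⟨X_nuE 0, (ev_pred_one _).2 rfl⟩
  | nat =>
    refine ⟨twin (ident PR.nat), isPRX_twin _, fun _ h => ?_, fun {M z} h => ?_⟩
    · rw [ev_pred_nat] at h
      obtain ⟨n, rfl⟩ := h
      exact (ev_twin_nuMap (ident PR.nat) n).trans (by simp)
    · refine ev_twin_of_ne ?_
      rintro ⟨n, rfl⟩
      exact h ⟨X_nuE n, (ev_pred_nat _).2 ⟨n, rfl⟩⟩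
  | prod P Q hP hQ =>
    obtain ⟨s, hs⟩ := hP
    obtain ⟨t, ht⟩ := hQ
    refine ⟨xProd s t, hs.isPRX.prod ht.isPRX, fun {M z} h k => ?_, fun {M z} h => ?_⟩
    · obtain ⟨x, y, rfl, hx, hy⟩ := (ev_pairPred_ne_zero _ _ _).1 k
      have hX := (X_cpd x y).1 h
      rw [ev_xProd_cpd, hs.ev_of hX.1 hx, ht.ev_of hX.2 hy, if_pos ⟨hX.1, hX.2, hX⟩]
    · by_cases hz : ∃ x y, z = cpd x y
      · obtain ⟨x, y, rfl⟩ := hz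
        rw [ev_xProd_cpd, if_neg]
        rintro ⟨h1, h2, h3, h4⟩
        refine h ⟨(X_cpd x y).2 ⟨h1, h2⟩, (ev_pairPred_cpd _ _ _ _).2 ⟨?_, ?_⟩⟩
        · intro h5
          rw [hs.ev_of_not fun k => k.2 h5] at h3
          exact not_X_bot h3
        · intro h5
          rw [ht.ev_of_not fun k => k.2 h5] at h4
          exact not_X_bot h4
      · exact ev_xProd_of_ne fun x y e => hz ⟨x, y, e⟩

theorem ev_pred_ofPR {A : PR} {M : Model} (z : El M PR.nat) :
    ev (ofPR A).pred z ≠ 0 ↔ ∃ a, z = ev (nuMap A) a := by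
  induction A generalizing z with
  | one =>
    refine (ev_pred_one z).trans ⟨fun h => ⟨default, by simpa using h⟩, ?_⟩
    rintro ⟨a, rfl⟩
    simp
  | nat => exact ev_pred_nat z
  | prod A B hA hB =>
    refine (ev_pairPred_ne_zero _ _ z).trans ?_
    simp only [hA, hB]
    constructor
    · rintro ⟨x, y, rfl, ⟨a, rfl⟩, b, rfl⟩
      exact ⟨mkp a b, by simp⟩
    · rintro ⟨c, rfl⟩
      obtain ⟨a, b, rfl⟩ := exists_mkp c
      exact ⟨_, _, ev_nuMap_mkp a b, ⟨a, rfl⟩, b, rfl⟩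

end PRX

namespace PRa

open PR PR.Model Term

variable {P Q R : PRa}

/-! ### Maps of `PRa` in models -/

/-- Membership in an object, in a model. -/
def Mem (P : PRa) {M : Model} (a : El M P.carrier) : Prop := ev P.pred a ≠ 0

theorem Rep.mem {f : Term P.carrier Q.carrier} {h : P ⟶ Q} (hf : Rep f h) {M : Model}
    {a : El M P.carrier} (ha : P.Mem a) : Q.Mem (ev f a) := by
  have := implies_iff_ev.1 hf.1 M a ha
  rwa [ev_comp] at this

/-- Equality of maps in `PRa` is a derivable implication with an equality predicate as conclusion,
and completeness makes this agreement on members. All equations in `PRa` are checked in this form.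
-/
theorem Rep.eq_iff {f g : Term P.carrier Q.carrier} {h k : P ⟶ Q} (hf : Rep f h) (hg : Rep g k) :
    h = k ↔ ∀ (M : Model) (a : El M P.carrier), P.Mem a → ev f a = ev g a := by
  obtain ⟨hf, rfl⟩ := hf
  obtain ⟨hg, rfl⟩ := hg
  simp only [← ev_eqT_ne_zero]
  exact (Quotient.eq (r := rawSetoid P Q)).trans implies_iff_ev

theorem exists_rep (h : P ⟶ Q) : ∃ f, Rep f h := by
  obtain ⟨⟨f, hf⟩, rfl⟩ := Quotient.exists_rep h
  exact ⟨f, hf, rfl⟩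

theorem rep_id (P : PRa) : Rep (ident P.carrier) (𝟙 P) := ⟨_, rfl⟩

/-- A term which represents a given map. -/
noncomputable def el (h : P ⟶ Q) : Term P.carrier Q.carrier := (exists_rep h).choose

theorem rep_el (h : P ⟶ Q) : Rep (el h) h := (exists_rep h).choose_spec

/-- The map given by a term. -/
def homMk (f : Term P.carrier Q.carrier)
    (hf : ∀ (M : Model) (a : El M P.carrier), P.Mem a → Q.Mem (ev f a)) : P ⟶ Q :=
  Quotient.mk _ ⟨f, implies_iff_ev.2 fun M a ha => by rw [ev_comp]; exact hf M a ha⟩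

theorem rep_homMk (f : Term P.carrier Q.carrier)
    (hf : ∀ (M : Model) (a : El M P.carrier), P.Mem a → Q.Mem (ev f a)) :
    Rep f (homMk f hf) := ⟨_, rfl⟩

/-- Operations on maps are defined below from chosen representatives; this lemma shows that any
other representatives serve as well. -/
theorem Rep.congr {f g : Term P.carrier Q.carrier} {h : P ⟶ Q} (hf : Rep f h)
    (hg : ∀ (M : Model) (a : El M P.carrier), P.Mem a → ev g a = ev f a) : Rep g h := by
  have hm (M : Model) (a : El M P.carrier) (ha : P.Mem a) : Q.Mem (ev g a) := by
    rw [hg M a ha]; exact hf.mem ha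
  have := ((rep_homMk g hm).eq_iff hf).2 hg
  rw [← this]
  exact rep_homMk g hm

/-! ### The cartesian p.r. structure of `PRa` -/

/-- The terminal object. -/
@[reducible] def oneObj : PRa := ⟨PR.one, trueT _, isPred_true _⟩
/-- The natural numbers object. -/
@[reducible] def natObj : PRa := ⟨PR.nat, trueT _, isPred_true _⟩
/-- The product of two objects. -/
@[reducible] def prodObj (P Q : PRa) : PRa :=
  ⟨prod P.carrier Q.carrier, and (P.pred ∘ₜ fst _ _) (Q.pred ∘ₜ snd _ _), isPred_and _ _⟩

theorem mem_oneObj {M : Model} (a : El M PR.one) : oneObj.Mem a := by simp [Mem, oneObj]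
theorem mem_natObj {M : Model} (a : El M PR.nat) : natObj.Mem a := by simp [Mem, natObj]
@[simp] theorem mem_prodObj {M : Model} (a : El M P.carrier) (b : El M Q.carrier) :
    (prodObj P Q).Mem (mkp a b) ↔ P.Mem a ∧ Q.Mem b := by
  refine (ev_and_ne_zero _ _ _).trans ?_
  rw [ev_comp, ev_comp, ev_fst_mkp, ev_snd_mkp]
  rfl

/-- Membership of the iterate is a definable predicate of the number of steps, so `induct` applies.
-/
theorem mem_iter {f : Term P.carrier P.carrier}
    (hf : ∀ (M : Model) (a : El M P.carrier), P.Mem a → P.Mem (ev f a)) {M : Model}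
    {a : El M P.carrier} (ha : P.Mem a) (n : El M PR.nat) : P.Mem (ev (iter f) (mkp a n)) :=
  induct (p := fun n => P.Mem (ev (iter f) (mkp a n)))
    ((((DF.const a).pair .id).map (iter f)).map P.pred).ne_zero (by simpa using ha)
    (fun n h => by rw [ev_iter_S]; exact hf _ _ h) n

/-- The pairing of maps. -/
noncomputable def liftHom (f : R ⟶ P) (g : R ⟶ Q) : R ⟶ prodObj P Q :=
  homMk (pair (el f) (el g)) fun M a ha => by
    rw [ev_pair]; exact (mem_prodObj _ _).2 ⟨(rep_el f).mem ha, (rep_el g).mem ha⟩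

theorem rep_liftHom {f : R ⟶ P} {g : R ⟶ Q} {u : Term R.carrier P.carrier}
    {v : Term R.carrier Q.carrier} (hu : Rep u f) (hv : Rep v g) :
    Rep (pair u v) (liftHom f g) :=
  (rep_homMk _ _).congr fun M a ha => by
    rw [ev_pair, ev_pair, (hu.eq_iff (rep_el f)).1 rfl M a ha, (hv.eq_iff (rep_el g)).1 rfl M a ha]

/-- The terminal map. -/
def bangHom (P : PRa) : P ⟶ oneObj := homMk (bang _) fun _ _ _ => mem_oneObj _
/-- The first projection. -/
def fstHom (P Q : PRa) : prodObj P Q ⟶ P := homMk (fst _ _) fun M a ha => by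
  obtain ⟨a, b, rfl⟩ := exists_mkp a
  rw [ev_fst_mkp]; exact ((mem_prodObj a b).1 ha).1
/-- The second projection. -/
def sndHom (P Q : PRa) : prodObj P Q ⟶ Q := homMk (snd _ _) fun M a ha => by
  obtain ⟨a, b, rfl⟩ := exists_mkp a
  rw [ev_snd_mkp]; exact ((mem_prodObj a b).1 ha).2
/-- The iteration of an endomap. -/
noncomputable def iterHom (f : P ⟶ P) : prodObj P natObj ⟶ P :=
  homMk (iter (el f)) fun M a ha => by
    obtain ⟨a, n, rfl⟩ := exists_mkp a
    exact mem_iter (fun _ _ => (rep_el f).mem) ((mem_prodObj a n).1 ha).1 n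
/-- Zero. -/
def zeroHom : oneObj ⟶ natObj := homMk zero fun _ _ _ => mem_natObj _
/-- The successor. -/
def succHom : natObj ⟶ natObj := homMk succ fun _ _ _ => mem_natObj _

theorem rep_bangHom (P : PRa) : Rep (bang _) (bangHom P) := rep_homMk _ _
theorem rep_fstHom (P Q : PRa) : Rep (fst _ _) (fstHom P Q) := rep_homMk _ _
theorem rep_sndHom (P Q : PRa) : Rep (snd _ _) (sndHom P Q) := rep_homMk _ _
theorem rep_zeroHom : Rep (P := oneObj) (Q := natObj) zero zeroHom := rep_homMk _ _
theorem rep_succHom : Rep (P := natObj) (Q := natObj) succ succHom := rep_homMk _ _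

theorem rep_iterHom {f : P ⟶ P} {u : Term P.carrier P.carrier} (hu : Rep u f) :
    Rep (iter u) (iterHom f) :=
  (rep_homMk _ _).congr fun M a ha => by
    obtain ⟨a, n, rfl⟩ := exists_mkp a
    have ha := ((mem_prodObj a n).1 ha).1
    refine induct ((((DF.const a).pair .id).map (iter u)).eq (((DF.const a).pair .id).map _))
      (by simp) (fun n h => ?_) n
    rw [ev_iter_S, ev_iter_S, h, (hu.eq_iff (rep_el f)).1 rfl]
    exact mem_iter (fun _ _ => (rep_el f).mem) ha n

/-- The cartesian p.r. structure of the theory with predicate abstraction. -/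
noncomputable def cartesianPR : CartesianPR PRa where
  one := oneObj
  bang := bangHom
  bang_uniq f := ((rep_el f).eq_iff (rep_bangHom _)).2 fun _ _ _ => Subsingleton.elim (α := El _ PR.one) _ _
  prod := prodObj
  fst := fstHom
  snd := sndHom
  lift := liftHom
  lift_fst f g := (((rep_liftHom (rep_el f) (rep_el g)).comp (rep_fstHom _ _)).eq_iff
    (rep_el f)).2 fun M a _ => by simp
  lift_snd f g := (((rep_liftHom (rep_el f) (rep_el g)).comp (rep_sndHom _ _)).eq_iff
    (rep_el g)).2 fun M a _ => by simp
  lift_uniq h := ((rep_liftHom ((rep_el h).comp (rep_fstHom _ _))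
    ((rep_el h).comp (rep_sndHom _ _))).eq_iff (rep_el h)).2 fun M a _ => by simp
  nat := natObj
  zero := zeroHom
  succ := succHom
  iter := iterHom
  iter_zero f := (((rep_liftHom (rep_id _) ((rep_bangHom _).comp rep_zeroHom)).comp
    (rep_iterHom (rep_el f))).eq_iff (rep_id _)).2 fun M a _ => by simp
  iter_succ f := (((rep_liftHom (rep_fstHom _ _) ((rep_sndHom _ _).comp rep_succHom)).comp
    (rep_iterHom (rep_el f))).eq_iff ((rep_iterHom (rep_el f)).comp (rep_el f))).2 fun M a _ => by
      obtain ⟨a, n, rfl⟩ := exists_mkp a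
      simp
  iter_uniq {P Q} f g h h0 hs := by
    rw [((rep_liftHom (rep_id _) ((rep_bangHom _).comp rep_zeroHom)).comp (rep_el h)).eq_iff
      (rep_el f)] at h0
    rw [((rep_liftHom (rep_fstHom _ _) ((rep_sndHom _ _).comp rep_succHom)).comp
      (rep_el h)).eq_iff ((rep_el h).comp (rep_el g))] at hs
    rw [(rep_el h).eq_iff ((rep_liftHom ((rep_fstHom _ _).comp (rep_el f)) (rep_sndHom _ _)).comp
      (rep_iterHom (rep_el g)))]
    intro M a ha
    obtain ⟨a, n, rfl⟩ := exists_mkp a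
    have ha := ((mem_prodObj a n).1 ha).1
    simp only [ev_comp, ev_pair, ev_fst_mkp, ev_snd_mkp]
    -- Uniqueness relative to a predicate: the induction keeps `a` fixed, so its membership is
    -- available at every stage.
    refine induct ((((DF.const a).pair .id).map (el h)).eq (((DF.const _).pair .id).map _))
      ?_ (fun n hn => ?_) n
    · simpa using h0 M a ha
    · rw [ev_iter_S, ← hn]
      simpa using hs M (mkp a n) ((mem_prodObj _ _).2 ⟨ha, mem_natObj n⟩)

/-- The equaliser of two maps. -/
@[reducible] noncomputable def eqObj (f g : P ⟶ Q) : PRa :=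
  ⟨P.carrier, and P.pred (eqT Q.carrier (el f) (el g)), isPred_and _ _⟩

theorem mem_eqObj {f g : P ⟶ Q} {M : Model} (a : El M P.carrier) :
    (eqObj f g).Mem a ↔ P.Mem a ∧ ev (el f) a = ev (el g) a :=
  (ev_and_ne_zero _ _ _).trans (and_congr Iff.rfl (ev_eqT_ne_zero _ _ _))

/-- The inclusion of the equaliser. -/
noncomputable def eqHom (f g : P ⟶ Q) : eqObj f g ⟶ P :=
  homMk (ident _) fun M a ha => by rw [ev_ident]; exact ((mem_eqObj (f := f) (g := g) a).1 ha).1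

theorem rep_eqHom (f g : P ⟶ Q) : Rep (P := eqObj f g) (Q := P) (ident P.carrier) (eqHom f g) :=
  rep_homMk _ _

theorem eqHom_condition (f g : P ⟶ Q) : eqHom f g ≫ f = eqHom f g ≫ g :=
  (((rep_eqHom f g).comp (rep_el f)).eq_iff ((rep_eqHom f g).comp (rep_el g))).2
    fun M a ha => by
      have := ((mem_eqObj (f := f) (g := g) a).1 ha).2
      simpa using this

theorem mem_eqObj_of_comp_eq {f g : P ⟶ Q} {k : R ⟶ P} (hk : k ≫ f = k ≫ g)
    {u : Term R.carrier P.carrier} (hu : Rep u k) {M : Model} {a : El M R.carrier}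
    (ha : R.Mem a) : (eqObj f g).Mem (ev u a) := by
  have := ((hu.comp (rep_el f)).eq_iff (hu.comp (rep_el g))).1 hk M a ha
  exact (mem_eqObj _).2 ⟨hu.mem ha, by simpa using this⟩

/-- The equaliser has the universal property. -/
noncomputable def isLimitEqHom (f g : P ⟶ Q) :
    IsLimit (Fork.ofι (eqHom f g) (eqHom_condition f g)) :=
  Fork.IsLimit.mk' _ fun s => by
    have hs : Rep (P := s.pt) (Q := P) (el (Q := P) s.ι) s.ι := rep_el (Q := P) s.ι
    have hm (M : Model) (a : El M s.pt.carrier) (ha : s.pt.Mem a) :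
        (eqObj f g).Mem (ev (el (Q := P) s.ι) a) := mem_eqObj_of_comp_eq s.condition hs ha
    refine ⟨homMk (P := s.pt) (Q := eqObj f g) (el (Q := P) s.ι) hm, ?_, fun {m} h => ?_⟩
    · exact (((rep_homMk _ hm).comp (rep_eqHom f g)).eq_iff hs).2 fun M a _ => by simp
    · refine ((rep_el (Q := eqObj f g) m).eq_iff (rep_homMk _ hm)).2 fun M a ha => ?_
      have := (((rep_el (Q := eqObj f g) m).comp (rep_eqHom f g)).eq_iff hs).1 h M a ha
      simpa using this

end PRa

namespace PRXa

open PR PR.Model Term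

variable {P Q R : PRXa}

/-! ### Maps of `PRXa` in models -/

/-- Membership in an object, in a model. -/
def Mem (P : PRXa) {M : Model} (z : El M PR.nat) : Prop := X z ∧ ev P.pred z ≠ 0

theorem mem_toObj (P : PRXa) {M : Model} (z : El M PR.nat) : P.toObj.Mem z ↔ P.Mem z :=
  ev_and_ne_zero _ _ _

theorem Rep.mem {u : Term PR.nat PR.nat} {h : P ⟶ Q} (hu : Rep u h) {M : Model}
    {z : El M PR.nat} (hz : P.Mem z) : Q.Mem (ev u z) :=
  (mem_toObj Q _).1 (PRa.Rep.mem hu ((mem_toObj P z).2 hz))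

theorem Rep.eq_iff {u v : Term PR.nat PR.nat} {h k : P ⟶ Q} (hu : Rep u h) (hv : Rep v k) :
    h = k ↔ ∀ (M : Model) (z : El M PR.nat), P.Mem z → ev u z = ev v z := by
  simp only [← mem_toObj]
  exact (Hom.ext_iff.trans (PRa.Rep.eq_iff hu hv))

theorem Rep.comp {u v : Term PR.nat PR.nat} {h : P ⟶ Q} {k : Q ⟶ R} (hu : Rep u h)
    (hv : Rep v k) : Rep (v ∘ₜ u) (h ≫ k) := PRa.Rep.comp hu hv

theorem Rep.congr {u v : Term PR.nat PR.nat} {h : P ⟶ Q} (hu : Rep u h)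
    (hv : ∀ (M : Model) (z : El M PR.nat), P.Mem z → ev v z = ev u z) : Rep v h :=
  PRa.Rep.congr hu fun M z hz => hv M z ((mem_toObj P z).1 hz)

/-- An element of the universe monoid which represents a given map. -/
noncomputable def el (h : P ⟶ Q) : Term PR.nat PR.nat := h.isPRX.choose

theorem isPRX_el (h : P ⟶ Q) : IsPRX (el h) := h.isPRX.choose_spec.1

theorem rep_el (h : P ⟶ Q) : Rep (el h) h := h.isPRX.choose_spec.2

/-- A representing term need not belong to the universe monoid, so the identity may be evaluated by
`ident` instead of `xId`. -/
theorem rep_ident (P : PRXa) : Rep (ident PR.nat) (𝟙 P) := PRa.rep_id P.toObj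

/-- The map given by an element of the universe monoid. -/
def homMk (u : Term PR.nat PR.nat) (hu : IsPRX u)
    (h : ∀ (M : Model) (z : El M PR.nat), P.Mem z → Q.Mem (ev u z)) : P ⟶ Q :=
  ⟨PRa.homMk u fun M z hz => (mem_toObj _ _).2 (h M z ((mem_toObj _ _).1 hz)), u, hu,
    PRa.rep_homMk _ _⟩

theorem rep_homMk (u : Term PR.nat PR.nat) (hu : IsPRX u)
    (h : ∀ (M : Model) (z : El M PR.nat), P.Mem z → Q.Mem (ev u z)) : Rep u (homMk u hu h) :=
  ⟨_, rfl⟩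

/-! ### The cartesian p.r. structure of `PRXa` -/

/-- The product of two objects. -/
def prodObj (P Q : PRXa) : PRXa := ⟨pairPred P.pred Q.pred, isPred_and _ _⟩

/-- The terminal object. -/
def oneObj : PRXa := PRX.one.toPRXa

/-- The natural numbers object. -/
def natObj : PRXa := PRX.nat.toPRXa

theorem mem_oneObj {M : Model} {z : El M PR.nat} : oneObj.Mem z ↔ z = nuE 0 :=
  ⟨fun h => (PRX.ev_pred_one z).1 h.2, fun h => ⟨by rw [h]; simp, (PRX.ev_pred_one z).2 h⟩⟩

theorem mem_natObj {M : Model} {z : El M PR.nat} : natObj.Mem z ↔ ∃ n, z = nuE n :=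
  ⟨fun h => (PRX.ev_pred_nat z).1 h.2,
    fun h => ⟨by obtain ⟨n, rfl⟩ := h; simp, (PRX.ev_pred_nat z).2 h⟩⟩

theorem mem_prodObj_cpd {M : Model} {x y : El M PR.nat} :
    (prodObj P Q).Mem (cpd x y) ↔ P.Mem x ∧ Q.Mem y := by
  refine (and_congr (X_cpd x y) (ev_pairPred_cpd _ _ x y)).trans ?_
  simp only [Mem]; tauto

theorem mem_prodObj {M : Model} {z : El M PR.nat} :
    (prodObj P Q).Mem z ↔ ∃ x y, z = cpd x y ∧ P.Mem x ∧ Q.Mem y := by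
  constructor
  · intro h
    obtain ⟨x, y, rfl, -⟩ := (ev_pairPred_ne_zero _ _ z).1 h.2
    exact ⟨x, y, rfl, mem_prodObj_cpd.1 h⟩
  · rintro ⟨x, y, rfl, h⟩
    exact mem_prodObj_cpd.2 h

theorem mem_iter {u : Term PR.nat PR.nat}
    (hu : ∀ (M : Model) (z : El M PR.nat), P.Mem z → P.Mem (ev u z)) {M : Model}
    {z : El M PR.nat} (hz : P.Mem z) (n : El M PR.nat) : P.Mem (ev (iter u) (mkp z n)) :=
  (mem_toObj _ _).1 (PRa.mem_iter (P := P.toObj)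
    (fun M z hz => (mem_toObj _ _).2 (hu M z ((mem_toObj _ _).1 hz))) ((mem_toObj _ _).2 hz) n)

/-- The pairing of maps. -/
noncomputable def liftHom (f : R ⟶ P) (g : R ⟶ Q) : R ⟶ prodObj P Q :=
  homMk (xPair (el f) (el g)) ((isPRX_el f).pair (isPRX_el g)) fun M z hz => by
    have h1 := (rep_el f).mem hz
    have h2 := (rep_el g).mem hz
    rw [ev_xPair_of hz.1 h1.1 h2.1]
    exact mem_prodObj_cpd.2 ⟨h1, h2⟩

theorem Rep.ev_xPair {f : R ⟶ P} {g : R ⟶ Q} {u v : Term PR.nat PR.nat} (hu : Rep u f)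
    (hv : Rep v g) {M : Model} {z : El M PR.nat} (hz : R.Mem z) :
    ev (xPair u v) z = cpd (ev u z) (ev v z) :=
  ev_xPair_of hz.1 (hu.mem hz).1 (hv.mem hz).1

theorem rep_liftHom {f : R ⟶ P} {g : R ⟶ Q} {u v : Term PR.nat PR.nat} (hu : Rep u f)
    (hv : Rep v g) : Rep (xPair u v) (liftHom f g) :=
  (rep_homMk _ _ _).congr fun M z hz => by
    rw [hu.ev_xPair hv hz, (rep_el f).ev_xPair (rep_el g) hz, (hu.eq_iff (rep_el f)).1 rfl M z hz,
      (hv.eq_iff (rep_el g)).1 rfl M z hz]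

theorem ev_xFst_mem {M : Model} {x y : El M PR.nat} (h : P.Mem x) (k : Q.Mem y) :
    ev xFst (cpd x y) = x := ev_xFst_cpd h.1 k.1
theorem ev_xSnd_mem {M : Model} {x y : El M PR.nat} (h : P.Mem x) (k : Q.Mem y) :
    ev xSnd (cpd x y) = y := ev_xSnd_cpd h.1 k.1

/-- The terminal map. -/
def bangHom (P : PRXa) : P ⟶ oneObj :=
  homMk xBang .bang fun M z hz => by rw [ev_xBang_of hz.1]; exact mem_oneObj.2 rfl
/-- The first projection. -/
def fstHom (P Q : PRXa) : prodObj P Q ⟶ P := homMk xFst .fst fun M z hz => by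
  obtain ⟨x, y, rfl, hx, hy⟩ := mem_prodObj.1 hz
  rwa [ev_xFst_cpd hx.1 hy.1]
/-- The second projection. -/
def sndHom (P Q : PRXa) : prodObj P Q ⟶ Q := homMk xSnd .snd fun M z hz => by
  obtain ⟨x, y, rfl, hx, hy⟩ := mem_prodObj.1 hz
  rwa [ev_xSnd_cpd hx.1 hy.1]
/-- The iteration of an endomap. -/
noncomputable def iterHom (f : P ⟶ P) : prodObj P natObj ⟶ P :=
  homMk (xIter (el f)) (isPRX_el f).iter fun M z hz => by
    obtain ⟨x, y, rfl, hx, hy⟩ := mem_prodObj.1 hz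
    obtain ⟨n, rfl⟩ := mem_natObj.1 hy
    rw [ev_xIter_cpd _ hx.1]
    exact mem_iter (fun _ _ => (rep_el f).mem) hx n
/-- Zero. -/
def zeroHom : oneObj ⟶ natObj :=
  homMk xZero .zero fun M z hz => by
    rw [mem_oneObj.1 hz, ev_xZero_nuE]; exact mem_natObj.2 ⟨0, rfl⟩
/-- The successor. -/
def succHom : natObj ⟶ natObj :=
  homMk xSucc .succ fun M z hz => by
    obtain ⟨n, rfl⟩ := mem_natObj.1 hz
    rw [ev_xSucc_nuE]; exact mem_natObj.2 ⟨_, rfl⟩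

theorem rep_bangHom (P : PRXa) : Rep xBang (bangHom P) := rep_homMk _ _ _
theorem rep_fstHom (P Q : PRXa) : Rep xFst (fstHom P Q) := rep_homMk _ _ _
theorem rep_sndHom (P Q : PRXa) : Rep xSnd (sndHom P Q) := rep_homMk _ _ _
theorem rep_zeroHom : Rep xZero zeroHom := rep_homMk _ _ _
theorem rep_succHom : Rep xSucc succHom := rep_homMk _ _ _

theorem rep_iterHom {f : P ⟶ P} {u : Term PR.nat PR.nat} (hu : Rep u f) :
    Rep (xIter u) (iterHom f) :=
  (rep_homMk _ _ _).congr fun M z hz => by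
    obtain ⟨x, y, rfl, hx, hy⟩ := mem_prodObj.1 hz
    obtain ⟨n, rfl⟩ := mem_natObj.1 hy
    rw [ev_xIter_cpd _ hx.1, ev_xIter_cpd _ hx.1]
    refine induct ((((DF.const x).pair .id).map (iter u)).eq (((DF.const x).pair .id).map _))
      (by simp) (fun n h => ?_) n
    rw [ev_iter_S, ev_iter_S, h, (hu.eq_iff (rep_el f)).1 rfl]
    exact mem_iter (fun _ _ => (rep_el f).mem) hx n

theorem rep_zero_bang (P : PRXa) : Rep (xZero ∘ₜ xBang) (bangHom P ≫ zeroHom) :=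
  (rep_bangHom P).comp rep_zeroHom

theorem ev_zero_bang {M : Model} {z : El M PR.nat} (hz : P.Mem z) :
    ev (xZero ∘ₜ xBang) z = nuE 0 := by rw [ev_comp, ev_xBang_of hz.1, ev_xZero_nuE]

/-- Together with `ev_next` this computes on codes the maps into the product with the numbers that
occur in the laws of iteration. -/
theorem ev_initial {M : Model} {z : El M PR.nat} (hz : P.Mem z) :
    ev (xPair (ident _) (xZero ∘ₜ xBang)) z = cpd z (nuE 0) := by
  rw [(rep_ident P).ev_xPair (rep_zero_bang P) hz, ev_zero_bang hz, ev_ident]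

theorem ev_next {M : Model} {z : El M PR.nat} (hz : P.Mem z) (n : El M PR.nat) :
    ev (xPair xFst (xSucc ∘ₜ xSnd)) (cpd z (nuE n)) = cpd z (nuE (S n)) := by
  have : (prodObj P natObj).Mem (cpd z (nuE n)) :=
    mem_prodObj_cpd.2 ⟨hz, mem_natObj.2 ⟨n, rfl⟩⟩
  rw [(rep_fstHom P natObj).ev_xPair ((rep_sndHom P natObj).comp rep_succHom) this, ev_comp,
    ev_xFst_cpd hz.1 (X_nuE n), ev_xSnd_cpd hz.1 (X_nuE n), ev_xSucc_nuE]

/-- The cartesian p.r. structure of the universe theory with predicate abstraction. -/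
noncomputable def cartesianPR : CartesianPR PRXa where
  one := oneObj
  bang := bangHom
  bang_uniq f := ((rep_el f).eq_iff (rep_bangHom _)).2 fun M z hz => by
    rw [mem_oneObj.1 ((rep_el f).mem hz), ev_xBang_of hz.1]
  prod := prodObj
  fst := fstHom
  snd := sndHom
  lift := liftHom
  lift_fst f g := (((rep_liftHom (rep_el f) (rep_el g)).comp (rep_fstHom _ _)).eq_iff
    (rep_el f)).2 fun M z hz => by
      rw [ev_comp, (rep_el f).ev_xPair (rep_el g) hz,
        ev_xFst_mem ((rep_el f).mem hz) ((rep_el g).mem hz)]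
  lift_snd f g := (((rep_liftHom (rep_el f) (rep_el g)).comp (rep_sndHom _ _)).eq_iff
    (rep_el g)).2 fun M z hz => by
      rw [ev_comp, (rep_el f).ev_xPair (rep_el g) hz,
        ev_xSnd_mem ((rep_el f).mem hz) ((rep_el g).mem hz)]
  lift_uniq h := ((rep_liftHom ((rep_el h).comp (rep_fstHom _ _))
    ((rep_el h).comp (rep_sndHom _ _))).eq_iff (rep_el h)).2 fun M z hz => by
      rw [((rep_el h).comp (rep_fstHom _ _)).ev_xPair ((rep_el h).comp (rep_sndHom _ _)) hz]
      obtain ⟨x, y, e, hx, hy⟩ := mem_prodObj.1 ((rep_el h).mem hz)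
      rw [ev_comp, ev_comp, e, ev_xFst_mem hx hy, ev_xSnd_mem hx hy]
  nat := natObj
  zero := zeroHom
  succ := succHom
  iter := iterHom
  iter_zero f := (((rep_liftHom (rep_ident _) (rep_zero_bang _)).comp
    (rep_iterHom (rep_el f))).eq_iff (rep_ident _)).2 fun M z hz => by
      rw [ev_comp, ev_initial hz, ev_xIter_cpd _ hz.1, ev_iter_zero, ev_ident]
  iter_succ f := (((rep_liftHom (rep_fstHom _ _) ((rep_sndHom _ _).comp rep_succHom)).comp
    (rep_iterHom (rep_el f))).eq_iff ((rep_iterHom (rep_el f)).comp (rep_el f))).2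
    fun M z hz => by
      obtain ⟨x, y, rfl, hx, hy⟩ := mem_prodObj.1 hz
      obtain ⟨n, rfl⟩ := mem_natObj.1 hy
      rw [ev_comp, ev_comp, ev_next hx, ev_xIter_cpd _ hx.1, ev_xIter_cpd _ hx.1, ev_iter_S]
  iter_uniq {P Q} f g h h0 hs := by
    rw [((rep_liftHom (rep_ident _) (rep_zero_bang _)).comp (rep_el h)).eq_iff
      (rep_el f)] at h0
    rw [((rep_liftHom (rep_fstHom _ _) ((rep_sndHom _ _).comp rep_succHom)).comp
      (rep_el h)).eq_iff ((rep_el h).comp (rep_el g))] at hs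
    rw [(rep_el h).eq_iff ((rep_liftHom ((rep_fstHom _ _).comp (rep_el f)) (rep_sndHom _ _)).comp
      (rep_iterHom (rep_el g)))]
    intro M z hz
    rw [ev_comp, ((rep_fstHom _ _).comp (rep_el f)).ev_xPair (rep_sndHom _ _) hz]
    obtain ⟨x, y, rfl, hx, hy⟩ := mem_prodObj.1 hz
    obtain ⟨n, rfl⟩ := mem_natObj.1 hy
    rw [ev_comp, ev_xFst_mem hx hy, ev_xSnd_mem hx hy, ev_xIter_cpd _ ((rep_el f).mem hx).1]
    -- For induction the code `⟨x; νn⟩` must be exhibited as a definable function of `n`, hence as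
    -- `codePair` applied to `x` and `nu n`.
    refine induct (((((DF.const x).pair (DF.id.map nu)).map (codePair (fst _ _) (snd _ _))).map
      (el h)).eq (((DF.const _).pair .id).map _)) ?_ (fun n hn => ?_) n |> fun k => by simpa using k
    · have := h0 M x hx
      rw [ev_comp, ev_initial hx] at this
      simpa using this
    · have := hs M (cpd x (nuE n)) (mem_prodObj_cpd.2 ⟨hx, mem_natObj.2 ⟨n, rfl⟩⟩)
      rw [ev_comp, ev_comp, ev_next hx] at this
      rw [ev_iter_S, ← hn]
      simpa using this

theorem isStandard : IsStandard cartesianPR (𝟭 PRXa) where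
  bang := rep_bangHom
  fst := rep_fstHom
  snd := rep_sndHom
  lift _ _ _ _ hu hv := rep_liftHom hu hv
  zero := rep_zeroHom
  succ := rep_succHom
  iter _ _ hu := rep_iterHom hu

end PRXa

/-! ### Generalities on cartesian p.r. categories and functors -/

namespace CartesianPR

variable {C D E : Type*} [Category C] [Category D] [Category E]

section

variable (S : CartesianPR C)

theorem bang_ext {A : C} (f g : A ⟶ S.one) : f = g :=
  (S.bang_uniq f).trans (S.bang_uniq g).symm

theorem lift_ext {W A B : C} {f g : W ⟶ S.prod A B} (h : f ≫ S.fst A B = g ≫ S.fst A B)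
    (k : f ≫ S.snd A B = g ≫ S.snd A B) : f = g := by
  rw [← S.lift_uniq f, ← S.lift_uniq g, h, k]

theorem lift_fst_assoc {W A B Z : C} (f : W ⟶ A) (g : W ⟶ B) (k : A ⟶ Z) :
    S.lift f g ≫ S.fst A B ≫ k = f ≫ k := by rw [← Category.assoc, S.lift_fst]

theorem lift_snd_assoc {W A B Z : C} (f : W ⟶ A) (g : W ⟶ B) (k : B ⟶ Z) :
    S.lift f g ≫ S.snd A B ≫ k = g ≫ k := by rw [← Category.assoc, S.lift_snd]

theorem comp_lift {V W A B : C} (e : V ⟶ W) (f : W ⟶ A) (g : W ⟶ B) :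
    e ≫ S.lift f g = S.lift (e ≫ f) (e ≫ g) := by
  apply S.lift_ext
  · rw [Category.assoc, S.lift_fst, S.lift_fst]
  · rw [Category.assoc, S.lift_snd, S.lift_snd]

theorem comp_lift_assoc {V W A B Z : C} (e : V ⟶ W) (f : W ⟶ A) (g : W ⟶ B)
    (k : S.prod A B ⟶ Z) : e ≫ S.lift f g ≫ k = S.lift (e ≫ f) (e ≫ g) ≫ k := by
  rw [← Category.assoc, comp_lift]

theorem lift_fst_snd (A B : C) : S.lift (S.fst A B) (S.snd A B) = 𝟙 _ := by
  apply S.lift_ext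
  · rw [S.lift_fst, Category.id_comp]
  · rw [S.lift_snd, Category.id_comp]

/-- Iterates of maps which are related by a map. -/
theorem iter_comp {A B : C} {f : A ⟶ A} {g : B ⟶ B} {h : A ⟶ B} (e : f ≫ h = h ≫ g) :
    S.iter f ≫ h = S.lift (S.fst A S.nat ≫ h) (S.snd A S.nat) ≫ S.iter g := by
  apply S.iter_uniq
  · rw [← Category.assoc, S.iter_zero, Category.id_comp]
  · rw [← Category.assoc, S.iter_succ, Category.assoc, e, Category.assoc]

/-- The object `one` is terminal. -/
def isTerminal : IsTerminal S.one :=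
  IsTerminal.ofUniqueHom S.bang fun _ f => S.bang_uniq f

/-- The product is a categorical product. -/
def isLimitFan (A B : C) : IsLimit (BinaryFan.mk (S.fst A B) (S.snd A B)) :=
  BinaryFan.isLimitMk (fun s => S.lift s.fst s.snd) (fun _ => S.lift_fst _ _)
    (fun _ => S.lift_snd _ _) fun s m h k => by
      rw [← h, ← k]; exact (S.lift_uniq m).symm

theorem hasFiniteProducts (S : CartesianPR C) : HasFiniteProducts C := by
  have : HasTerminal C := S.isTerminal.hasTerminal
  have : ∀ {A B : C}, HasLimit (pair A B) := fun {A B} => ⟨⟨_, S.isLimitFan A B⟩⟩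
  have : HasBinaryProducts C := hasBinaryProducts_of_hasLimit_pair C
  exact hasFiniteProducts_of_has_binary_and_terminal

theorem hasFiniteLimits (S : CartesianPR C) (h : ∀ {A B : C} (f g : A ⟶ B), ∃ (W : C) (m : W ⟶ A)
    (w : m ≫ f = m ≫ g), Nonempty (IsLimit (Fork.ofι m w))) : HasFiniteLimits C := by
  have := S.hasFiniteProducts
  have : ∀ {A B : C} {f g : A ⟶ B}, HasLimit (parallelPair f g) := fun {A B f g} => by
    obtain ⟨W, m, w, ⟨k⟩⟩ := h f g
    exact ⟨⟨_, k⟩⟩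
  have : HasEqualizers C := hasEqualizers_of_hasLimit_parallelPair C
  exact hasFiniteLimits_of_hasEqualizers_and_finite_products

end

namespace IsPRFunctor

variable {S : CartesianPR C} {T : CartesianPR D} {U : CartesianPR E} {F : C ⥤ D} {G : D ⥤ E}

/-- Each comparison map of the composite is the image under `G` of the one for `F`, combined with
the one for `G`. -/
theorem comp (hF : S.IsPRFunctor T F) (hG : T.IsPRFunctor U G) : S.IsPRFunctor U (F ⋙ G) where
  one := by
    have h1 := hF.one
    have h2 := hG.one
    have : U.bang ((F ⋙ G).obj S.one) = G.map (T.bang (F.obj S.one)) ≫ U.bang (G.obj T.one) :=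
      U.bang_ext _ _
    rw [this]
    infer_instance
  prod A B := by
    have h1 := hF.prod A B
    have h2 := hG.prod (F.obj A) (F.obj B)
    have : U.lift ((F ⋙ G).map (S.fst A B)) ((F ⋙ G).map (S.snd A B)) =
        G.map (T.lift (F.map (S.fst A B)) (F.map (S.snd A B))) ≫
          U.lift (G.map (T.fst (F.obj A) (F.obj B))) (G.map (T.snd (F.obj A) (F.obj B))) := by
      rw [U.comp_lift, ← G.map_comp, ← G.map_comp, T.lift_fst, T.lift_snd]
      rfl
    rw [this]
    infer_instance
  nat := by
    obtain ⟨i, i0, is, ii⟩ := hF.nat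
    obtain ⟨j, j0, js, jj⟩ := hG.nat
    have e : U.bang ((F ⋙ G).obj S.one) = G.map (T.bang (F.obj S.one)) ≫ U.bang (G.obj T.one) :=
      U.bang_ext _ _
    refine ⟨j ≪≫ G.mapIso i, ?_, ?_, fun {A} f => ?_⟩
    · rw [e, Iso.trans_hom, Functor.mapIso_hom, Category.assoc, ← Category.assoc U.zero,
        ← Category.assoc (U.bang _), j0, ← G.map_comp, ← G.map_comp, i0]
      rfl
    · rw [Iso.trans_hom, Functor.mapIso_hom, ← Category.assoc, js, Category.assoc, Category.assoc,
        ← G.map_comp, is, G.map_comp]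
      rfl
    · have h1 := congrArg G.map (ii f)
      rw [G.map_comp, ← jj, U.comp_lift_assoc, ← G.map_comp, ← Category.assoc, ← G.map_comp,
        T.lift_fst, T.lift_snd, G.map_comp, Category.assoc] at h1
      exact h1

theorem preservesFiniteProducts (hF : S.IsPRFunctor T F) : PreservesFiniteProducts F := by
  have : HasTerminal C := S.isTerminal.hasTerminal
  have := S.hasFiniteProducts
  have h0 : PreservesLimit (Functor.empty.{0} C) F := by
    have := hF.one
    exact preservesLimit_of_preserves_limit_cone S.isTerminal
      ((isLimitMapConeEmptyConeEquiv F S.one).symm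
        (IsTerminal.ofIso T.isTerminal (asIso (T.bang (F.obj S.one))).symm))
  have := preservesLimitsOfShape_pempty_of_preservesTerminal F
  have h2 (A B : C) : PreservesLimit (pair A B) F := by
    obtain ⟨i, hi, hi'⟩ := (hF.prod A B).out
    have e1 : i ≫ F.map (S.fst A B) = T.fst _ _ := by
      rw [← T.lift_fst (F.map (S.fst A B)) (F.map (S.snd A B)), ← Category.assoc, hi',
        Category.id_comp]
    have e2 : i ≫ F.map (S.snd A B) = T.snd _ _ := by
      rw [← T.lift_snd (F.map (S.fst A B)) (F.map (S.snd A B)), ← Category.assoc, hi',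
        Category.id_comp]
    refine preservesLimit_of_preserves_limit_cone (S.isLimitFan A B)
      ((isLimitMapConeBinaryFanEquiv F _ _).symm (BinaryFan.isLimitMk
        (fun s => T.lift (A := F.obj A) (B := F.obj B) s.fst s.snd ≫ i)
        (fun s => ?_) (fun s => ?_) fun s m h k => ?_))
    · rw [Category.assoc, e1]; exact T.lift_fst _ _
    · rw [Category.assoc, e2]; exact T.lift_snd _ _
    · rw [← h, ← k, ← T.comp_lift, Category.assoc, hi, Category.comp_id]
  have : PreservesLimitsOfShape (Discrete WalkingPair) F :=
    ⟨fun {K} => preservesLimit_of_iso_diagram F (diagramIsoPair K).symm⟩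
  exact .of_preserves_binary_and_terminal F

/-- Finite limits are built from finite products and equalisers, and for each parallel pair it
suffices to test one equaliser cone. -/
theorem preservesFiniteLimits (hF : S.IsPRFunctor T F) (h : ∀ {A B : C} (f g : A ⟶ B),
    ∃ (W : C) (m : W ⟶ A) (w : m ≫ f = m ≫ g), Nonempty (IsLimit (Fork.ofι m w)) ∧
      Nonempty (IsLimit (Fork.ofι (F.map m)
        (by rw [← F.map_comp, w, F.map_comp] : F.map m ≫ F.map f = F.map m ≫ F.map g)))) :
    PreservesFiniteLimits F := by
  have := S.hasFiniteLimits fun f g => by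
    obtain ⟨W, m, w, k, -⟩ := h f g
    exact ⟨W, m, w, k⟩
  have := hF.preservesFiniteProducts
  have h1 {A B : C} (f g : A ⟶ B) : PreservesLimit (parallelPair f g) F := by
    obtain ⟨W, m, w, ⟨k⟩, ⟨k'⟩⟩ := h f g
    exact preservesLimit_of_preserves_limit_cone k ((isLimitMapConeForkEquiv F w).symm k')
  have : PreservesLimitsOfShape WalkingParallelPair F :=
    ⟨fun {K} => preservesLimit_of_iso_diagram F (diagramIsoParallelPair K).symm⟩
  exact preservesFiniteLimits_of_preservesEqualizers_and_finiteProducts F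

end IsPRFunctor

/-! ### Transport along an equivalence -/

section Transport

variable (S : CartesianPR C) (e : C ≌ D)

/-- The unit of an equivalence, at an object. -/
def up (X : C) : X ⟶ e.inverse.obj (e.functor.obj X) := e.unit.app X
/-- The inverse of the unit, at an object. -/
def down (X : C) : e.inverse.obj (e.functor.obj X) ⟶ X := e.unitInv.app X
/-- The counit of an equivalence, at an object. -/
def cou (Y : D) : e.functor.obj (e.inverse.obj Y) ⟶ Y := e.counit.app Y
/-- The inverse of the counit, at an object. -/
def couInv (Y : D) : Y ⟶ e.functor.obj (e.inverse.obj Y) := e.counitInv.app Y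

@[simp]
theorem up_down (X : C) : up e X ≫ down e X = 𝟙 X := e.unitIso.hom_inv_id_app X
@[simp]
theorem down_up (X : C) : down e X ≫ up e X = 𝟙 _ := e.unitIso.inv_hom_id_app X
@[simp]
theorem up_down_assoc {X Y : C} (f : X ⟶ Y) : up e X ≫ down e X ≫ f = f := by
  rw [← Category.assoc, up_down, Category.id_comp]
@[simp]
theorem down_up_assoc {X Y : C} (f : e.inverse.obj (e.functor.obj X) ⟶ Y) :
    down e X ≫ up e X ≫ f = f := by
  rw [← Category.assoc, down_up, Category.id_comp]

instance (X : C) : IsIso (up e X) := ⟨down e X, up_down e X, down_up e X⟩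
instance (X : C) : IsIso (down e X) := ⟨up e X, down_up e X, up_down e X⟩

theorem inverse_map_map {X Y : C} (f : X ⟶ Y) :
    e.inverse.map (e.functor.map f) = down e X ≫ f ≫ up e Y := e.inv_fun_map X Y f

theorem inverse_map_cou (Y : D) : e.inverse.map (cou e Y) = down e (e.inverse.obj Y) :=
  (e.unitInv_app_inverse Y).symm

theorem inverse_map_couInv (Y : D) : e.inverse.map (couInv e Y) = up e (e.inverse.obj Y) :=
  (e.unit_app_inverse Y).symm

/-- The triangle identity in working form. Equations between transported maps are tested after
applying the faithful inverse functor, where this rewrites the transported projections and iterates.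
-/
theorem inverse_map_map_cou {X : C} {Y : D} (f : X ⟶ e.inverse.obj Y) :
    e.inverse.map (e.functor.map f ≫ cou e Y) = down e X ≫ f := by
  rw [Functor.map_comp, inverse_map_cou, inverse_map_map]
  simp

/-- The transported terminal map. -/
def transportBang (A : D) : A ⟶ e.functor.obj S.one :=
  couInv e A ≫ e.functor.map (S.bang _)

/-- The transported pairing. -/
def transportLift {W A B : D} (f : W ⟶ A) (g : W ⟶ B) :
    W ⟶ e.functor.obj (S.prod (e.inverse.obj A) (e.inverse.obj B)) :=
  couInv e W ≫ e.functor.map (S.lift (e.inverse.map f) (e.inverse.map g))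

/-- Adjusting the argument of an iterated map. -/
def downNat (A : C) : S.prod A (e.inverse.obj (e.functor.obj S.nat)) ⟶ S.prod A S.nat :=
  S.lift (S.fst _ _) (S.snd _ _ ≫ down e S.nat)

/-- The inverse of `downNat`. -/
def upNat (A : C) : S.prod A S.nat ⟶ S.prod A (e.inverse.obj (e.functor.obj S.nat)) :=
  S.lift (S.fst _ _) (S.snd _ _ ≫ up e S.nat)

theorem upNat_downNat (A : C) : S.upNat e A ≫ S.downNat e A = 𝟙 _ := by
  apply S.lift_ext <;>
    simp [upNat, downNat, S.lift_fst, S.lift_snd, S.lift_snd_assoc]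

theorem downNat_upNat (A : C) : S.downNat e A ≫ S.upNat e A = 𝟙 _ := by
  apply S.lift_ext <;>
    simp [upNat, downNat, S.lift_fst, S.lift_snd, S.lift_snd_assoc]

theorem upNat_downNat_assoc {A B : C} (f : S.prod A S.nat ⟶ B) :
    S.upNat e A ≫ S.downNat e A ≫ f = f := by
  rw [← Category.assoc, upNat_downNat, Category.id_comp]

theorem downNat_upNat_assoc {A B : C}
    (f : S.prod A (e.inverse.obj (e.functor.obj S.nat)) ⟶ B) :
    S.downNat e A ≫ S.upNat e A ≫ f = f := by
  rw [← Category.assoc, downNat_upNat, Category.id_comp]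

/-- The transported iteration. -/
def transportIter {A : D} (f : A ⟶ A) : e.functor.obj (S.prod (e.inverse.obj A)
    (e.inverse.obj (e.functor.obj S.nat))) ⟶ A :=
  e.functor.map (S.downNat e _ ≫ S.iter (e.inverse.map f)) ≫ cou e A

theorem inverse_map_transportLift {W A B : D} (f : W ⟶ A) (g : W ⟶ B) :
    e.inverse.map (S.transportLift e f g) =
      S.lift (e.inverse.map f) (e.inverse.map g) ≫ up e _ := by
  rw [transportLift, Functor.map_comp, inverse_map_couInv, inverse_map_map]
  simp

theorem inverse_map_transportIter {A : D} (f : A ⟶ A) :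
    e.inverse.map (S.transportIter e f) =
      down e _ ≫ S.downNat e _ ≫ S.iter (e.inverse.map f) := by
  rw [transportIter, inverse_map_map_cou]

theorem transportBang_ext {A : D} (f g : A ⟶ e.functor.obj S.one) : f = g := by
  apply e.inverse.map_injective
  have := S.bang_ext (e.inverse.map f ≫ down e S.one) (e.inverse.map g ≫ down e S.one)
  simpa using congrArg (fun k => k ≫ up e S.one) this

/-- Seen through the inverse functor and freed of units, the transported starting map becomes the
original one; `inverse_map_next` does the same for the successor step. -/
theorem inverse_map_initial (A : D) : e.inverse.map (S.transportLift e (𝟙 A)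
    (S.transportBang e A ≫ e.functor.map S.zero)) ≫ down e _ ≫ S.downNat e _ =
    S.lift (𝟙 _) (S.bang _ ≫ S.zero) := by
  have h : e.inverse.map (S.transportBang e A) ≫ down e S.one = S.bang _ := S.bang_ext _ _
  rw [inverse_map_transportLift, Category.assoc, CategoryTheory.Functor.map_id, Functor.map_comp,
    inverse_map_map, up_down_assoc, downNat]
  apply S.lift_ext
  · simp [S.lift_fst]
  · simp [S.lift_snd, S.lift_snd_assoc, reassoc_of% h]

theorem inverse_map_next (A : D) : e.inverse.map (S.transportLift e
      (e.functor.map (S.fst (e.inverse.obj A) (e.inverse.obj (e.functor.obj S.nat))) ≫ cou e A)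
      ((e.functor.map (S.snd (e.inverse.obj A) (e.inverse.obj (e.functor.obj S.nat))) ≫
        cou e (e.functor.obj S.nat)) ≫ e.functor.map S.succ)) ≫ down e _ ≫ S.downNat e _ =
    down e _ ≫ S.downNat e _ ≫ S.lift (S.fst _ _) (S.snd _ _ ≫ S.succ) := by
  rw [inverse_map_transportLift, Category.assoc, inverse_map_map_cou, Functor.map_comp,
    inverse_map_map_cou, inverse_map_map, up_down_assoc, downNat]
  apply S.lift_ext <;> simp [S.lift_fst, S.lift_snd, S.lift_snd_assoc]

/-- The cartesian p.r. structure transported along an equivalence. -/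
@[reducible] def transport : CartesianPR D where
  one := e.functor.obj S.one
  bang := S.transportBang e
  bang_uniq f := S.transportBang_ext e _ _
  prod A B := e.functor.obj (S.prod (e.inverse.obj A) (e.inverse.obj B))
  fst A B := e.functor.map (S.fst _ _) ≫ cou e A
  snd A B := e.functor.map (S.snd _ _) ≫ cou e B
  lift := S.transportLift e
  lift_fst f g := by
    apply e.inverse.map_injective
    rw [Functor.map_comp, inverse_map_transportLift, inverse_map_map_cou]
    simp [S.lift_fst]
  lift_snd f g := by
    apply e.inverse.map_injective
    rw [Functor.map_comp, inverse_map_transportLift, inverse_map_map_cou]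
    simp [S.lift_snd]
  lift_uniq h := by
    apply e.inverse.map_injective
    rw [inverse_map_transportLift, Functor.map_comp, Functor.map_comp e.inverse h,
      inverse_map_map_cou, inverse_map_map_cou, ← Category.assoc, ← Category.assoc,
      S.lift_uniq]
    simp
  nat := e.functor.obj S.nat
  zero := e.functor.map S.zero
  succ := e.functor.map S.succ
  iter := S.transportIter e
  iter_zero f := by
    apply e.inverse.map_injective
    have := congrArg (fun k => k ≫ S.iter (e.inverse.map f)) (S.inverse_map_initial e _)
    simp only [Category.assoc, S.iter_zero] at this
    rw [Functor.map_comp, inverse_map_transportIter, this, CategoryTheory.Functor.map_id]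
  iter_succ f := by
    apply e.inverse.map_injective
    have := congrArg (fun k => k ≫ S.iter (e.inverse.map f)) (S.inverse_map_next e _)
    simp only [Category.assoc, S.iter_succ] at this
    rw [Functor.map_comp, Functor.map_comp, inverse_map_transportIter]
    simp only [Category.assoc]
    rw [← this]
  iter_uniq {A B} f g h h0 hs := by
    -- This is `h` carried to the original category, with its numerical argument adjusted by the
    -- unit. Uniqueness is applied to it there and the result carried back.
    let k : S.prod (e.inverse.obj A) S.nat ⟶ e.inverse.obj B :=
      S.upNat e _ ≫ up e _ ≫ e.inverse.map h
    have hk : e.inverse.map h = down e _ ≫ S.downNat e _ ≫ k := by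
      simp only [k]
      rw [downNat_upNat_assoc, down_up_assoc]
    have key : k = S.lift (S.fst _ _ ≫ e.inverse.map f) (S.snd _ _) ≫ S.iter (e.inverse.map g) := by
      apply S.iter_uniq
      · rw [← h0, Functor.map_comp, hk, ← inverse_map_initial]
        simp only [Category.assoc]
      · have hs := congrArg e.inverse.map hs
        have h1 := congrArg (fun x => x ≫ k) (S.inverse_map_next e A)
        simp only [Category.assoc] at h1
        rw [Functor.map_comp, Functor.map_comp, hk, Category.assoc (e.functor.map _)] at hs
        have h2 := congrArg (fun x => S.upNat e _ ≫ up e _ ≫ x) (h1.symm.trans hs)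
        simpa only [Category.assoc, up_down_assoc, upNat_downNat_assoc] using h2
    apply e.inverse.map_injective
    have h3 : S.downNat e (e.inverse.obj A) ≫ S.lift (S.fst _ _ ≫ e.inverse.map f) (S.snd _ _) =
        S.lift (S.fst _ _ ≫ e.inverse.map f) (S.snd _ _) ≫ S.downNat e _ := by
      apply S.lift_ext <;>
        simp [downNat, S.lift_fst, S.lift_snd, S.lift_snd_assoc, S.lift_fst_assoc]
    rw [Functor.map_comp, inverse_map_transportLift, inverse_map_transportIter, hk, key,
      Functor.map_comp, inverse_map_map_cou, inverse_map_map_cou, Category.assoc, Category.assoc,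
      up_down_assoc, ← S.comp_lift, Category.assoc, ← reassoc_of% h3]

/-- All comparison maps turn out to be components of the unit or of its inverse. -/
theorem transport_inverse : (S.transport e).IsPRFunctor S e.inverse where
  one := by
    have : S.bang (e.inverse.obj (S.transport e).one) = down e S.one := S.bang_ext _ _
    rw [this]
    exact inferInstanceAs (IsIso (down e _))
  prod A B := by
    have : S.lift (e.inverse.map ((S.transport e).fst A B)) (e.inverse.map ((S.transport e).snd A B))
        = down e (S.prod (e.inverse.obj A) (e.inverse.obj B)) := by
      change S.lift (e.inverse.map (e.functor.map _ ≫ cou e A))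
        (e.inverse.map (e.functor.map _ ≫ cou e B)) = _
      rw [inverse_map_map_cou, inverse_map_map_cou, S.lift_uniq]
    rw [this]
    exact inferInstanceAs (IsIso (down e _))
  nat := by
    refine ⟨⟨up e S.nat, down e S.nat, up_down e _, down_up e _⟩, ?_, ?_, fun {A} f => ?_⟩
    · change S.bang (e.inverse.obj (e.functor.obj S.one)) ≫ S.zero ≫ up e _ =
        e.inverse.map (e.functor.map S.zero)
      rw [inverse_map_map, S.bang_ext (S.bang _) (down e S.one)]
    · change S.succ ≫ up e _ = up e _ ≫ e.inverse.map (e.functor.map S.succ)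
      rw [inverse_map_map]
      simp
    · change S.lift (e.inverse.map (e.functor.map (S.fst _ _) ≫ cou e A))
        (e.inverse.map (e.functor.map (S.snd _ _) ≫ cou e (e.functor.obj S.nat)) ≫ down e _) ≫ _ =
          e.inverse.map (S.transportIter e f)
      rw [inverse_map_transportIter, inverse_map_map_cou, inverse_map_map_cou, downNat,
        S.comp_lift_assoc, Category.assoc]

/-- The product comparison becomes a composite of isomorphisms after applying the inverse functor,
which reflects isomorphisms. The numbers object is preserved strictly. -/
theorem transport_functor : S.IsPRFunctor (S.transport e) e.functor where
  one := by
    have : (S.transport e).bang (e.functor.obj S.one) = 𝟙 _ := (S.transport e).bang_ext _ _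
    rw [this]
    exact inferInstanceAs (IsIso (𝟙 (e.functor.obj S.one)))
  prod A B := by
    have h : e.inverse.map ((S.transport e).lift (e.functor.map (S.fst A B))
        (e.functor.map (S.snd A B))) = down e _ ≫
          S.lift (S.fst A B ≫ up e A) (S.snd A B ≫ up e B) ≫ up e _ := by
      change e.inverse.map (S.transportLift e _ _) = _
      rw [inverse_map_transportLift, inverse_map_map, inverse_map_map, S.comp_lift_assoc]
    have : IsIso (S.lift (S.fst A B ≫ up e A) (S.snd A B ≫ up e B)) := by
      refine ⟨S.lift (S.fst _ _ ≫ down e A) (S.snd _ _ ≫ down e B), ?_, ?_⟩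
      · apply S.lift_ext <;>
          simp [S.lift_fst, S.lift_snd, S.lift_snd_assoc, S.lift_fst_assoc]
      · apply S.lift_ext <;>
          simp [S.lift_fst, S.lift_snd, S.lift_snd_assoc, S.lift_fst_assoc]
    have : IsIso (e.inverse.map ((S.transport e).lift (e.functor.map (S.fst A B))
        (e.functor.map (S.snd A B)))) := by
      rw [h]
      exact inferInstanceAs (IsIso (down e _ ≫ S.lift _ _ ≫ up e _))
    exact isIso_of_reflects_iso _ e.inverse
  nat := by
    refine ⟨Iso.refl _, ?_, ?_, fun {A} f => ?_⟩
    · have : (S.transport e).bang (e.functor.obj S.one) = 𝟙 _ := (S.transport e).bang_ext _ _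
      rw [this]
      exact (Category.id_comp _).trans (Category.comp_id _)
    · exact (Category.comp_id _).trans (Category.id_comp _).symm
    · apply e.inverse.map_injective
      change e.inverse.map (S.transportLift e (e.functor.map (S.fst A S.nat))
        (e.functor.map (S.snd A S.nat) ≫ 𝟙 (e.functor.obj S.nat)) ≫
          S.transportIter e (e.functor.map f)) = _
      have h1 := S.iter_comp (f := f) (g := e.inverse.map (e.functor.map f)) (h := up e A)
        (by rw [inverse_map_map]; simp)
      have h2 : S.lift (down e (S.prod A S.nat) ≫ S.fst A S.nat ≫ up e A)
          (down e (S.prod A S.nat) ≫ S.snd A S.nat ≫ up e S.nat) ≫ S.downNat e _ =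
            down e (S.prod A S.nat) ≫ S.lift (S.fst A S.nat ≫ up e A) (S.snd A S.nat) := by
        apply S.lift_ext <;>
          simp [downNat, S.lift_fst, S.lift_snd, S.lift_snd_assoc]
      rw [Category.comp_id, Functor.map_comp, inverse_map_transportLift, inverse_map_transportIter,
        inverse_map_map e (S.iter f), h1, inverse_map_map e (S.fst _ _),
        inverse_map_map e (S.snd _ _), Category.assoc, up_down_assoc, reassoc_of% h2]

end Transport

end CartesianPR

/-- A fully faithful functor which is bijective on objects is an isomorphism of categories. -/
theorem CategoryTheory.Functor.exists_strict_inverse {C D : Type*} [Category C] [Category D]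
    (F : C ⥤ D) [F.Full] [F.Faithful] (hF : Function.Bijective F.obj) :
    ∃ K : D ⥤ C, F ⋙ K = 𝟭 _ ∧ K ⋙ F = 𝟭 _ := by
  choose k hk using hF.2
  -- Fullness supplies the maps; the equalities `F.obj (k X) = X` are inserted as isomorphisms to
  -- match their endpoints.
  let K : D ⥤ C :=
    { obj := k
      map := fun {X Y} f => F.preimage (eqToHom (hk X) ≫ f ≫ eqToHom (hk Y).symm)
      map_id := fun X => F.map_injective (by simp)
      map_comp := fun f g => F.map_injective (by simp) }
  refine ⟨K, Functor.ext (fun X => hF.1 (hk _)) fun X Y f => F.map_injective ?_,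
    Functor.ext hk fun X Y f => ?_⟩
  · simp [K, eqToHom_map]
  · simp [K]

namespace PRX

open PR PR.Model Term

/-! ### The cartesian p.r. structure of `PRX` -/

instance : incl.Faithful := inferInstanceAs (inducedFunctor toPRXa).Faithful

/-- A map of `PRX`, as a map of `PRXa`. -/
def homMk {P Q : PRX} (f : incl.obj P ⟶ incl.obj Q) : P ⟶ Q := InducedCategory.homMk f

/-- The cartesian p.r. structure of the universe theory. -/
noncomputable def cartesianPR : CartesianPR PRX where
  one := one
  bang P := homMk (PRXa.bangHom (incl.obj P))
  -- The inclusion is faithful and takes the chosen objects definitionally to those of `PRXa`, so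
  -- the laws there are reflected.
  bang_uniq f := incl.map_injective (PRXa.cartesianPR.bang_uniq (incl.map f))
  prod := prod
  fst P Q := homMk (PRXa.fstHom (incl.obj P) (incl.obj Q))
  snd P Q := homMk (PRXa.sndHom (incl.obj P) (incl.obj Q))
  lift f g := homMk (PRXa.liftHom (incl.map f) (incl.map g))
  lift_fst f g := incl.map_injective (PRXa.cartesianPR.lift_fst (incl.map f) (incl.map g))
  lift_snd f g := incl.map_injective (PRXa.cartesianPR.lift_snd (incl.map f) (incl.map g))
  lift_uniq {_ A B} h := incl.map_injective (PRXa.cartesianPR.lift_uniq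
    (A := incl.obj A) (B := incl.obj B) (incl.map h))
  nat := nat
  zero := homMk PRXa.zeroHom
  succ := homMk PRXa.succHom
  iter f := homMk (PRXa.iterHom (incl.map f))
  iter_zero f := incl.map_injective (PRXa.cartesianPR.iter_zero (incl.map f))
  iter_succ f := incl.map_injective (PRXa.cartesianPR.iter_succ (incl.map f))
  iter_uniq f g h h0 hs := incl.map_injective (PRXa.cartesianPR.iter_uniq (incl.map f) (incl.map g)
    (incl.map h) (congrArg incl.map h0) (congrArg incl.map hs))

theorem isStandard : PRXa.IsStandard cartesianPR incl where
  bang P := PRXa.rep_bangHom (incl.obj P)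
  fst P Q := PRXa.rep_fstHom (incl.obj P) (incl.obj Q)
  snd P Q := PRXa.rep_sndHom (incl.obj P) (incl.obj Q)
  lift _ _ _ _ hu hv := PRXa.rep_liftHom hu hv
  zero := PRXa.rep_zeroHom
  succ := PRXa.rep_succHom
  iter _ _ hu := PRXa.rep_iterHom hu

/-- The structure is preserved on the nose, so the comparison maps are identities. -/
theorem isPRFunctor_incl : cartesianPR.IsPRFunctor PRXa.cartesianPR incl where
  one := by
    have : PRXa.cartesianPR.bang (incl.obj cartesianPR.one) = 𝟙 PRXa.oneObj :=
      PRXa.cartesianPR.bang_ext _ _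
    rw [this]
    exact inferInstanceAs (IsIso (𝟙 PRXa.oneObj))
  prod P Q := by
    have : PRXa.cartesianPR.lift (incl.map (cartesianPR.fst P Q)) (incl.map (cartesianPR.snd P Q)) =
        𝟙 (PRXa.prodObj (incl.obj P) (incl.obj Q)) :=
      PRXa.cartesianPR.lift_fst_snd (incl.obj P) (incl.obj Q)
    rw [this]
    exact inferInstanceAs (IsIso (𝟙 (PRXa.prodObj (incl.obj P) (incl.obj Q))))
  nat := by
    refine ⟨Iso.refl PRXa.natObj, ?_, ?_, fun {A} f => ?_⟩
    · have : PRXa.cartesianPR.bang (incl.obj cartesianPR.one) = 𝟙 PRXa.oneObj :=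
        PRXa.cartesianPR.bang_ext _ _
      rw [this]
      exact (Category.id_comp _).trans (Category.comp_id PRXa.zeroHom)
    · exact (Category.comp_id PRXa.succHom).trans (Category.id_comp PRXa.succHom).symm
    · have : PRXa.cartesianPR.lift (PRXa.fstHom (incl.obj A) PRXa.natObj)
          (PRXa.sndHom (incl.obj A) PRXa.natObj ≫ 𝟙 PRXa.natObj) = 𝟙 _ := by
        rw [Category.comp_id]
        exact PRXa.cartesianPR.lift_fst_snd _ _
      exact (congrArg (fun k => k ≫ PRXa.iterHom (incl.map f)) this).trans (Category.id_comp _)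

end PRX

namespace PRXa

open PR PR.Model Term

/-! ### The embedding functors -/

theorem mem_ofPRa {P : PRa} {M : Model} {z : El M PR.nat} :
    (ofPRa P).Mem z ↔ ∃ a, z = ev (nuMap P.carrier) a ∧ P.Mem a := by
  refine (and_congr_right fun _ => (ev_and_ne_zero _ _ _).trans
    (and_congr_left fun _ => ev_imPred_ne_zero _)).trans ?_
  constructor
  · rintro ⟨-, ⟨a, rfl⟩, h⟩
    exact ⟨a, rfl, by simpa [PRa.Mem] using h⟩
  · rintro ⟨a, rfl, h⟩
    exact ⟨X_nuMap a, ⟨a, rfl⟩, by simpa [PRa.Mem] using h⟩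

theorem mem_incl_ofPR {A : PR} {M : Model} {z : El M PR.nat} :
    (PRX.incl.obj (PRX.ofPR A)).Mem z ↔ ∃ a, z = ev (nuMap A) a := by
  refine (and_congr_right fun _ => PRX.ev_pred_ofPR z).trans (and_iff_right_of_imp ?_)
  rintro ⟨a, rfl⟩
  exact X_nuMap a

end PRXa

/-! ### The functor from `PR` to `PRX` -/

namespace PR

open PR.Model Term

/-- A term for a map of the theory of primitive recursion. -/
noncomputable def el {A B : PR} (f : A ⟶ B) : Term A B := (mk_surj f).choose

theorem cls_el {A B : PR} (f : A ⟶ B) : cls (el f) = f := (mk_surj f).choose_spec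

/-- The map of `PRX` given by a numeral twin. -/
def twinHom {A B : PR} (f : Term A B) : PRX.ofPR A ⟶ PRX.ofPR B :=
  PRX.homMk (PRXa.homMk (twin f) (isPRX_twin f) fun M z hz => by
    obtain ⟨a, rfl⟩ := PRXa.mem_incl_ofPR.1 hz
    exact PRXa.mem_incl_ofPR.2 ⟨ev f a, ev_twin_nuMap f a⟩)

theorem rep_twinHom {A B : PR} (f : Term A B) :
    PRXa.Rep (twin f) (PRX.incl.map (twinHom f)) := ⟨_, rfl⟩

/-- Injectivity of numeralisation gives one direction. The two directions make the embedding
faithful and independent of chosen terms. -/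
theorem twinHom_eq_iff {A B : PR} {f g : Term A B} : twinHom f = twinHom g ↔ Eqv f g := by
  rw [← PRX.incl.map_injective.eq_iff, (rep_twinHom f).eq_iff (rep_twinHom g), eqv_iff_ev]
  refine forall_congr' fun M => ⟨fun h a => ?_, fun h z hz => ?_⟩
  · simpa using h _ (PRXa.mem_incl_ofPR.2 ⟨a, rfl⟩)
  · obtain ⟨a, rfl⟩ := PRXa.mem_incl_ofPR.1 hz
    simp [h]

theorem twinHom_comp {A B C : PR} (f : Term A B) (g : Term B C) :
    twinHom (g ∘ₜ f) = twinHom f ≫ twinHom g := by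
  apply PRX.incl.map_injective
  rw [Functor.map_comp, (rep_twinHom _).eq_iff ((rep_twinHom f).comp (rep_twinHom g))]
  intro M z hz
  obtain ⟨a, rfl⟩ := PRXa.mem_incl_ofPR.1 hz
  simp

theorem twinHom_ident (A : PR) : twinHom (ident A) = 𝟙 _ := by
  apply PRX.incl.map_injective
  rw [CategoryTheory.Functor.map_id, (rep_twinHom _).eq_iff (PRXa.rep_ident _)]
  intro M z hz
  obtain ⟨a, rfl⟩ := PRXa.mem_incl_ofPR.1 hz
  simp

/-- The embedding of the theory of primitive recursion in the universe theory. -/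
noncomputable def embedding : PR ⥤ PRX where
  obj := PRX.ofPR
  map f := twinHom (el f)
  map_id A := by
    rw [← twinHom_ident, twinHom_eq_iff, ← mk_eq, cls_el, mk_id]
  map_comp f g := by
    rw [← twinHom_comp, twinHom_eq_iff, ← mk_eq, cls_el, mk_comp, cls_el, cls_el]

theorem embedding_map_cls {A B : PR} (f : Term A B) : embedding.map (cls f) = twinHom f :=
  twinHom_eq_iff.2 (mk_eq.1 (cls_el _))

theorem rep_embedding_map {A B : PR} (f : Term A B) :
    PRXa.Rep (twin f) (PRX.incl.map (embedding.map (cls f))) := by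
  rw [embedding_map_cls]; exact rep_twinHom f

instance : embedding.Faithful where
  map_injective {A B f g} h := by
    rw [← cls_el f, ← cls_el g, mk_eq]; exact twinHom_eq_iff.1 h

/-- `PRX.ofPR` respects the generation of objects strictly, so the comparison maps are identities;
the laws of twins supply the equations. -/
theorem isPRFunctor_embedding : PR.cartesianPR.IsPRFunctor PRX.cartesianPR embedding where
  one := by
    have : PRX.cartesianPR.bang (embedding.obj PR.cartesianPR.one) = 𝟙 PRX.one :=
      PRX.cartesianPR.bang_ext _ _
    rw [this]
    exact inferInstanceAs (IsIso (𝟙 PRX.one))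
  prod A B := by
    have : PRX.cartesianPR.lift (embedding.map (PR.cartesianPR.fst A B))
        (embedding.map (PR.cartesianPR.snd A B)) = 𝟙 (PRX.ofPR (PR.prod A B)) := by
      apply PRX.incl.map_injective
      refine ((PRX.isStandard.lift _ _ _ _ (rep_embedding_map (fst A B))
        (rep_embedding_map (snd A B))).eq_iff (PRXa.rep_ident _)).2 fun M z hz => ?_
      obtain ⟨a, rfl⟩ := PRXa.mem_incl_ofPR.1 hz
      rw [← eqv_iff_ev.1 (twin_pair _ _), ev_twin_nuMap]
      simp
    rw [this]
    exact inferInstanceAs (IsIso (𝟙 (PRX.ofPR (PR.prod A B))))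
  nat := by
    refine ⟨Iso.refl PRX.nat, ?_, ?_, fun {A} f => ?_⟩
    · have : PRX.cartesianPR.bang (embedding.obj PR.cartesianPR.one) = 𝟙 PRX.one :=
        PRX.cartesianPR.bang_ext _ _
      rw [this]
      refine (Category.id_comp _).trans ((Category.comp_id PRX.cartesianPR.zero).trans ?_)
      apply PRX.incl.map_injective
      refine (PRX.isStandard.zero.eq_iff (rep_embedding_map zero)).2 fun M z hz => ?_
      rw [eqv_iff_ev.1 twin_zero]
    · refine (Category.comp_id PRX.cartesianPR.succ).trans (Eq.trans ?_ (Category.id_comp _).symm)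
      apply PRX.incl.map_injective
      refine (PRX.isStandard.succ.eq_iff (rep_embedding_map succ)).2 fun M z hz => ?_
      rw [eqv_iff_ev.1 twin_succ]
    · obtain ⟨f, rfl⟩ := mk_surj f
      apply PRX.incl.map_injective
      refine (((PRX.isStandard.lift _ _ _ _ (rep_embedding_map (fst A PR.nat))
        (((rep_embedding_map (snd A PR.nat)).comp (PRXa.rep_ident _)).congr
          (v := twin (snd A PR.nat)) fun M z _ => by simp)).comp
        (PRX.isStandard.iter _ _ (rep_embedding_map f))).eq_iff (rep_embedding_map (iter f))).2
          fun M z hz => ?_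
      obtain ⟨a, rfl⟩ := PRXa.mem_incl_ofPR.1 hz
      rw [eqv_iff_ev.1 (twin_iter f), ev_comp, ev_comp, ← eqv_iff_ev.1 (twin_pair _ _),
        ev_twin_nuMap, ev_twin_nuMap]
      simp

end PR

/-! ### The functor from `PRa` to `PRXa` -/

namespace PRXa

open PR PR.Model Term

variable {P Q R : PRa}

/-- The map of `PRXa` given by the numeral twin of a representing term. -/
noncomputable def twinHom (h : P ⟶ Q) : ofPRa P ⟶ ofPRa Q :=
  homMk (twin (PRa.el h)) (isPRX_twin _) fun M z hz => by
    obtain ⟨a, rfl, ha⟩ := mem_ofPRa.1 hz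
    rw [ev_twin_nuMap]
    exact mem_ofPRa.2 ⟨_, rfl, (PRa.rep_el h).mem ha⟩

theorem rep_twinHom {f : Term P.carrier Q.carrier} {h : P ⟶ Q} (hf : PRa.Rep f h) :
    Rep (twin f) (twinHom h) :=
  (rep_homMk _ _ _).congr fun M z hz => by
    obtain ⟨a, rfl, ha⟩ := mem_ofPRa.1 hz
    rw [ev_twin_nuMap, ev_twin_nuMap, (hf.eq_iff (PRa.rep_el h)).1 rfl M a ha]

theorem twinHom_eq_iff {h k : P ⟶ Q} : twinHom h = twinHom k ↔ h = k := by
  rw [(rep_twinHom (PRa.rep_el h)).eq_iff (rep_twinHom (PRa.rep_el k)),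
    (PRa.rep_el h).eq_iff (PRa.rep_el k)]
  refine forall_congr' fun M => ⟨fun e a ha => ?_, fun e z hz => ?_⟩
  · simpa using e _ (mem_ofPRa.2 ⟨a, rfl, ha⟩)
  · obtain ⟨a, rfl, ha⟩ := mem_ofPRa.1 hz
    rw [ev_twin_nuMap, ev_twin_nuMap, e a ha]

/-- The embedding of the theory with predicate abstraction in the universe theory. -/
noncomputable def embedding : PRa ⥤ PRXa where
  obj := ofPRa
  map h := twinHom h
  map_id P := ((rep_twinHom (PRa.rep_id P)).eq_iff (rep_ident _)).2 fun M z hz => by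
    obtain ⟨a, rfl, ha⟩ := mem_ofPRa.1 hz
    simp
  map_comp h k := ((rep_twinHom ((PRa.rep_el h).comp (PRa.rep_el k))).eq_iff
    ((rep_twinHom (PRa.rep_el h)).comp (rep_twinHom (PRa.rep_el k)))).2 fun M z hz => by
      obtain ⟨a, rfl, ha⟩ := mem_ofPRa.1 hz
      simp

theorem rep_embedding_map {f : Term P.carrier Q.carrier} {h : P ⟶ Q} (hf : PRa.Rep f h) :
    Rep (twin f) (embedding.map h) := rep_twinHom hf

instance : embedding.Faithful where
  map_injective h := twinHom_eq_iff.1 h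

/-- Objects carry predicate terms, not classes of terms. The predicate of the image contains `P.pred
∘ₜ nuMapInv P.carrier`; injectivity of the term constructors recovers the carrier, as the
intermediate object, and then the predicate. -/
theorem embedding_obj_injective : Function.Injective embedding.obj := by
  intro P Q h
  have h : and (imPred P.carrier) (P.pred ∘ₜ nuMapInv P.carrier) =
      and (imPred Q.carrier) (Q.pred ∘ₜ nuMapInv Q.carrier) := congrArg PRXa.pred h
  obtain ⟨A, p, hp⟩ := P
  obtain ⟨B, q, hq⟩ := Q
  simp only [PR.and, mul, Term.comp.injEq, Term.pair.injEq, heq_eq_eq, true_and] at h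
  obtain ⟨-, rfl, h, -⟩ := h
  cases h
  rfl

/-- The preimage of `k` is `k` conjugated by numeralisation. Nothing is lost in decoding, since `k`
takes numeralised members of `P` to numeralised members of `Q`. -/
instance : embedding.Full where
  map_surjective {P Q} k := by
    have hm (M : Model) (a : El M P.carrier) (ha : P.Mem a) : ∃ b,
        ev (el k) (ev (nuMap P.carrier) a) = ev (nuMap Q.carrier) b ∧ Q.Mem b :=
      mem_ofPRa.1 ((rep_el k).mem (mem_ofPRa.2 ⟨a, rfl, ha⟩))
    refine ⟨PRa.homMk (nuMapInv _ ∘ₜ el k ∘ₜ nuMap _) fun M a ha => ?_,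
      ((rep_embedding_map (PRa.rep_homMk _ _)).eq_iff (rep_el k)).2 fun M z hz => ?_⟩
    · obtain ⟨b, hb, hb'⟩ := hm M a ha
      simpa [hb] using hb'
    · obtain ⟨a, rfl, ha⟩ := mem_ofPRa.1 hz
      obtain ⟨b, hb, hb'⟩ := hm M a ha
      simp [hb]

/-- Objects with the same elements are isomorphic, by the identity. -/
def isoOfMem {P Q : PRXa} (h : ∀ (M : Model) (z : El M PR.nat), P.Mem z ↔ Q.Mem z) : P ≅ Q where
  hom := homMk xId .id fun M z hz => by rw [ev_xId_of hz.1]; exact (h M z).1 hz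
  inv := homMk xId .id fun M z hz => by rw [ev_xId_of hz.1]; exact (h M z).2 hz
  hom_inv_id := (((rep_homMk _ _ _).comp (rep_homMk _ _ _)).eq_iff (rep_ident _)).2 fun M z hz => by
    rw [ev_comp, ev_xId_of hz.1, ev_xId_of hz.1, ev_ident]
  inv_hom_id := (((rep_homMk _ _ _).comp (rep_homMk _ _ _)).eq_iff (rep_ident _)).2 fun M z hz => by
    rw [ev_comp, ev_xId_of hz.1, ev_xId_of hz.1, ev_ident]

theorem rep_isoOfMem_hom {P Q : PRXa} (h : ∀ (M : Model) (z : El M PR.nat), P.Mem z ↔ Q.Mem z) :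
    Rep (ident PR.nat) (isoOfMem h).hom :=
  Rep.congr (u := xId) ⟨_, rfl⟩ fun M z hz => by rw [ev_xId_of hz.1, ev_ident]

theorem rep_isoOfMem_inv {P Q : PRXa} (h : ∀ (M : Model) (z : El M PR.nat), P.Mem z ↔ Q.Mem z) :
    Rep (ident PR.nat) (isoOfMem h).inv :=
  Rep.congr (u := xId) ⟨_, rfl⟩ fun M z hz => by rw [ev_xId_of hz.1, ev_ident]

/-- A map represented by the identity between objects with the same elements is invertible. -/
theorem Rep.isIso {P Q : PRXa} {u : Term PR.nat PR.nat} {m : P ⟶ Q} (hu : Rep u m)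
    (hm : ∀ (M : Model) (z : El M PR.nat), P.Mem z → ev u z = z)
    (h : ∀ (M : Model) (z : El M PR.nat), P.Mem z ↔ Q.Mem z) : IsIso m := by
  have : m = (isoOfMem h).hom := (hu.eq_iff (rep_isoOfMem_hom h)).2 fun M z hz => by
    rw [hm M z hz, ev_ident]
  rw [this]
  infer_instance

/-- The embedding functors are compatible. -/
noncomputable def embeddingIso : PR.toPRa ⋙ embedding ≅ PR.embedding ⋙ PRX.incl :=
  NatIso.ofComponents
    -- The two objects carry different predicate terms with the same members, so they are compared
    -- by the identity of elements and not by an equality of objects.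
    (fun A => isoOfMem (P := ofPRa (PR.toPRa.obj A)) (Q := PRX.incl.obj (PRX.ofPR A))
      fun M z => by
        have h (a : El M A) : ev (trueT A) a ≠ 0 := by simp
        rw [mem_ofPRa, mem_incl_ofPR]
        exact exists_congr fun a => and_iff_left (h a))
    fun {A B} f => by
      obtain ⟨f, rfl⟩ := mk_surj f
      have hf : PRa.Rep (P := PR.toPRa.obj A) (Q := PR.toPRa.obj B) f (PR.toPRa.map (cls f)) :=
        ⟨_, rfl⟩
      refine (((rep_embedding_map hf).comp (rep_isoOfMem_hom _)).eq_iff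
        ((rep_isoOfMem_hom _).comp (PR.rep_embedding_map f))).2 fun M z hz => ?_
      simp only [ev_comp, ev_ident]
      rfl

theorem rep_embeddingIso (A : PR) : Rep xId (embeddingIso.hom.app A) := ⟨_, rfl⟩

theorem mem_embedding_one {M : Model} {z : El M PR.nat} :
    oneObj.Mem z ↔ (ofPRa PRa.oneObj).Mem z := by
  rw [mem_oneObj, mem_ofPRa]
  constructor
  · rintro rfl
    exact ⟨default, by simp, PRa.mem_oneObj _⟩
  · rintro ⟨a, rfl, -⟩
    simp

theorem mem_embedding_nat {M : Model} {z : El M PR.nat} :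
    natObj.Mem z ↔ (ofPRa PRa.natObj).Mem z := by
  rw [mem_natObj, mem_ofPRa]
  exact exists_congr fun n => ⟨fun h => ⟨by simpa using h, PRa.mem_natObj _⟩, fun h => by simpa using h.1⟩

theorem mem_embedding_prod {M : Model} {z : El M PR.nat} :
    (ofPRa (PRa.prodObj P Q)).Mem z ↔ (prodObj (ofPRa P) (ofPRa Q)).Mem z := by
  rw [mem_ofPRa, mem_prodObj]
  constructor
  · rintro ⟨a, rfl, h⟩
    obtain ⟨a, b, rfl⟩ := exists_mkp a
    have h := (PRa.mem_prodObj a b).1 h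
    exact ⟨_, _, ev_nuMap_mkp a b, mem_ofPRa.2 ⟨a, rfl, h.1⟩, mem_ofPRa.2 ⟨b, rfl, h.2⟩⟩
  · rintro ⟨x, y, rfl, hx, hy⟩
    obtain ⟨a, rfl, ha⟩ := mem_ofPRa.1 hx
    obtain ⟨b, rfl, hb⟩ := mem_ofPRa.1 hy
    exact ⟨mkp a b, (ev_nuMap_mkp a b).symm, (PRa.mem_prodObj a b).2 ⟨ha, hb⟩⟩

/-- Here source and target of a comparison map may differ as predicate terms, but they have the same
members and the map acts as the identity, so `Rep.isIso` applies. -/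
theorem isPRFunctor_embedding : PRa.cartesianPR.IsPRFunctor cartesianPR embedding where
  one := (rep_bangHom (ofPRa PRa.oneObj)).isIso (fun M z hz => by
    rw [ev_xBang_of hz.1]; exact (mem_oneObj.1 (mem_embedding_one.2 hz)).symm)
      fun M z => mem_embedding_one.symm
  prod P Q := (rep_liftHom (rep_embedding_map (PRa.rep_fstHom P Q))
    (rep_embedding_map (PRa.rep_sndHom P Q))).isIso (fun M z hz => by
      obtain ⟨a, rfl, -⟩ := mem_ofPRa.1 hz
      rw [← eqv_iff_ev.1 (twin_pair _ _), ev_twin_nuMap]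
      simp) fun M z => mem_embedding_prod
  nat := by
    refine ⟨isoOfMem fun M z => mem_embedding_nat, ?_, ?_, fun {P} f => ?_⟩
    · refine (((rep_bangHom _).comp (rep_zeroHom.comp (rep_isoOfMem_hom _))).eq_iff
        (rep_embedding_map PRa.rep_zeroHom)).2 fun M z hz => ?_
      rw [mem_oneObj.1 (mem_embedding_one.2 hz), eqv_iff_ev.1 twin_zero]
      simp [ev_xBang_of]
    · refine ((rep_succHom.comp (rep_isoOfMem_hom _)).eq_iff ((rep_isoOfMem_hom _).comp
        (rep_embedding_map PRa.rep_succHom))).2 fun M z hz => ?_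
      simp [eqv_iff_ev.1 twin_succ]
    · refine (((rep_liftHom (rep_embedding_map (PRa.rep_fstHom P PRa.natObj))
        (((rep_embedding_map (PRa.rep_sndHom P PRa.natObj)).comp (rep_isoOfMem_inv _)).congr
          (v := twin (snd P.carrier PR.nat)) fun M z _ => by simp)).comp
        (rep_iterHom (rep_embedding_map (PRa.rep_el f)))).eq_iff
          (rep_embedding_map (PRa.rep_iterHom (PRa.rep_el f)))).2 fun M z hz => ?_
      obtain ⟨a, rfl, -⟩ := mem_ofPRa.1 hz
      rw [eqv_iff_ev.1 (twin_iter _), ev_comp, ev_comp, ← eqv_iff_ev.1 (twin_pair _ _),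
        ev_twin_nuMap, ev_twin_nuMap]
      simp

end PRXa

namespace PRXa

open PR PR.Model Term

variable {P Q R : PRXa}

/-! ### Predicative subobjects and equalisers -/

theorem mono_of_rep_xId {m : P ⟶ Q} (hm : Rep xId m) : Mono m where
  right_cancellation {W} f g e := by
    refine ((rep_el f).eq_iff (rep_el g)).2 fun M z hz => ?_
    have := (((rep_el f).comp hm).eq_iff ((rep_el g).comp hm)).1 e M z hz
    rwa [ev_comp, ev_comp, ev_xId_of ((rep_el f).mem hz).1, ev_xId_of ((rep_el g).mem hz).1] at this

/-- The subobject of an object cut out by a predicate. -/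
def sub (P : PRXa) (c : Term PR.nat PR.nat) : PRXa := ⟨PR.and P.pred c, isPred_and _ _⟩

theorem mem_sub {c : Term PR.nat PR.nat} {M : Model} {z : El M PR.nat} :
    (sub P c).Mem z ↔ P.Mem z ∧ ev c z ≠ 0 :=
  (and_congr_right fun _ => ev_and_ne_zero _ _ _).trans and_assoc.symm

/-- The inclusion of the subobject cut out by a predicate. -/
def subHom (P : PRXa) (c : Term PR.nat PR.nat) : sub P c ⟶ P :=
  homMk xId .id fun M z hz => by rw [ev_xId_of hz.1]; exact (mem_sub.1 hz).1

theorem rep_subHom (P : PRXa) (c : Term PR.nat PR.nat) : Rep xId (subHom P c) := ⟨_, rfl⟩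

/-- As `m` acts as the identity, a factor of `f` has the same values as `f`; the only question is
whether these values lie in `E`. -/
theorem exists_comp_eq_iff {E : PRXa} {m : E ⟶ P} (hm : Rep xId m) (f : Q ⟶ P)
    {u : Term PR.nat PR.nat} (hu : Rep u f) : (∃ k : Q ⟶ E, k ≫ m = f) ↔
      ∀ (M : Model) (z : El M PR.nat), Q.Mem z → E.Mem (ev u z) := by
  constructor
  · rintro ⟨k, rfl⟩ M z hz
    have h := (rep_el k).mem hz
    rw [(hu.eq_iff ((rep_el k).comp hm)).1 rfl M z hz, ev_comp, ev_xId_of h.1]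
    exact h
  · intro h
    have e := (hu.eq_iff (rep_el f)).1 rfl
    refine ⟨homMk (el f) (isPRX_el f) fun M z hz => e M z hz ▸ h M z hz,
      (((rep_homMk _ _ _).comp hm).eq_iff (rep_el f)).2 fun M z hz => ?_⟩
    rw [ev_comp, ev_xId_of ((rep_el f).mem hz).1]

theorem exists_comp_subHom_iff {c : Term PR.nat PR.nat} (f : Q ⟶ P)
    {u : Term PR.nat PR.nat} (hu : Rep u f) :
    (∃ k : Q ⟶ sub P c, k ≫ subHom P c = f) ↔ Implies Q.toObj.pred (c ∘ₜ u) := by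
  rw [exists_comp_eq_iff (rep_subHom P c) f hu, implies_iff_ev]
  refine forall_congr' fun M => forall_congr' fun z => ?_
  have e : ev (c ∘ₜ u) z = ev c (ev u z) := ev_comp _ _ _
  exact ⟨fun h hz => e.trans_ne (mem_sub.1 (h ((mem_toObj _ _).1 hz))).2,
    fun h hz => mem_sub.2 ⟨hu.mem hz, e.symm.trans_ne (h ((mem_toObj _ _).2 hz))⟩⟩

/-- Stated as a criterion for an arbitrary inclusion, so that it also recognises the images under
the embedding of equalisers formed in `PRa`. -/
theorem nonempty_isLimit {f g : P ⟶ Q} {E : PRXa} {m : E ⟶ P} (hm : Rep xId m)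
    (w : m ≫ f = m ≫ g) (h : ∀ (M : Model) (z : El M PR.nat), P.Mem z →
      ev (el f) z = ev (el g) z → E.Mem z) : Nonempty (IsLimit (Fork.ofι m w)) := by
  have := mono_of_rep_xId hm
  have key {W : PRXa} (k : W ⟶ P) (hk : k ≫ f = k ≫ g) : ∃ l : W ⟶ E, l ≫ m = k := by
    refine (exists_comp_eq_iff hm k (rep_el k)).2 fun M z hz => h M _ ((rep_el k).mem hz) ?_
    simpa using (((rep_el k).comp (rep_el f)).eq_iff ((rep_el k).comp (rep_el g))).1 hk M z hz
  exact ⟨Fork.IsLimit.mk' _ fun s => ⟨(key s.ι s.condition).choose,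
    (key s.ι s.condition).choose_spec, fun {l} hl =>
      (cancel_mono m).1 (hl.trans (key s.ι s.condition).choose_spec.symm)⟩⟩

/-- The object is cut out by the equality predicate of two representing elements. That predicate may
be any predicate of `PR`; only the inclusion has to come from the universe monoid. -/
theorem exists_equaliser (f g : P ⟶ Q) : ∃ (E : PRXa) (m : E ⟶ P) (w : m ≫ f = m ≫ g),
    Rep xId m ∧ Nonempty (IsLimit (Fork.ofι m w)) := by
  have hm (M : Model) (z : El M PR.nat) : (sub P (eqT PR.nat (el f) (el g))).Mem z ↔
      P.Mem z ∧ ev (el f) z = ev (el g) z := by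
    rw [mem_sub, ev_eqT_ne_zero]
  have w : subHom P (eqT PR.nat (el f) (el g)) ≫ f = subHom P _ ≫ g :=
    (((rep_subHom _ _).comp (rep_el f)).eq_iff ((rep_subHom _ _).comp (rep_el g))).2
      fun M z hz => by rw [ev_comp, ev_comp, ev_xId_of hz.1]; exact ((hm M z).1 hz).2
  exact ⟨_, _, w, rep_subHom _ _, nonempty_isLimit (rep_subHom _ _) w
    fun M z hz e => (hm M z).2 ⟨hz, e⟩⟩

theorem hasFiniteLimits : HasFiniteLimits PRXa :=
  cartesianPR.hasFiniteLimits fun f g => by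
    obtain ⟨E, m, w, -, h⟩ := exists_equaliser f g
    exact ⟨E, m, w, h⟩

theorem _root_.PRa.hasFiniteLimits : HasFiniteLimits PRa :=
  PRa.cartesianPR.hasFiniteLimits fun f g => ⟨_, _, _, ⟨PRa.isLimitEqHom f g⟩⟩

/-- The inclusion of an equaliser in `PRa` is represented by the identity, so its image acts as the
identity. Cancelling numeralisation brings equality of values back to `PRa`. -/
theorem preservesFiniteLimits_embedding : PreservesFiniteLimits embedding :=
  isPRFunctor_embedding.preservesFiniteLimits fun {P Q} f g =>
    ⟨_, _, PRa.eqHom_condition f g, ⟨PRa.isLimitEqHom f g⟩,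
      nonempty_isLimit ((rep_embedding_map (PRa.rep_eqHom f g)).congr fun M z hz => by
        obtain ⟨a, rfl, -⟩ := mem_ofPRa.1 hz
        rw [ev_xId_of hz.1, ev_twin_nuMap, ev_ident]) _ fun M z hz e => by
          obtain ⟨a, rfl, ha⟩ := mem_ofPRa.1 hz
          refine mem_ofPRa.2 ⟨a, rfl, (PRa.mem_eqObj a).2 ⟨ha, ?_⟩⟩
          rw [((rep_el _).eq_iff (rep_embedding_map (PRa.rep_el f))).1 rfl M _ hz,
            ((rep_el _).eq_iff (rep_embedding_map (PRa.rep_el g))).1 rfl M _ hz] at e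
          simpa using e⟩

/-! ### The truth object and equality predicates -/

theorem _root_.PRa.mem_two {M : Model} {n : El M PR.nat} : PRa.two.Mem n ↔ n = 0 ∨ n = 1 := by
  refine Iff.trans (b := n - 1 = 0) (by simp [PRa.Mem, PRa.two, le]) ?_
  obtain rfl | ⟨n, rfl⟩ := zero_or_S n
  · simp [one_def]
  · rw [one_def, S_sub_S, Model.sub_Z, S_inj]
    simp

theorem mem_two {M : Model} {z : El M PR.nat} :
    (ofPRa PRa.two).Mem z ↔ z = nuE 0 ∨ z = nuE 1 := by
  rw [mem_ofPRa]
  constructor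
  · rintro ⟨n, rfl, h⟩
    exact (PRa.mem_two.1 h).imp (congrArg nuE) (congrArg nuE)
  · rintro (rfl | rfl)
    · exact ⟨(0 : El M PR.nat), rfl, PRa.mem_two.2 (.inl rfl)⟩
    · exact ⟨(1 : El M PR.nat), rfl, PRa.mem_two.2 (.inr rfl)⟩

/-- The truth value false. -/
def ffHom : oneObj ⟶ ofPRa PRa.two := homMk xZero .zero fun M z hz => by
  rw [mem_oneObj.1 hz, ev_xZero_nuE]; exact mem_two.2 (.inl rfl)

/-- The truth value true. -/
def ttHom : oneObj ⟶ ofPRa PRa.two :=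
  homMk (xSucc ∘ₜ xZero) (.comp .zero .succ) fun M z hz => by
    rw [mem_oneObj.1 hz, ev_comp, ev_xZero_nuE, ev_xSucc_nuE]; exact mem_two.2 (.inr rfl)

theorem rep_ffHom : Rep xZero ffHom := ⟨_, rfl⟩
theorem rep_ttHom : Rep (xSucc ∘ₜ xZero) ttHom := ⟨_, rfl⟩

theorem ev_tt {M : Model} {z : El M PR.nat} (hz : P.Mem z) :
    ev ((xSucc ∘ₜ xZero) ∘ₜ xBang) z = nuE 1 := by
  rw [ev_comp, ev_comp, ev_xBang_of hz.1, ev_xZero_nuE, ev_xSucc_nuE]; rfl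

/-- Maps into the universal object defined by case distinction on a truth value. -/
def choice (u v : Term PR.nat PR.nat) : Term PR.nat PR.nat :=
  xFst ∘ₜ xIter (xPair xSnd xSnd) ∘ₜ xPair (xPair v u ∘ₜ xFst) xSnd

/-- One application of `⟨x; y⟩ ↦ ⟨y; y⟩` replaces the first candidate by the second. Zero or one
applications to `⟨v z; u z⟩`, followed by the first projection, therefore select between the two. -/
theorem ev_choice {u v : Term PR.nat PR.nat} {M : Model} {z : El M PR.nat} (hz : X z)
    (hu : X (ev u z)) (hv : X (ev v z)) :
    ev (choice u v) (cpd z (nuE 0)) = ev v z ∧ ev (choice u v) (cpd z (nuE 1)) = ev u z := by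
  have h (n : El M PR.nat) : ev (xPair (xPair v u ∘ₜ xFst) xSnd) (cpd z (nuE n)) =
      cpd (cpd (ev v z) (ev u z)) (nuE n) := by
    have h1 : ev (xPair v u ∘ₜ xFst) (cpd z (nuE n)) = cpd (ev v z) (ev u z) := by
      rw [ev_comp, ev_xFst_cpd hz (X_nuE n), ev_xPair_of hz hv hu]
    have h2 := ev_xSnd_cpd hz (X_nuE n)
    rw [ev_xPair_of, h1, h2]
    · exact (X_cpd _ _).2 ⟨hz, X_nuE n⟩
    · rw [h1]; exact (X_cpd _ _).2 ⟨hv, hu⟩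
    · rw [h2]; exact X_nuE n
  have hX : X (cpd (ev v z) (ev u z)) := (X_cpd _ _).2 ⟨hv, hu⟩
  constructor
  · rw [choice, ev_comp, ev_comp, h, ev_xIter_cpd _ hX, ev_iter_zero, ev_xFst_cpd hv hu]
  · have hs := ev_xSnd_cpd hv hu
    rw [choice, ev_comp, ev_comp, h, ev_xIter_cpd _ hX, one_def, ev_iter_S, ev_iter_zero,
      ev_xPair_of hX (by rwa [hs]) (by rwa [hs]), hs, ev_xFst_cpd hu hu]

theorem isPRX_choice {u v : Term PR.nat PR.nat} (hu : IsPRX u) (hv : IsPRX v) :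
    IsPRX (choice u v) :=
  .comp (.comp (.pair (.comp .fst (.pair hv hu)) .snd) (.iter (.pair .snd .snd))) .fst

theorem mem_prod_two {M : Model} {z : El M PR.nat} : (prodObj P (ofPRa PRa.two)).Mem z ↔
    ∃ x, P.Mem x ∧ (z = cpd x (nuE 0) ∨ z = cpd x (nuE 1)) := by
  rw [mem_prodObj]
  simp only [mem_two]
  constructor
  · rintro ⟨x, y, rfl, hx, rfl | rfl⟩
    · exact ⟨x, hx, .inl rfl⟩
    · exact ⟨x, hx, .inr rfl⟩
  · rintro ⟨x, hx, rfl | rfl⟩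
    · exact ⟨x, _, rfl, hx, .inl rfl⟩
    · exact ⟨x, _, rfl, hx, .inr rfl⟩

/-- A member of the product is `⟨x; ν0⟩` or `⟨x; ν1⟩`, so a map out of it amounts to two maps out of
`A`, and `choice` glues them within the universe monoid. -/
theorem isTruthObject : cartesianPR.IsTruthObject ffHom ttHom := by
  intro A B f g
  have hff : Rep (xPair (ident _) (xZero ∘ₜ xBang))
      (cartesianPR.lift (𝟙 A) (cartesianPR.bang A ≫ ffHom)) :=
    rep_liftHom (rep_ident A) ((rep_bangHom A).comp rep_ffHom)
  have htt : Rep (xPair (ident _) ((xSucc ∘ₜ xZero) ∘ₜ xBang))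
      (cartesianPR.lift (𝟙 A) (cartesianPR.bang A ≫ ttHom)) :=
    rep_liftHom (rep_ident A) ((rep_bangHom A).comp rep_ttHom)
  have ev0 {M : Model} {z : El M PR.nat} (hz : A.Mem z) :
      ev (xPair (ident _) (xZero ∘ₜ xBang)) z = cpd z (nuE 0) := ev_initial hz
  have ev1 {M : Model} {z : El M PR.nat} (hz : A.Mem z) :
      ev (xPair (ident _) ((xSucc ∘ₜ xZero) ∘ₜ xBang)) z = cpd z (nuE 1) := by
    rw [(rep_ident A).ev_xPair ((rep_bangHom A).comp rep_ttHom) hz, ev_tt hz, ev_ident]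
  have key {h : prodObj A (ofPRa PRa.two) ⟶ B} {w : Term PR.nat PR.nat} (hw : Rep w h) :
      (cartesianPR.lift (𝟙 A) (cartesianPR.bang A ≫ ttHom) ≫ h = f ∧
        cartesianPR.lift (𝟙 A) (cartesianPR.bang A ≫ ffHom) ≫ h = g) ↔
      ∀ (M : Model) (z : El M PR.nat), A.Mem z → ev w (cpd z (nuE 1)) = ev (el f) z ∧
        ev w (cpd z (nuE 0)) = ev (el g) z := by
    refine (and_congr ((htt.comp hw).eq_iff (rep_el f)) ((hff.comp hw).eq_iff (rep_el g))).trans ?_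
    constructor
    · intro h M z hz
      have h1 := h.1 M z hz
      have h2 := h.2 M z hz
      rw [ev_comp, ev1 hz] at h1
      rw [ev_comp, ev0 hz] at h2
      exact ⟨h1, h2⟩
    · exact fun h => ⟨fun M z hz => by rw [ev_comp, ev1 hz]; exact (h M z hz).1,
        fun M z hz => by rw [ev_comp, ev0 hz]; exact (h M z hz).2⟩
  have evc {M : Model} {z : El M PR.nat} (hz : A.Mem z) := ev_choice (u := el f) (v := el g) hz.1
    ((rep_el f).mem hz).1 ((rep_el g).mem hz).1
  have hm (M : Model) (z : El M PR.nat) (hz : (prodObj A (ofPRa PRa.two)).Mem z) :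
      B.Mem (ev (choice (el f) (el g)) z) := by
    obtain ⟨x, hx, rfl | rfl⟩ := mem_prod_two.1 hz
    · rw [(evc hx).1]; exact (rep_el g).mem hx
    · rw [(evc hx).2]; exact (rep_el f).mem hx
  refine ⟨homMk (choice (el f) (el g)) (isPRX_choice (isPRX_el f) (isPRX_el g)) hm,
    (key (rep_homMk _ _ _)).2 fun M z hz => (evc hz).symm, fun h hh => ?_⟩
  have hh := (key (rep_el h)).1 hh
  refine ((rep_el h).eq_iff (rep_homMk _ _ _)).2 fun M z hz => ?_
  obtain ⟨x, hx, rfl | rfl⟩ := mem_prod_two.1 hz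
  · rw [(evc hx).1, (hh M x hx).2]
  · rw [(evc hx).2, (hh M x hx).1]

open Classical in
-- Equality is decided before numeralisation: the equality predicate of the carrier is a map of
-- `PR`, so its twin lies in the universe monoid, and injectivity of numeralisation makes it decide
-- equality of codes.
theorem exists_isEqualityPred (P : PRa) :
    ∃ e : prodObj (ofPRa P) (ofPRa P) ⟶ ofPRa PRa.two, cartesianPR.IsEqualityPred ttHom e := by
  let c : Term (PR.prod P.carrier P.carrier) PR.nat :=
    sign ∘ₜ eqT P.carrier (fst _ _) (snd _ _)
  have hc {M : Model} (a b : El M P.carrier) :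
      ev (twin c) (cpd (ev (nuMap P.carrier) a) (ev (nuMap P.carrier) b)) =
        nuE (ev c (mkp a b)) := by
    rw [← ev_nuMap_mkp, ev_twin_nuMap, ev_nuMap_nat]
  have hc' {M : Model} (a b : El M P.carrier) : ev c (mkp a b) = if a = b then 1 else 0 := by
    have := ev_eqT_eq_zero (fst P.carrier P.carrier) (snd _ _) (mkp a b)
    rw [ev_fst_mkp, ev_snd_mkp] at this
    rw [ev_comp, ev_sign]
    by_cases h : a = b
    · rw [if_neg, if_pos h]
      rw [this]; exact not_not.2 h
    · rw [if_pos (this.2 h), if_neg h]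
  have hm (M : Model) (z : El M PR.nat) (hz : (prodObj (ofPRa P) (ofPRa P)).Mem z) :
      (ofPRa PRa.two).Mem (ev (twin c) z) := by
    obtain ⟨x, y, rfl, hx, hy⟩ := mem_prodObj.1 hz
    obtain ⟨a, rfl, -⟩ := mem_ofPRa.1 hx
    obtain ⟨b, rfl, -⟩ := mem_ofPRa.1 hy
    rw [hc, hc', mem_two]
    split_ifs
    · exact .inr rfl
    · exact .inl rfl
  refine ⟨homMk (twin c) (isPRX_twin c) hm, fun {Q} f g => ?_⟩
  refine (((rep_liftHom (rep_el f) (rep_el g)).comp (rep_homMk _ _ hm)).eq_iff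
    ((rep_bangHom Q).comp rep_ttHom)).trans (Iff.trans ?_ ((rep_el f).eq_iff (rep_el g)).symm)
  refine forall_congr' fun M => forall_congr' fun z => forall_congr' fun hz => ?_
  rw [ev_tt hz, ev_comp, (rep_el f).ev_xPair (rep_el g) hz]
  obtain ⟨a, ha, -⟩ := mem_ofPRa.1 ((rep_el f).mem hz)
  obtain ⟨b, hb, -⟩ := mem_ofPRa.1 ((rep_el g).mem hz)
  rw [ha, hb, hc, hc', nuE_inj, nuMap_inj]
  split_ifs with h <;> simp [h]

/-! ### Map equality -/

/-- Equal maps force agreement on `X`; outside `X` both elements take the value `⊥`. -/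
theorem eq_iff_eqv {h k : PRX.incl.obj PRX.univ ⟶ Q} {u v : Term PR.nat PR.nat} (hu : IsPRX u)
    (hv : IsPRX v) (hh : Rep u h) (hk : Rep v k) : h = k ↔ Eqv u v := by
  rw [hh.eq_iff hk, eqv_iff_ev]
  refine forall_congr' fun M => forall_congr' fun z => ⟨fun e => ?_, fun e _ => e⟩
  by_cases hz : X z
  · exact e ⟨hz, (ev_trueT z).trans_ne one_ne_zero⟩
  · rw [ev_eq_bot hu hz, ev_eq_bot hv hz]

open Classical in
-- Precomposing any representing element with the restriction `t` makes it undefined outside the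
-- domain. For uniqueness, `h` prescribes the values on the domain and the last condition those
-- elsewhere.
theorem existsUnique_element {t : Term PR.nat PR.nat} (ht : IsRestriction t P.pred) (h : P ⟶ Q) :
    ∃! w : PR.nat ⟶ PR.nat, ∃ t, cls t = w ∧ IsPRX t ∧ Rep t h ∧
      Eqv (cond P.toObj.pred t (bott PR.nat)) t := by
  -- The conditional equation says that the value is `⊥` outside the domain.
  have hc {u : Term PR.nat PR.nat} : Eqv (cond (and inX P.pred) u (bott PR.nat)) u ↔
      ∀ (M : Model) (z : El M PR.nat), ¬ P.Mem z → ev u z = bot := by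
    rw [eqv_iff_ev]
    refine forall_congr' fun M => forall_congr' fun z => ?_
    rw [ev_cond_of_iff (c := and inX P.pred) (mem_toObj P z), ev_bott]
    split_ifs with hz <;> simp [hz, eq_comm]
  refine ⟨cls (el h ∘ₜ t), ⟨_, rfl, ht.isPRX.comp (isPRX_el h), (rep_el h).congr fun M z hz => ?_,
    hc.2 fun M z hz => ?_⟩, ?_⟩
  · rw [ev_comp, ht.ev_of hz.1 hz.2]
  · rw [ev_comp, ht.ev_of_not hz, ev_eq_bot (isPRX_el h) not_X_bot]
  · rintro _ ⟨u, rfl, -, hu, hu'⟩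
    rw [mk_eq, eqv_iff_ev]
    intro M z
    by_cases hz : P.Mem z
    · rw [ev_comp, ht.ev_of hz.1 hz.2, (hu.eq_iff (rep_el h)).1 rfl M z hz]
    · rw [ev_comp, ht.ev_of_not hz, ev_eq_bot (isPRX_el h) not_X_bot, hc.1 hu' M z hz]

/-! ### The embedding diagram -/

/-- Numeralisation is an isomorphism. -/
def numeralIsoApp (P : PRa) : P ≅ (ofPRa P).toObj where
  hom := PRa.homMk (P := P) (Q := (ofPRa P).toObj) (nuMap P.carrier) fun M a ha =>
    (mem_toObj _ _).2 (mem_ofPRa.2 ⟨a, rfl, ha⟩)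
  inv := PRa.homMk (P := (ofPRa P).toObj) (Q := P) (nuMapInv P.carrier) fun M z hz => by
    obtain ⟨a, rfl, ha⟩ := mem_ofPRa.1 ((mem_toObj _ _).1 hz)
    exact (congrArg P.Mem (nuMapInv_nuMap a)).mpr ha
  hom_inv_id := (((PRa.rep_homMk _ _).comp (PRa.rep_homMk _ _)).eq_iff (PRa.rep_id P)).2
    fun M a ha => (ev_comp _ _ _).trans ((nuMapInv_nuMap a).trans (ev_ident a).symm)
  inv_hom_id := (((PRa.rep_homMk _ _).comp (PRa.rep_homMk _ _)).eq_iff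
    (PRa.rep_id (ofPRa P).toObj)).2 fun M z hz => by
      obtain ⟨a, rfl, ha⟩ := mem_ofPRa.1 ((mem_toObj _ _).1 hz)
      exact (ev_comp _ _ _).trans ((congrArg _ (nuMapInv_nuMap a)).trans (ev_ident _).symm)

theorem rep_numeralIsoApp (P : PRa) : PRa.Rep (P := P) (Q := (ofPRa P).toObj) (nuMap P.carrier)
    (numeralIsoApp P).hom := ⟨_, rfl⟩

/-- Numeralisation is natural. -/
noncomputable def numeralIso : 𝟭 PRa ≅ embedding ⋙ forget :=
  NatIso.ofComponents numeralIsoApp fun {P Q} f =>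
    (((PRa.rep_el f).comp (rep_numeralIsoApp Q)).eq_iff ((rep_numeralIsoApp P).comp
      (rep_embedding_map (PRa.rep_el f)))).2 fun _ a _ =>
        (ev_comp _ _ _).trans ((ev_twin_nuMap _ a).symm.trans (ev_comp _ _ _).symm)

/-- The inclusion in the universal object. -/
def inclUniv (P : PRXa) : P ⟶ PRX.incl.obj PRX.univ :=
  homMk xId .id fun M z hz => by
    rw [ev_xId_of hz.1]; exact ⟨hz.1, (ev_trueT z).trans_ne one_ne_zero⟩

theorem rep_inclUniv (P : PRXa) : Rep xId (inclUniv P) := ⟨_, rfl⟩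

end PRXa

/-! ### Values in `X ∪ {⊥}` -/

namespace PR

open Model

theorem implies_inX_inXbot : Implies inX inXbot :=
  implies_iff_ev.2 fun _ _ hz => (ev_inXbot_ne_zero _).2 (.inl hz)

theorem implies_inXbot_comp {u : Term nat nat} (hu : IsPRX u) : Implies inXbot (inXbot ∘ₜ u) :=
  implies_iff_ev.2 fun _ z _ => by
    rw [ev_comp, ev_inXbot_ne_zero]; exact X_or_eq_bot hu z

end PR

namespace CartesianPR

/-! ### The image of a full embedding -/

/-- Onto its image `F` is fully faithful and bijective on objects, hence strictly invertible, and
the structure of `C` is transported along this equivalence. The inclusion of the image equals `K ⋙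
F` and is thus a composite of p.r. functors. -/
theorem exists_image {C D : Type*} [Category C] [Category D] {S : CartesianPR C}
    {T : CartesianPR D} {F : C ⥤ D} [F.Full] [F.Faithful] (hF : S.IsPRFunctor T F)
    (h : Function.Injective F.obj) :
    ∃ (K : (imageProp F).FullSubcategory ⥤ C) (U : CartesianPR (imageProp F).FullSubcategory),
      toImage F ⋙ K = 𝟭 _ ∧ K ⋙ toImage F = 𝟭 _ ∧ U.IsPRFunctor T (imageProp F).ι ∧
        S.IsPRFunctor U (toImage F) ∧ U.IsPRFunctor S K := by
  have : (toImage F).Full :=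
    .of_comp_faithful_iso ((imageProp F).liftCompιIso F fun X => ⟨X, rfl⟩)
  have : (toImage F).Faithful :=
    .of_comp_iso ((imageProp F).liftCompιIso F fun X => ⟨X, rfl⟩)
  obtain ⟨K, h1, h2⟩ := (toImage F).exists_strict_inverse
    ⟨fun X Y e => h (congrArg (·.obj) e), fun ⟨_, X, e⟩ => ⟨X, ObjectProperty.FullSubcategory.ext e⟩⟩
  let e : C ≌ (imageProp F).FullSubcategory :=
    .mk (toImage F) K (eqToIso h1.symm) (eqToIso h2)
  have hK : (S.transport e).IsPRFunctor S K := S.transport_inverse e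
  have hι : (imageProp F).ι = K ⋙ F := by
    rw [← Functor.id_comp (imageProp F).ι, ← h2]; rfl
  refine ⟨K, S.transport e, h1, h2, ?_, S.transport_functor e, hK⟩
  rw [hι]
  exact hK.comp hF

end CartesianPR

/-! ### The embedding theorem -/

open PR PR.Term in
theorem mainTheorem11 :
    ∃ (SX : CartesianPR PRX) (SA : CartesianPR PRa) (SXa : CartesianPR PRXa)
      (I₀ : PR ⥤ PRX) (I : PRa ⥤ PRXa),
      -- (i) `PRX` is cartesian p.r. by means of the operations of the universe monoid, and
      -- `I₀ : PR ⥤ PRX` is a faithful cartesian p.r. functor given by the numeral twins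
      (SX.one = PRX.one ∧ SX.nat = PRX.nat ∧ SX.prod = PRX.prod ∧
        PRXa.IsStandard SX PRX.incl) ∧
      (∀ A, I₀.obj A = PRX.ofPR A) ∧
      (∀ {A B : PR} (f : Term A B), IsPRX (twin f) ∧
        PRXa.Rep (twin f) (PRX.incl.map (I₀.map (cls f)))) ∧
      I₀.Faithful ∧
      PR.cartesianPR.IsPRFunctor SX I₀ ∧
      -- the laws for numeral twins hold as equations in the monoid of endomaps of `nat` in `PR`
      (∀ {A B : PR} (f g : Term A B), Eqv (twin f) (twin g) ↔ Eqv f g) ∧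
      (∀ {A B C : PR} (f : Term A B) (g : Term B C), Eqv (twin (g ∘ₜ f)) (twin g ∘ₜ twin f)) ∧
      (∀ A : PR, Eqv (twin (bang A)) (xBang ∘ₜ twin (ident A))) ∧
      (∀ A B : PR, Eqv (twin (fst A B)) (xFst ∘ₜ twin (ident (prod A B))) ∧
        Eqv (twin (snd A B)) (xSnd ∘ₜ twin (ident (prod A B)))) ∧
      (∀ {D A B : PR} (f : Term D A) (g : Term D B),
        Eqv (twin (pair f g)) (xPair (twin f) (twin g))) ∧
      (∀ {A A' B B' : PR} (f : Term A A') (g : Term B B'),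
        Eqv (twin (pair (f ∘ₜ fst A B) (g ∘ₜ snd A B))) (xProd (twin f) (twin g))) ∧
      Eqv (twin zero) xZero ∧ Eqv (twin succ) xSucc ∧
      (∀ {A : PR} (f : Term A A),
        Eqv (twin (iter f)) (xIter (twin f) ∘ₜ twin (ident (prod A nat)))) ∧
      -- (ii) `PRXa` inherits the structure of `PRa`: cartesian p.r. structure,
      PRXa.IsStandard SXa (𝟭 PRXa) ∧
      SX.IsPRFunctor SXa PRX.incl ∧
      -- truth object and equality predicates,
      (∃ ff tt : SXa.one ⟶ I.obj PRa.two,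
        PRXa.Rep xZero ff ∧ PRXa.Rep (xSucc ∘ₜ xZero) tt ∧ SXa.IsTruthObject ff tt ∧
        ∀ P : PRa, ∃ e : SXa.prod (I.obj P) (I.obj P) ⟶ I.obj PRa.two,
          SXa.IsEqualityPred tt e) ∧
      -- abstraction of predicates,
      (∀ (P : PRXa) (c : Term nat nat), IsPred c → ∃ (E : PRXa) (m : E ⟶ P),
        PRXa.Rep xId m ∧ Mono m ∧ ∀ {Q : PRXa} (f : Q ⟶ P) (u : Term nat nat), PRXa.Rep u f →
          ((∃ k : Q ⟶ E, k ≫ m = f) ↔ Implies Q.toObj.pred (c ∘ₜ u))) ∧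
      -- equalisers, as predicative subobjects, and hence all finite limits
      (∀ {P Q : PRXa} (f g : P ⟶ Q), ∃ (E : PRXa) (m : E ⟶ P) (w : m ≫ f = m ≫ g),
        PRXa.Rep xId m ∧ Nonempty (IsLimit (Fork.ofι m w))) ∧
      HasFiniteLimits PRa ∧ HasFiniteLimits PRXa ∧
      -- (iii) `I` is a cartesian p.r. embedding which extends `I₀`
      (∀ P, I.obj P = PRXa.ofPRa P) ∧
      (∀ {P Q : PRa} (f : Term P.carrier Q.carrier) (h : P ⟶ Q), PRa.Rep f h →
        PRXa.Rep (twin f) (I.map h)) ∧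
      (∃ a : PR.toPRa ⋙ I ≅ I₀ ⋙ PRX.incl, ∀ A, PRXa.Rep xId (a.hom.app A)) ∧
      SA.IsPRFunctor SXa I ∧
      PreservesFiniteLimits I ∧
      I.Faithful ∧ Function.Injective I.obj ∧
      -- (iv) `I` is a p.r. isomorphism of categories onto its image
      I.Full ∧
      (∃ (K : (imageProp I).FullSubcategory ⥤ PRa)
        (SI : CartesianPR (imageProp I).FullSubcategory),
        toImage I ⋙ K = 𝟭 _ ∧ K ⋙ toImage I = 𝟭 _ ∧
        SI.IsPRFunctor SXa (imageProp I).ι ∧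
        SA.IsPRFunctor SI (toImage I) ∧ SI.IsPRFunctor SA K) ∧
      -- (v) map equality is inherited from `PR`
      (∀ {Q : PRXa} (h k : PRX.incl.obj PRX.univ ⟶ Q) (u v : Term nat nat),
        IsPRX u → IsPRX v → PRXa.Rep u h → PRXa.Rep v k → (h = k ↔ Eqv u v)) ∧
      (∀ P Q : PRXa, ((∃ S, PRX.incl.obj S = P) ∨ ∃ S, I.obj S = P) → ∀ h : P ⟶ Q,
        ∃! w : nat ⟶ nat, ∃ t, cls t = w ∧ IsPRX t ∧ PRXa.Rep t h ∧
          Eqv (cond P.toObj.pred t (bott nat)) t) ∧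
      -- (vi) the embedding diagram
      (∃ b : 𝟭 PRa ≅ I ⋙ PRXa.forget, ∀ P : PRa,
        PRa.Rep (Q := (I.obj P).toObj) (nuMap P.carrier) (b.hom.app P)) ∧
      (∀ P : PRXa, ∃ m : P ⟶ PRX.incl.obj PRX.univ, PRXa.Rep xId m ∧ Mono m) ∧
      Implies inX inXbot ∧
      (∀ u : Term nat nat, IsPRX u → Implies inXbot (inXbot ∘ₜ u)) := by
  refine ⟨PRX.cartesianPR, PRa.cartesianPR, PRXa.cartesianPR, PR.embedding, PRXa.embedding,
    ⟨rfl, rfl, rfl, PRX.isStandard⟩, fun _ => rfl,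
    fun f => ⟨isPRX_twin f, rep_embedding_map f⟩, inferInstance, isPRFunctor_embedding,
    twin_eqv_iff, twin_comp, twin_bang, fun A B => ⟨twin_fst A B, twin_snd A B⟩, twin_pair,
    twin_prod, twin_zero, twin_succ, twin_iter, PRXa.isStandard, PRX.isPRFunctor_incl,
    ⟨PRXa.ffHom, PRXa.ttHom, PRXa.rep_ffHom, PRXa.rep_ttHom, PRXa.isTruthObject,
      PRXa.exists_isEqualityPred⟩,
    fun P c _ => ⟨PRXa.sub P c, PRXa.subHom P c, PRXa.rep_subHom P c,
      PRXa.mono_of_rep_xId (PRXa.rep_subHom P c), fun f _ hu => PRXa.exists_comp_subHom_iff f hu⟩,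
    PRXa.exists_equaliser, PRa.hasFiniteLimits, PRXa.hasFiniteLimits, fun _ => rfl,
    fun _ _ hf => PRXa.rep_embedding_map hf, ⟨PRXa.embeddingIso, PRXa.rep_embeddingIso⟩,
    PRXa.isPRFunctor_embedding, PRXa.preservesFiniteLimits_embedding, inferInstance,
    PRXa.embedding_obj_injective, inferInstance,
    CartesianPR.exists_image PRXa.isPRFunctor_embedding PRXa.embedding_obj_injective,
    fun _ _ _ _ hu hv hh hk => PRXa.eq_iff_eqv hu hv hh hk, ?_,
    ⟨PRXa.numeralIso, PRXa.rep_numeralIsoApp⟩,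
    fun P => ⟨PRXa.inclUniv P, PRXa.rep_inclUniv P, PRXa.mono_of_rep_xId (PRXa.rep_inclUniv P)⟩,
    implies_inX_inXbot, fun _ hu => implies_inXbot_comp hu⟩
  -- For both families of domains a restriction of the identity is available in the universe monoid.
  rintro P Q (⟨S, rfl⟩ | ⟨S, rfl⟩) h
  · obtain ⟨t, ht⟩ := S.exists_isRestriction
    exact PRXa.existsUnique_element (P := PRX.incl.obj S) ht h
  · obtain ⟨t, ht⟩ := exists_isRestriction_image S.pred
    exact PRXa.existsUnique_element (P := PRXa.ofPRa S) ht h
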